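/- **Theorem 3.2 (Absolute cohomologies).** *Matter.* Let $d\ge 2$ be an integer, $\alpha>0$ and $\beta,a$ real, $\eta=\mathrm{diag}(-1,1,\dots,1)$, and let $p\in\mathbb R^{d}$, $p\neq 0$. Let $\mathcal H(p)$ be the algebraic Fock space generated from a vacuum $\omega(p)$ by modes $a^\mu_m$ ($0\le\mu<d$) and $u_m$, $m\in\mathbb Z$, with $[a^\mu_m,a^\nu_n]=m\eta^{\mu\nu}\delta_{m+n}$, $[u_m,u_n]=m\delta_{m+n}$, all other commutators zero, $a^\mu_m\omega(p)=u_m\omega(p)=0$ for $m>0$, $a_0^\mu=p^\mu/\sqrt\alpha$, $u_0=0$. Put $$L_m=\tfrac12\sum_{k}:a_{m+k}\cdot a_{-k}:+\tfrac12\sum_k:u_{m+k}u_{-k}:+2i\sqrt\beta\,m\,u_m+2\beta\delta_{m0},$$ $$\mathcal H_{\rm phys}(p)=\{v\in\mathcal H(p):(L_m-a\delta_{m0})v=0\ \text{for all } m\ge0\}.$$ *Ghosts.* Let $\mathcal C_{\rm gh}$ be the fermionic Fock space of modes $b_m,c_m$, $m\in\mathbb Z$, with $\{b_m,c_n\}=\delta_{m+n}$,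 $\{b_m,b_n\}=\{c_m,c_n\}=0$ and vacuum $\omega$, $c_m\omega=0$ ($m>0$), $b_m\omega=0$ ($m\ge0$). Put $\mathcal L_m=\sum_k(k-m):c_{-k}b_{m+k}:$, $\ {\rm gh}=\sum_m:c_{-m}b_m:$ (with $:c_0b_0:=\frac12(c_0b_0-b_0c_0)$), and $d_{\rm gh}=\frac12\sum_{m>0}c_{-m}\mathcal L_m+\frac12c_0\mathcal L_0+\frac12\sum_{m>0}\mathcal L_{-m}c_m$. *The complexes.* On $\mathcal C(p)=\mathcal H(p)\otimes\mathcal C_{\rm gh}$ let $D=\sum_m(L_m-a\delta_{m0})\otimes c_{-m}+1\otimes d_{\rm gh}$ and $L^{\rm tot}_m=L_m+\mathcal L_m-a\delta_{m0}$. The polarized anomalous complex is $$\mathcal P(p)=\{\Psi\in\mathcal C(p):[L_m^{\rm tot},D]\Psi=0\ \text{for all } m\ge0\},$$ graded by the eigenvalues $r$ of ${\rm gh}$, and $H^r(p)=\ker D|_{\mathcal P^r(p)}\big/D\mathcal P^{r-1}(p)$. The relative complex is $\mathcal P_{\rm rel}(p)=\{\Psi\in\mathcal P(p):L_0^{\rm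 tot}\Psi=0,\ b_0\Psi=0\}$, with differential $D_{\rm rel}=D-L_0^{\rm tot}c_0-Mb_0$, $M=-2\sum_{m>0}m\,c_{-m}c_m$, graded by the eigenvalues of ${\rm gh}_0=\sum_{m\ne0}:c_{-m}b_m:$, and $H^r_{\rm rel}(p)=Z^r_{\rm rel}(p)/B^r_{\rm rel}(p)$ is its cohomology. *Claim.* Assume $(d-25)+48\beta\ne0$ and put $\xi=1+\frac{24(1-a)}{(d-25)+48\beta}$. Assume that $\xi\ne s^2$ for all integers $s\ge2$ (for instance $\xi\le1$). Then $D$ and $D_{\rm rel}$ make $\mathcal P(p)$ and $\mathcal P_{\rm rel}(p)$ complexes, and: 1. $H^r(p)=0$ for $r\ne\pm\frac12$. 2. Every $\Psi\in Z^0_{\rm rel}(p)$ is an absolute cocycle, and $i_-^*:H^0_{\rm rel}(p)\to H^{-1/2}(p)$, $[\Psi]\mapsto[\Psi]$, is a well-defined linear isomorphism. 3. For every $\Psi\in Z^0_{\rm rel}(p)$ there is a primary $P(M\Psi)\in\mathcal P^1_{\rm rel}(p)$, i.e. $D_{\rm rel}P(M\Psi)=M\Psi$; primaries can be chosen to depend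 linearly on $\Psi$ and so that $P(MD_{\rm rel}\chi)=M\chi$ for all $\chi\in\mathcal P^{-1}_{\rm rel}(p)$. For every choice of primaries, $c_0\Psi-P(M\Psi)$ is an absolute cocycle, and $i_+^*:H^0_{\rm rel}(p)\to H^{1/2}(p)$, $[\Psi]\mapsto[c_0\Psi-P(M\Psi)]$, is a well-defined linear isomorphism, independent of the choice. 4. If $\xi\neq1$, then $v\mapsto[v\otimes\omega]$ is an isomorphism $\mathcal H_{\rm phys}(p)\cong H^{-1/2}(p)$, and $c_0(v\otimes\omega)\mapsto[c_0(v\otimes\omega)]$ is an isomorphism $c_0\mathcal H_{\rm phys}(p)\cong H^{1/2}(p)$. 5. If $\xi=1$ (equivalently $a=1$), let $\mathcal G(p)=\{L_{-1}F: F\in\mathcal H(p),\ L_mF=0\ (m>0),\ L_0F=(a-1)F=0\}$. Then $\mathcal G(p)\subseteq\mathcal H_{\rm phys}(p)$, and the same maps induce isomorphisms $\mathcal H_{\rm phys}(p)/\mathcal G(p)\cong H^{-1/2}(p)$ and $c_0\mathcal H_{\rm phys}(p)/c_0\mathcal G(p)\cong H^{1/2}(p)$. -/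

import Mathlib

open scoped TensorProduct

noncomputable section

namespace AnomalousString

/-- The operator `v ↦ ∑ i, f i v` of a family of operators such that, on each vector, only
finitely many members of the family act non-trivially. -/
def locSum {ι V : Type*} [AddCommGroup V] [Module ℂ V] (f : ι → Module.End ℂ V)
    (hf : ∀ v, (Function.support fun i => f i v).Finite) : Module.End ℂ V where
  toFun v := ∑ᶠ i, f i v
  map_add' v w := by
    simp only [map_add]
    exact finsum_add_distrib (hf v) (hf w)
  map_smul' z v := by
    simp only [map_smul, RingHom.id_apply]
    exact (smul_finsum' z (hf v)).symm

/-- The quotient `Z / B` of a subspace `Z` by a subspace `B ≤ Z` (in general, `Z / (Z ∩ B)`). -/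
def Subquot {V : Type*} [AddCommGroup V] [Module ℂ V] (Z B : Submodule ℂ V) : Type _ :=
  ↥Z ⧸ B.submoduleOf Z

instance {V : Type*} [AddCommGroup V] [Module ℂ V] (Z B : Submodule ℂ V) :
    AddCommGroup (Subquot Z B) :=
  inferInstanceAs (AddCommGroup (↥Z ⧸ B.submoduleOf Z))

instance {V : Type*} [AddCommGroup V] [Module ℂ V] (Z B : Submodule ℂ V) :
    Module ℂ (Subquot Z B) :=
  inferInstanceAs (Module ℂ (↥Z ⧸ B.submoduleOf Z))

/-- The class in `Z / B` of an element of `Z`. -/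
def Subquot.mk {V : Type*} [AddCommGroup V] [Module ℂ V] (Z B : Submodule ℂ V) :
    ↥Z →ₗ[ℂ] Subquot Z B :=
  (B.submoduleOf Z).mkQ

/-- A sequence of operators is of annihilation type if every vector is killed by all operators
of sufficiently large index. -/
def AnnType {V : Type*} [AddCommGroup V] [Module ℂ V] (x : ℤ → Module.End ℂ V) : Prop :=
  ∀ v, ∃ K : ℤ, 0 ≤ K ∧ ∀ n, K < n → x n v = 0

/-! ### The matter Fock space -/

/-- Algebraic Fock space: polynomials in the creation operators. The variable `(s, n)` is the
creation operator of frequency `n + 1` and polarisation `s`, where `s = Sum.inl μ` are the `d`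
space-time polarisations and `s = Sum.inr ()` is the Liouville one. The constant polynomial `1`
is the vacuum `ω(p)`. -/
abbrev Fock (d : ℕ) : Type := MvPolynomial ((Fin d ⊕ Unit) × ℕ) ℂ

/-- The `m`-th mode of polarisation `s`; `g = ±1` is the metric coefficient of `s` and `z` the
value of the zero mode, so that `[x_m, x_n] = m g δ_{m+n}`. -/
def boson {d : ℕ} (s : Fin d ⊕ Unit) (g z : ℂ) : ℤ → Module.End ℂ (Fock d)
  | Int.ofNat 0 => z • 1
  | Int.ofNat (n + 1) =>
      (((n : ℂ) + 1) * g) • (MvPolynomial.pderiv (R := ℂ) (s, n)).toLinearMap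
  | Int.negSucc n => LinearMap.mulLeft ℂ (MvPolynomial.X (s, n))

/-- The normal ordered product `:x_i x_j:` (annihilation operators to the right). -/
def nOrd {V : Type*} [AddCommGroup V] [Module ℂ V] (x : ℤ → Module.End ℂ V) (i j : ℤ) :
    Module.End ℂ V :=
  if i ≤ j then x i * x j else x j * x i

theorem nOrd_apply_eq_zero {V : Type*} [AddCommGroup V] [Module ℂ V]
    {x : ℤ → Module.End ℂ V} {v : V} {K : ℤ} (h : ∀ n, K < n → x n v = 0) {i j : ℤ}
    (hij : K < i ∨ K < j) : nOrd x i j v = 0 := by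
  unfold nOrd
  split_ifs with hle
  · simp [h j (by omega)]
  · simp [h i (by omega)]

theorem nOrd_finite {V : Type*} [AddCommGroup V] [Module ℂ V] {x : ℤ → Module.End ℂ V}
    (hx : AnnType x) (m : ℤ) (v : V) :
    (Function.support fun k : ℤ => nOrd x (m + k) (-k) v).Finite := by
  obtain ⟨K, -, h⟩ := hx v
  refine (Set.finite_Icc (-K) (K - m)).subset fun k hk => ?_
  by_contra hn
  rw [Set.mem_Icc] at hn
  exact hk (nOrd_apply_eq_zero h (by omega))

theorem boson_annType {d : ℕ} (s : Fin d ⊕ Unit) (g z : ℂ) : AnnType (boson s g z) := by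
  intro v
  refine ⟨((v.vars.sup fun i => i.2) : ℕ) + 1, by positivity, fun n hn => ?_⟩
  obtain ⟨k, rfl⟩ : ∃ k : ℕ, n = Int.ofNat (k + 1) := ⟨(n - 1).toNat, by simp; omega⟩
  have hk : (s, k) ∉ v.vars := fun hmem => by
    have := Finset.le_sup (f := fun i : (Fin d ⊕ Unit) × ℕ => i.2) hmem
    simp only [Int.ofNat_eq_natCast] at hn
    push_cast at hn
    omega
  change (((k : ℂ) + 1) * g) • MvPolynomial.pderiv (s, k) v = 0
  rw [MvPolynomial.pderiv_eq_zero_of_notMem_vars hk, smul_zero]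

/-- `∑_{k ∈ ℤ} :x_{m+k} x_{-k}:`. -/
def bosonQuad {d : ℕ} (s : Fin d ⊕ Unit) (g z : ℂ) (m : ℤ) : Module.End ℂ (Fock d) :=
  locSum (fun k : ℤ => nOrd (boson s g z) (m + k) (-k)) (nOrd_finite (boson_annType s g z) m)

theorem bosonQuad_annType {d : ℕ} (s : Fin d ⊕ Unit) (g z : ℂ) :
    AnnType (bosonQuad s g z) := by
  intro v
  obtain ⟨K, hK, h⟩ := boson_annType s g z v
  refine ⟨2 * K, by omega, fun n hn => ?_⟩
  change ∑ᶠ k : ℤ, nOrd (boson s g z) (n + k) (-k) v = 0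
  rw [finsum_congr fun k : ℤ => nOrd_apply_eq_zero h (i := n + k) (j := -k) (by omega)]
  simp

/-! ### The ghost space -/

/-- The ghost Fock space: the exterior algebra on the creation operators. The basis vector with
index `n ≤ 0` is `c_n`, the one with index `n > 0` is `b_{-n}`. The unit is the ghost vacuum. -/
abbrev GhostSpace : Type := ExteriorAlgebra ℂ (ℤ →₀ ℂ)

/-- Exterior multiplication by the `n`-th basis vector. -/
def wedge (n : ℤ) : Module.End ℂ GhostSpace :=
  LinearMap.mulLeft ℂ (ExteriorAlgebra.ι ℂ (Finsupp.single n 1))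

/-- Contraction with the `n`-th dual basis vector. -/
def contr (n : ℤ) : Module.End ℂ GhostSpace :=
  CliffordAlgebra.contractLeft (Q := (0 : QuadraticForm ℂ (ℤ →₀ ℂ))) (Finsupp.lapply n)

/-- The ghost modes `c_n`. -/
def ghC (n : ℤ) : Module.End ℂ GhostSpace := if n ≤ 0 then wedge n else contr n

/-- The anti-ghost modes `b_n`. -/
def ghB (n : ℤ) : Module.End ℂ GhostSpace := if 0 ≤ n then contr (-n) else wedge (-n)

theorem contr_bound (w : GhostSpace) :
    ∃ K : ℤ, 0 ≤ K ∧ ∀ n, K < n → contr n w = 0 ∧ contr (-n) w = 0 := by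
  induction w using CliffordAlgebra.left_induction with
  | algebraMap r =>
    exact ⟨0, le_rfl, fun n _ => ⟨CliffordAlgebra.contractLeft_algebraMap _ _ r,
      CliffordAlgebra.contractLeft_algebraMap _ _ r⟩⟩
  | add x y hx hy =>
    obtain ⟨K, hK, h⟩ := hx
    obtain ⟨K', -, h'⟩ := hy
    refine ⟨max K K', by omega, fun n hn => ?_⟩
    rw [map_add, map_add, (h n (by omega)).1, (h' n (by omega)).1, (h n (by omega)).2,
      (h' n (by omega)).2]
    simp
  | ι_mul x v hx =>
    obtain ⟨K, hK, h⟩ := hx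
    refine ⟨K + ∑ i ∈ v.support, |i|, add_nonneg hK (Finset.sum_nonneg fun _ _ => abs_nonneg _),
      fun n hn => ?_⟩
    have hs : 0 ≤ ∑ i ∈ v.support, |i| := Finset.sum_nonneg fun _ _ => abs_nonneg _
    have key : ∀ j : ℤ, |j| = n → contr j x = 0 →
        contr j (CliffordAlgebra.ι (0 : QuadraticForm ℂ (ℤ →₀ ℂ)) v * x) = 0 := by
      intro j hj hjx
      have hv : v j = 0 := by
        by_contra hne
        have := Finset.single_le_sum (f := fun i : ℤ => |i|) (fun _ _ => abs_nonneg _)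
          (Finsupp.mem_support_iff.mpr hne)
        omega
      have e : contr j (CliffordAlgebra.ι (0 : QuadraticForm ℂ (ℤ →₀ ℂ)) v * x)
          = v j • x - CliffordAlgebra.ι (0 : QuadraticForm ℂ (ℤ →₀ ℂ)) v * contr j x :=
        CliffordAlgebra.contractLeft_ι_mul _ _ _
      rw [e, hv, hjx]
      simp
    have hn0 : |n| = n := abs_of_nonneg (by omega)
    exact ⟨key n hn0 (h n (by omega)).1, key (-n) (by rw [abs_neg, hn0]) (h n (by omega)).2⟩

theorem gh_bound (w : GhostSpace) :
    ∃ K : ℤ, 0 ≤ K ∧ ∀ n, K < n → ghC n w = 0 ∧ ghB n w = 0 := by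
  obtain ⟨K, hK, h⟩ := contr_bound w
  refine ⟨K, hK, fun n hn => ?_⟩
  rw [ghC, ghB, if_neg (by omega), if_pos (by omega)]
  exact h n hn

/-- The normal ordered product `:c_i b_j:`, with `:c_0 b_0: = (c_0 b_0 - b_0 c_0) / 2`. -/
def ghOrd (i j : ℤ) : Module.End ℂ GhostSpace :=
  if i = 0 ∧ j = 0 then (1 / 2 : ℂ) • (ghC 0 * ghB 0 - ghB 0 * ghC 0)
  else if 0 < i then -(ghB j * ghC i) else ghC i * ghB j

theorem ghQuad_finite (q : ℤ → ℂ) (m : ℤ) (w : GhostSpace) :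
    (Function.support fun k : ℤ => (q k • ghOrd (-k) (m + k)) w).Finite := by
  obtain ⟨K, hK, h⟩ := gh_bound w
  refine (Set.finite_Icc (-K) (K + |m|)).subset fun k hk => ?_
  by_contra hn
  rw [Set.mem_Icc] at hn
  apply hk
  have hm := neg_abs_le m
  have hm' := abs_nonneg m
  simp only [ghOrd]
  rw [if_neg (by omega)]
  split_ifs with hi
  · simp [(h (-k) (by omega)).1]
  · simp [(h (m + k) (by omega)).2]

/-- `∑_{k ∈ ℤ} q(k) :c_{-k} b_{m+k}:`. -/
def ghQuad (q : ℤ → ℂ) (m : ℤ) : Module.End ℂ GhostSpace :=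
  locSum (fun k : ℤ => q k • ghOrd (-k) (m + k)) (ghQuad_finite q m)

/-- The ghost Virasoro operators `∑_k (k - m) :c_{-k} b_{m+k}:`. -/
def ghL (m : ℤ) : Module.End ℂ GhostSpace := ghQuad (fun k => (k : ℂ) - m) m

/-- The ghost number operator `∑_m :c_{-m} b_m:`. -/
def ghNumber : Module.End ℂ GhostSpace := ghQuad (fun _ => 1) 0

/-- The relative ghost number operator, i.e. `∑_{m ≠ 0} :c_{-m} b_m:`. -/
def ghNumberRel : Module.End ℂ GhostSpace := ghQuad (fun k => if k = 0 then 0 else 1) 0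

theorem ghL_annType : AnnType ghL := by
  intro w
  obtain ⟨K, hK, h⟩ := gh_bound w
  refine ⟨2 * K, by omega, fun n hn => ?_⟩
  change ∑ᶠ k : ℤ, (((k : ℂ) - n) • ghOrd (-k) (n + k)) w = 0
  have key : ∀ k : ℤ, (((k : ℂ) - n) • ghOrd (-k) (n + k)) w = 0 := by
    intro k
    rw [ghOrd, if_neg (by omega)]
    split_ifs with hi
    · by_cases hk : K < -k
      · simp [(h (-k) hk).1]
      · have hb := (h (n + k) (by omega)).2
        rw [ghB, if_pos (by omega)] at hb
        have hc : contr (-(n + k)) (contr (-k) w) = -(contr (-k) (contr (-(n + k)) w)) :=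
          CliffordAlgebra.contractLeft_comm _ _ _
        rw [ghB, ghC, if_pos (by omega), if_neg (by omega)]
        simp only [LinearMap.smul_apply, LinearMap.neg_apply, Module.End.mul_apply, hc, hb,
          map_zero, neg_zero, smul_zero]
    · simp [(h (n + k) (by omega)).2]
  rw [finsum_congr key]
  simp

theorem nat_support_finite {V : Type*} [AddCommGroup V] (f : ℕ → V) (K : ℤ)
    (h : ∀ n : ℕ, K < (n : ℤ) + 1 → f n = 0) : (Function.support f).Finite := by
  refine (Set.finite_Iio (K.toNat + 1)).subset fun n hn => ?_
  by_contra hlt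
  rw [Set.mem_Iio] at hlt
  exact hn (h n (by omega))

/-- The ghost differential
`½ ∑_{m>0} c_{-m} 𝓛_m + ½ c_0 𝓛_0 + ½ ∑_{m>0} 𝓛_{-m} c_m` (with `m = n + 1`). -/
def ghD : Module.End ℂ GhostSpace :=
  (1 / 2 : ℂ) • locSum (fun n : ℕ => ghC (-((n : ℤ) + 1)) * ghL ((n : ℤ) + 1))
      (fun w => by
        obtain ⟨K, -, h⟩ := ghL_annType w
        exact nat_support_finite _ K fun n hn => by simp [h _ hn])
    + (1 / 2 : ℂ) • (ghC 0 * ghL 0)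
    + (1 / 2 : ℂ) • locSum (fun n : ℕ => ghL (-((n : ℤ) + 1)) * ghC ((n : ℤ) + 1))
      (fun w => by
        obtain ⟨K, -, h⟩ := gh_bound w
        exact nat_support_finite _ K fun n hn => by simp [(h _ hn).1])

/-- `M = -2 ∑_{m>0} m c_{-m} c_m` (with `m = n + 1`). -/
def ghM : Module.End ℂ GhostSpace :=
  (-2 : ℂ) • locSum
    (fun n : ℕ => ((n : ℂ) + 1) • (ghC (-((n : ℤ) + 1)) * ghC ((n : ℤ) + 1)))
    (fun w => by
      obtain ⟨K, -, h⟩ := gh_bound w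
      exact nat_support_finite _ K fun n hn => by simp [(h _ hn).1])

/-! ### Massive strings -/

/-- Parameters of a massive string model: space-time dimension `d`, the constants `α`, `β` of
the action, and the intercept `a`. -/
structure Model where
  d : ℕ
  α : ℝ
  β : ℝ
  a : ℝ

namespace Model

variable (S : Model)

/-- The coefficient `(d - 25) + 48 β` of the anomaly. -/
def κ : ℝ := ((S.d : ℝ) - 25) + 48 * S.β

/-- `ξ = 1 + 24 (1 - a) / ((d - 25) + 48 β)`. -/
def ξ : ℝ := 1 + 24 * (1 - S.a) / S.κ

/-- The Minkowski metric `diag(-1, 1, …, 1)`. -/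
def η (μ : Fin S.d) : ℂ := if (μ : ℕ) = 0 then -1 else 1

/-- The value `p^μ / √α` of the zero mode `a^μ_0` at momentum `p`. -/
def aZero (p : Fin S.d → ℝ) (μ : Fin S.d) : ℂ := ((p μ / √S.α : ℝ) : ℂ)

/-- The string modes `a^μ_m` at momentum `p`. -/
def aMode (p : Fin S.d → ℝ) (μ : Fin S.d) : ℤ → Module.End ℂ (Fock S.d) :=
  boson (Sum.inl μ) (S.η μ) (S.aZero p μ)

/-- The Liouville modes `u_m`, with `u_0 = 0`. -/
def uMode : ℤ → Module.End ℂ (Fock S.d) := boson (Sum.inr ()) 1 0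

/-- The Virasoro operators of the matter sector at momentum `p`:
`½ ∑_k :a_{m+k}·a_{-k}: + ½ ∑_k :u_{m+k} u_{-k}: + 2i√β m u_m + 2β δ_{m,0}`,
where `bosonQuad` sums over the modes `aMode` and `uMode` respectively. -/
def L (p : Fin S.d → ℝ) (m : ℤ) : Module.End ℂ (Fock S.d) :=
  (1 / 2 : ℂ) • ∑ μ : Fin S.d,
      S.η μ • bosonQuad (Sum.inl μ) (S.η μ) (S.aZero p μ) m
    + (1 / 2 : ℂ) • bosonQuad (Sum.inr ()) 1 0 m
    + (2 * Complex.I * Complex.sqrt (S.β : ℂ) * m) • S.uMode m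
    + (if m = 0 then 2 * (S.β : ℂ) else 0) • 1

/-- `L_m - h δ_{m,0}`. -/
def Lshift (p : Fin S.d → ℝ) (h : ℝ) (m : ℤ) : Module.End ℂ (Fock S.d) :=
  S.L p m - (if m = 0 then (h : ℂ) else 0) • 1

theorem Lshift_annType (p : Fin S.d → ℝ) (h : ℝ) : AnnType (S.Lshift p h) := by
  intro v
  choose K hK hA using fun μ : Fin S.d =>
    bosonQuad_annType (Sum.inl μ) (S.η μ) (S.aZero p μ) v
  obtain ⟨K₁, hK₁, hU⟩ := bosonQuad_annType (d := S.d) (Sum.inr ()) 1 0 v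
  obtain ⟨K₂, hK₂, hu⟩ := boson_annType (d := S.d) (Sum.inr ()) 1 0 v
  have hs : 0 ≤ ∑ μ, K μ := Finset.sum_nonneg fun μ _ => hK μ
  refine ⟨∑ μ, K μ + K₁ + K₂, by omega, fun n hn => ?_⟩
  have hA' : ∀ μ, bosonQuad (Sum.inl μ) (S.η μ) (S.aZero p μ) n v = 0 := fun μ => by
    have := Finset.single_le_sum (f := K) (fun μ _ => hK μ) (Finset.mem_univ μ)
    exact hA μ n (by omega)
  have hU' := hU n (by omega)
  have hu' := hu n (by omega)
  have hn0 : n ≠ 0 := by omega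
  simp only [Lshift, L, uMode, if_neg hn0, LinearMap.add_apply,
    LinearMap.smul_apply, LinearMap.sum_apply, hA', hU', hu', smul_zero, zero_smul,
    Finset.sum_const_zero, add_zero, sub_zero]

/-- States `v` with `L_m v = 0` for all `m > 0` and `L_0 v = h v`. -/
def highestWeight (p : Fin S.d → ℝ) (h : ℝ) : Submodule ℂ (Fock S.d) :=
  ⨅ m : ℕ, LinearMap.ker (S.Lshift p h m)

/-- The physical states: `(L_m - a δ_{m,0}) v = 0` for `m ≥ 0`. -/
def phys (p : Fin S.d → ℝ) : Submodule ℂ (Fock S.d) := S.highestWeight p S.a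

/-- The states `L_{-1} F`, where `L_m F = 0` for `m > 0` and `L_0 F = (a - 1) F`, so that
`L_{-1} F` has `L_0`-eigenvalue `a`. -/
def gauge (p : Fin S.d → ℝ) : Submodule ℂ (Fock S.d) :=
  (S.highestWeight p (S.a - 1)).map (S.L p (-1))

/-! ### The differential space and the polarized complex at momentum `p` -/

/-- The differential space at fixed momentum. -/
abbrev C : Type := Fock S.d ⊗[ℂ] GhostSpace

/-- A ghost operator acting on the differential space. -/
def gh (x : Module.End ℂ GhostSpace) : Module.End ℂ S.C := TensorProduct.map LinearMap.id x

/-- A matter operator acting on the differential space. -/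
def matter (x : Module.End ℂ (Fock S.d)) : Module.End ℂ S.C := TensorProduct.map x LinearMap.id

theorem D_finite (p : Fin S.d → ℝ) (Ψ : S.C) :
    (Function.support fun m : ℤ =>
      (TensorProduct.map (S.Lshift p S.a m) (ghC (-m)) : Module.End ℂ S.C) Ψ).Finite := by
  induction Ψ using TensorProduct.induction_on with
  | zero => simp
  | tmul v w =>
    obtain ⟨K, -, h⟩ := S.Lshift_annType p S.a v
    obtain ⟨K', -, h'⟩ := gh_bound w
    refine (Set.finite_Icc (-K') K).subset fun m hm => ?_
    by_contra hn
    rw [Set.mem_Icc] at hn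
    apply hm
    simp only [TensorProduct.map_tmul]
    by_cases hlt : K < m
    · rw [h m hlt, TensorProduct.zero_tmul]
    · rw [(h' (-m) (by omega)).1, TensorProduct.tmul_zero]
  | add x y hx hy =>
    refine (hx.union hy).subset fun m hm => ?_
    by_contra hn
    simp only [Set.mem_union, Function.mem_support, not_or, not_not] at hn
    exact hm (by simp only [map_add, hn.1, hn.2, add_zero])

/-- The differential `D = ∑_m (L_m - a δ_{m,0}) ⊗ c_{-m} + 1 ⊗ d_gh`. -/
def D (p : Fin S.d → ℝ) : Module.End ℂ S.C :=
  locSum (fun m : ℤ => TensorProduct.map (S.Lshift p S.a m) (ghC (-m))) (S.D_finite p)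
    + S.gh ghD

/-- The ghost extended constraints `L_m^tot = L_m + 𝓛_m - a δ_{m,0}`. -/
def Ltot (p : Fin S.d → ℝ) (m : ℤ) : Module.End ℂ S.C :=
  S.matter (S.Lshift p S.a m) + S.gh (ghL m)

/-- The polarized anomalous complex: `[L_m^tot, D] Ψ = 0` for all `m ≥ 0`. -/
def P (p : Fin S.d → ℝ) : Submodule ℂ S.C :=
  ⨅ m : ℕ, LinearMap.ker (S.Ltot p m * S.D p - S.D p * S.Ltot p m)

/-- Polarized cochains of ghost number `r`. -/
def Pdeg (p : Fin S.d → ℝ) (r : ℚ) : Submodule ℂ S.C :=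
  S.P p ⊓ Module.End.eigenspace (S.gh ghNumber) (r : ℂ)

/-- Absolute cocycles. -/
def Z (p : Fin S.d → ℝ) (r : ℚ) : Submodule ℂ S.C := S.Pdeg p r ⊓ LinearMap.ker (S.D p)

/-- Absolute coboundaries. -/
def B (p : Fin S.d → ℝ) (r : ℚ) : Submodule ℂ S.C := (S.Pdeg p (r - 1)).map (S.D p)

/-- Absolute cohomology `H^r(p)`. -/
abbrev H (p : Fin S.d → ℝ) (r : ℚ) : Type := Subquot (S.Z p r) (S.B p r)

/-- The class of a cocycle in `H^r(p)`. -/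
def cls (p : Fin S.d → ℝ) (r : ℚ) (Ψ : S.Z p r) : S.H p r :=
  Subquot.mk (S.Z p r) (S.B p r) Ψ

/-- The relative differential `D - L_0^tot c_0 - M b_0`. -/
def Drel (p : Fin S.d → ℝ) : Module.End ℂ S.C :=
  S.D p - S.Ltot p 0 * S.gh (ghC 0) - S.gh ghM * S.gh (ghB 0)

/-- The relative polarized complex: on-mass-shell polarized cochains killed by `b_0`. -/
def Prel (p : Fin S.d → ℝ) : Submodule ℂ S.C :=
  S.P p ⊓ LinearMap.ker (S.Ltot p 0) ⊓ LinearMap.ker (S.gh (ghB 0))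

/-- Relative polarized cochains of relative ghost number `r`. -/
def PrelDeg (p : Fin S.d → ℝ) (r : ℤ) : Submodule ℂ S.C :=
  S.Prel p ⊓ Module.End.eigenspace (S.gh ghNumberRel) (r : ℂ)

/-- Relative cocycles. -/
def Zrel (p : Fin S.d → ℝ) (r : ℤ) : Submodule ℂ S.C :=
  S.PrelDeg p r ⊓ LinearMap.ker (S.Drel p)

/-- Relative coboundaries. -/
def Brel (p : Fin S.d → ℝ) (r : ℤ) : Submodule ℂ S.C := (S.PrelDeg p (r - 1)).map (S.Drel p)

/-- Relative cohomology `H^r_rel(p)`. -/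
abbrev Hrel (p : Fin S.d → ℝ) (r : ℤ) : Type := Subquot (S.Zrel p r) (S.Brel p r)

/-- The class of a relative cocycle in `H^r_rel(p)`. -/
def clsRel (p : Fin S.d → ℝ) (r : ℤ) (Ψ : S.Zrel p r) : S.Hrel p r :=
  Subquot.mk (S.Zrel p r) (S.Brel p r) Ψ

/-- `χ` is a primary of `M Ψ`: a relative cochain of degree one with `D_rel χ = M Ψ`. -/
def IsPrimary (p : Fin S.d → ℝ) (Ψ χ : S.C) : Prop :=
  χ ∈ S.PrelDeg p 1 ∧ S.Drel p χ = S.gh ghM Ψ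

/-- The embedding `v ↦ v ⊗ ω` of matter states, `ω` being the ghost vacuum. -/
def vac : Fock S.d →ₗ[ℂ] S.C := (TensorProduct.mk ℂ (Fock S.d) GhostSpace).flip 1

/-- The map `v ↦ c_0 (v ⊗ ω)`. -/
def cvac : Fock S.d →ₗ[ℂ] S.C := S.gh (ghC 0) ∘ₗ S.vac

/-- The subspace `c_0 H_phys(p)`. -/
def cphys (p : Fin S.d → ℝ) : Submodule ℂ S.C := (S.phys p).map S.cvac

/-- The subspace of `c_0 H_phys(p)` spanned by the `c_0 L_{-1} F`. -/
def cgauge (p : Fin S.d → ℝ) : Submodule ℂ S.C := (S.gauge p).map S.cvac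

end Model

end AnomalousString

end

open AnomalousString

/-! Write `κ = (d - 25) + 48 β`. For `m ≥ 0` one finds `[L_m^tot, D] = A_m c_m` with `A_m = κ m (m²
- ξ) / 12`: the matter central charge `d + 1 + 48 β`, the ghost anomaly and the intercept combine
into this single coefficient (`Lt_comm_D`, `A_eq`). Polarization therefore means `c_m Ψ = 0`
whenever `A_m ≠ 0`. Since `ξ` is not the square of an integer `≥ 2`, the polarized space is the
common kernel `Pann m₀` of the `c_n` with `n ≥ m₀`, where `m₀ = 1` if `ξ ≠ 1` and `m₀ = 2` if `ξ =
1` (`P_eq`). On this space `D² = 0`, because `{D, b_n} = L_n^tot` makes `D²` commute there with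
every `b_n`, `n ≥ 0`, and a vector of positive degree killed by all these `b_n` is zero (`Dt_Dt`).

The relative complex is exact in positive degrees. As `p ≠ 0`, two space-time polarisations have a
complex null combination `x` whose zero mode `ζ` is non-zero. For the homotopy `h = ∑_{m>0} x_{-m}
b_m`, the operator `{h, D}` is `ζ` times a weight operator plus terms that lower a filtration
bounded below. The weight of a word is at least its ghost number, so `{h, D}` is invertible in
positive degrees and `h` contracts the complex there (`hasOrder_laplacian_sub`, `F_le_regularPart`,
`exists_primitive`). Closed vectors of negative degree vanish: for `m₀ = 1` there are no cochains,
and for `m₀ = 2` only the `b_{-1} F`, with `D b_{-1} F = L_{-1} F`, where `L_{-1}` is injective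
because `p ≠ 0` (`LW_neg_one_injective`).

The absolute cohomology follows as in a Gysin sequence. As `L_0^tot = {D, b_0}` is diagonalisable,
everything may be moved to its kernel. There `Ψ = ψ₀ + c_0 ψ₁` with relative `ψ₀`, `ψ₁`, and `D Ψ =
D ψ₀ + M ψ₁ - c_0 D ψ₁`, where `M = {D, c_0}`. With relative cohomology only in degree zero, solving
for `ψ₁` and then for `ψ₀` leaves the degrees `∓1/2`, represented by `Ψ` and by `c_0 Ψ` corrected
with a primary.

Finally, for `m₀ = 1` a relative cocycle of degree zero is `v ⊗ ω` with `v` physical, and there are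
no coboundaries. For `m₀ = 2` the operator `c_1` maps to the `m₀ = 1` complex of intercept `a - 1`;
exactness of the latter in degree one allows any `b_{-1}` to be removed
(`exists_phys_cohomologous`), and the coboundaries are the `L_{-1} F`. -/

open scoped TensorProduct

noncomputable section

namespace AnomalousString

/-! ### Locally finite sums of operators -/

section LocHasSum

variable {ι κ V W : Type*} [AddCommGroup V] [Module ℂ V] [AddCommGroup W] [Module ℂ W]

/-- `X` is the locally finite sum of the operators `f i`. -/
def LocHasSum (f : ι → Module.End ℂ V) (X : Module.End ℂ V) : Prop :=
  ∀ v, (Function.support fun i => f i v).Finite ∧ X v = ∑ᶠ i, f i v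

theorem locHasSum_locSum (f : ι → Module.End ℂ V)
    (hf : ∀ v, (Function.support fun i => f i v).Finite) : LocHasSum f (locSum f hf) :=
  fun v => ⟨hf v, rfl⟩

namespace LocHasSum

variable {f g : ι → Module.End ℂ V} {X Y : Module.End ℂ V}

theorem unique (hX : LocHasSum f X) (hY : LocHasSum f Y) : X = Y :=
  LinearMap.ext fun v => (hX v).2.trans (hY v).2.symm

theorem congr (hX : LocHasSum f X) (h : ∀ i, f i = g i) : LocHasSum g X := by
  rwa [← funext h]

theorem add (hX : LocHasSum f X) (hY : LocHasSum g Y) :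
    LocHasSum (fun i => f i + g i) (X + Y) := fun v => by
  refine ⟨((hX v).1.union (hY v).1).subset (Function.support_add _ _), ?_⟩
  rw [LinearMap.add_apply, (hX v).2, (hY v).2, ← finsum_add_distrib (hX v).1 (hY v).1]
  rfl

theorem mul_left (Z : Module.End ℂ V) (hX : LocHasSum f X) :
    LocHasSum (fun i => Z * f i) (Z * X) := fun v => by
  refine ⟨(hX v).1.subset fun i hi hz => hi ?_, ?_⟩
  · simp only at hz
    simp [hz]
  · rw [Module.End.mul_apply, (hX v).2]
    exact map_finsum Z (hX v).1

theorem mul_right (Z : Module.End ℂ V) (hX : LocHasSum f X) :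
    LocHasSum (fun i => f i * Z) (X * Z) := fun v => hX (Z v)

theorem smul (z : ℂ) (hX : LocHasSum f X) : LocHasSum (fun i => z • f i) (z • X) := by
  have := hX.mul_left (z • (1 : Module.End ℂ V))
  simpa using this

theorem neg (hX : LocHasSum f X) : LocHasSum (fun i => -f i) (-X) := by
  simpa using hX.smul (-1)

theorem sub (hX : LocHasSum f X) (hY : LocHasSum g Y) :
    LocHasSum (fun i => f i - g i) (X - Y) := by
  simpa [sub_eq_add_neg] using hX.add hY.neg

theorem commutator (Z : Module.End ℂ V) (hX : LocHasSum f X) :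
    LocHasSum (fun i => f i * Z - Z * f i) (X * Z - Z * X) :=
  (hX.mul_right Z).sub (hX.mul_left Z)

theorem anticommutator (Z : Module.End ℂ V) (hX : LocHasSum f X) :
    LocHasSum (fun i => f i * Z + Z * f i) (X * Z + Z * X) :=
  (hX.mul_right Z).add (hX.mul_left Z)

theorem comp_equiv (e : κ ≃ ι) (hX : LocHasSum f X) : LocHasSum (fun k => f (e k)) X := fun v =>
  ⟨((hX v).1.preimage e.injective.injOn), (hX v).2.trans (finsum_comp_equiv e).symm⟩

theorem extend (e : κ → ι) (he : Function.Injective e) (hf : ∀ i, i ∉ Set.range e → f i = 0)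
    (hX : LocHasSum (fun k => f (e k)) X) : LocHasSum f X := fun v => by
  have hs : (Function.support fun i => f i v) ⊆ e '' (Function.support fun k => f (e k) v) := by
    intro i hi
    by_cases h : i ∈ Set.range e
    · obtain ⟨k, rfl⟩ := h
      exact ⟨k, hi, rfl⟩
    · exact absurd (by simp [hf i h]) hi
  refine ⟨((hX v).1.image e).subset hs, (hX v).2.trans ?_⟩
  rw [← finsum_mem_range he (f := fun i => f i v)]
  refine (finsum_mem_inter_support_eq _ _ _ ?_).trans (finsum_mem_univ _)
  ext i
  simp only [Set.mem_inter_iff, Set.mem_univ, true_and, and_iff_right_iff_imp]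
  intro hi
  obtain ⟨k, -, rfl⟩ := hs hi
  exact ⟨k, rfl⟩

theorem of_forall_ne (i₀ : ι) (h : ∀ i, i ≠ i₀ → f i = 0) : LocHasSum f (f i₀) := fun v =>
  ⟨(Set.finite_singleton i₀).subset fun i hi => by
    by_contra hne
    exact hi (by simp [h i hne]),
   (finsum_eq_single (fun i => f i v) i₀ fun i hi => by simp [h i hi]).symm⟩

theorem zero : LocHasSum (fun _ : ι => (0 : Module.End ℂ V)) 0 := fun v => by simp

theorem eq_zero (hX : LocHasSum f X) (h : ∀ i, f i = 0) : X = 0 :=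
  (hX.congr h).unique zero

theorem eq_apply (hX : LocHasSum f X) (i₀ : ι) (h : ∀ i, i ≠ i₀ → f i = 0) : X = f i₀ :=
  hX.unique (of_forall_ne i₀ h)

theorem apply_eq_single (hX : LocHasSum f X) (v : V) (i₀ : ι) (h : ∀ i, i ≠ i₀ → f i v = 0) :
    X v = f i₀ v :=
  (hX v).2.trans (finsum_eq_single (fun i => f i v) i₀ h)

theorem apply_eq_zero (hX : LocHasSum f X) (v : V) (h : ∀ i, f i v = 0) : X v = 0 :=
  (hX v).2.trans (by simp [h])

theorem apply_mem (hX : LocHasSum f X) (v : V) (U : Submodule ℂ V) (h : ∀ i, f i v ∈ U) :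
    X v ∈ U := by
  rw [(hX v).2, finsum_eq_sum _ (hX v).1]
  exact U.sum_mem fun i _ => h i

theorem map_apply (hX : LocHasSum f X) (φ : V →ₗ[ℂ] W) (v : V) : φ (X v) = ∑ᶠ i, φ (f i v) := by
  rw [(hX v).2]
  exact map_finsum φ (hX v).1

theorem sum {τ : Type*} (s : Finset τ) (F : τ → ι → Module.End ℂ V) (Y : τ → Module.End ℂ V)
    (h : ∀ t ∈ s, LocHasSum (F t) (Y t)) :
    LocHasSum (fun i => ∑ t ∈ s, F t i) (∑ t ∈ s, Y t) := by
  classical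
  induction s using Finset.induction_on with
  | empty => simpa using zero
  | insert a s ha ih =>
    simp only [Finset.sum_insert ha]
    exact (h a (Finset.mem_insert_self a s)).add
      (ih fun t ht => h t (Finset.mem_insert_of_mem ht))

/-- A sum over `ℤ` splits into the positive, the vanishing and the negative indices. -/
theorem int_split {F : ℤ → Module.End ℂ V} {X Y : Module.End ℂ V}
    (hX : LocHasSum (fun n : ℕ => F ((n : ℤ) + 1)) X)
    (hY : LocHasSum (fun n : ℕ => F (-((n : ℤ) + 1))) Y) : LocHasSum F (X + F 0 + Y) := by
  have h1 : LocHasSum (fun k : ℤ => if 0 < k then F k else 0) X := by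
    refine extend (fun n : ℕ => (n : ℤ) + 1) (fun a b h => by simpa using h) (fun i hi => ?_)
      (hX.congr fun n => by rw [if_pos (by omega)])
    rw [if_neg]
    exact fun h => hi ⟨(i - 1).toNat, by simp; omega⟩
  have h2 : LocHasSum (fun k : ℤ => if k < 0 then F k else 0) Y := by
    refine extend (fun n : ℕ => -((n : ℤ) + 1)) (fun a b h => by simpa using h) (fun i hi => ?_)
      (hY.congr fun n => by rw [if_pos (by omega)])
    rw [if_neg]
    exact fun h => hi ⟨(-i - 1).toNat, by simp; omega⟩
  have h0 : LocHasSum (fun k : ℤ => if k = 0 then F k else 0) (F 0) := by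
    have := of_forall_ne (f := fun k : ℤ => if k = 0 then F k else 0) 0
      (fun i hi => if_neg hi)
    simpa using this
  refine ((h1.add h0).add h2).congr fun k => ?_
  rcases lt_trichotomy k 0 with h | h | h
  · simp [h, h.ne, h.le]
  · simp [h]
  · simp [h, h.ne', h.le]

end LocHasSum

end LocHasSum

/-! ### Eigenvectors -/

section Eigen

variable {V : Type*} [AddCommGroup V] [Module ℂ V]

/-- In a sum of subspaces of eigenspaces, an eigenvector lies in those of its own eigenvalue. -/
theorem mem_iSup_of_eigenvector {ι : Type*} (A : Module.End ℂ V) (G : ι → Submodule ℂ V)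
    (α : ι → ℂ) (hG : ∀ i, G i ≤ A.eigenspace (α i)) (z : ℂ) {v : V} (hv : A v = z • v)
    (h : v ∈ ⨆ i, G i) : v ∈ ⨆ i : {i // α i = z}, G i := by
  have h1 : (⨆ i, G i) ≤ (⨆ i : {i // α i = z}, G i) ⊔ ⨆ j, ⨆ _ : j ≠ z, A.eigenspace j := by
    refine iSup_le fun i => ?_
    by_cases hi : α i = z
    · exact le_sup_of_le_left (le_iSup (fun i : {i // α i = z} => G i) ⟨i, hi⟩)
    · exact le_sup_of_le_right ((hG i).trans (le_iSup₂_of_le (α i) hi le_rfl))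
  obtain ⟨x, hx, y, hy, rfl⟩ := Submodule.mem_sup.mp (h1 h)
  have hxe : x ∈ A.eigenspace z := by
    have : (⨆ i : {i // α i = z}, G i) ≤ A.eigenspace z :=
      iSup_le fun i => (hG i).trans (by rw [i.2])
    exact this hx
  have hye : y ∈ A.eigenspace z := by
    have : y = (x + y) - x := by abel
    rw [this]
    exact Submodule.sub_mem _ (Module.End.mem_eigenspace_iff.mpr hv) hxe
  -- The remainder `y` lies both in the eigenspace of `z` and in the sum of all the others, hence is
  -- zero.
  have := (Submodule.disjoint_def.mp (A.eigenspaces_iSupIndep z)) y hye hy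
  rw [this, add_zero]
  exact hx

/-- Vectors annihilated by a polynomial of an operator with non-zero constant term. -/
def regularPart (T : Module.End ℂ V) : Submodule ℂ V where
  carrier := {v | ∃ q : Polynomial ℂ, q.eval 0 ≠ 0 ∧ Polynomial.aeval T q v = 0}
  zero_mem' := ⟨1, by simp, by simp⟩
  add_mem' := by
    rintro v w ⟨q, hq, hv⟩ ⟨q', hq', hw⟩
    refine ⟨q * q', by simp [hq, hq'], ?_⟩
    rw [map_add, map_mul, Module.End.mul_apply, Module.End.mul_apply, hw, map_zero, add_zero,
      ← Module.End.mul_apply, ← map_mul, mul_comm, map_mul, Module.End.mul_apply, hv, map_zero]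
  smul_mem' := by
    rintro z v ⟨q, hq, hv⟩
    exact ⟨q, hq, by rw [map_smul, hv, smul_zero]⟩

/-- Multiply an annihilating polynomial by `X - z`, whose constant term is non-zero. This is the
induction step for operators of the form "non-zero scalar plus lower order". -/
theorem mem_regularPart_of_sub {T : Module.End ℂ V} {v : V} {z : ℂ} (hz : z ≠ 0)
    (h : T v - z • v ∈ regularPart T) : v ∈ regularPart T := by
  obtain ⟨q, hq, hv⟩ := h
  refine ⟨q * (Polynomial.X - Polynomial.C z), by simp [hq, hz], ?_⟩
  simpa [Module.End.mul_apply, Algebra.algebraMap_eq_smul_one] using hv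

/-- On a subspace preserved by `T`, a vector of the regular part is of the form `T w`. -/
theorem exists_preimage_of_mem_regularPart {T : Module.End ℂ V} {v : V} (h : v ∈ regularPart T)
    (U : Submodule ℂ V) (hU : ∀ u ∈ U, T u ∈ U) (hv : v ∈ U) : ∃ w ∈ U, T w = v := by
  obtain ⟨q, hq, h0⟩ := h
  have hpol : ∀ g : Polynomial ℂ, ∀ u ∈ U, Polynomial.aeval T g u ∈ U := by
    intro g u hu
    induction g using Polynomial.induction_on' with
    | add a b ha hb =>
      rw [map_add, LinearMap.add_apply]
      exact U.add_mem ha hb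
    | monomial n z =>
      rw [Polynomial.aeval_monomial, ← Algebra.smul_def, LinearMap.smul_apply]
      refine U.smul_mem _ ?_
      induction n with
      | zero => simpa using hu
      | succ n ih =>
        rw [pow_succ', Module.End.mul_apply]
        exact hU _ ih
  -- From `q = X · divX q + q(0)` and `q(T) v = 0` one gets `T (divX q)(T) v = -q(0) v`; dividing by
  -- `-q(0)` inverts `T` at `v`.
  refine ⟨(-(q.eval 0)⁻¹) • Polynomial.aeval T q.divX v, U.smul_mem _ (hpol _ _ hv), ?_⟩
  have h1 := congrArg (fun g => Polynomial.aeval T g v) q.divX_mul_X_add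
  simp only [map_add, map_mul, Polynomial.aeval_X, Polynomial.aeval_C, h0, LinearMap.add_apply,
    Module.End.mul_apply, Algebra.algebraMap_eq_smul_one, LinearMap.smul_apply,
    Module.End.one_apply] at h1
  have hc : Polynomial.aeval T q.divX (T v) = T (Polynomial.aeval T q.divX v) := by
    rw [← Module.End.mul_apply, ← Module.End.mul_apply]
    have : Polynomial.aeval T (q.divX * Polynomial.X) = Polynomial.aeval T (Polynomial.X * q.divX) :=
      by rw [mul_comm]
    simpa only [map_mul, Polynomial.aeval_X] using congrArg (fun X => X v) this
  rw [hc, Polynomial.coeff_zero_eq_eval_zero] at h1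
  rw [map_smul, eq_neg_of_add_eq_zero_left h1, smul_neg, neg_smul, neg_neg, smul_smul,
    inv_mul_cancel₀ hq, one_smul]

end Eigen

/-! ### The canonical anticommutation relations of the ghosts -/

/-! ### Graded Leibniz and Jacobi identities. -/

section RingIdentities

variable {R : Type*} [Ring R] (x y z w : R)

theorem mul_anticomm_eq :
    x * y * z + z * (x * y) = (x * z + z * x) * y + x * (y * z - z * y) := by noncomm_ring

theorem mul_anticomm_eq' :
    x * y * z + z * (x * y) = x * (y * z + z * y) - (x * z - z * x) * y := by noncomm_ring

theorem mul_comm_eq_anticomm :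
    x * y * z - z * (x * y) = x * (y * z + z * y) - (x * z + z * x) * y := by noncomm_ring

theorem mul_comm_eq_comm :
    x * y * z - z * (x * y) = (x * z - z * x) * y + x * (y * z - z * y) := by noncomm_ring

theorem comm_anticomm_eq :
    (x * y - y * x) * z + z * (x * y - y * x)
      = (x * (y * z + z * y) - (y * z + z * y) * x)
        - (y * (x * z - z * x) + (x * z - z * x) * y) := by noncomm_ring

theorem comm_comm_eq :
    (x * y - y * x) * z - z * (x * y - y * x)
      = (x * (y * z - z * y) - (y * z - z * y) * x)
        - (y * (x * z - z * x) - (x * z - z * x) * y) := by noncomm_ring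

end RingIdentities


theorem contr_wedge (i j : ℤ) :
    contr i * wedge j + wedge j * contr i = if i = j then 1 else 0 := by
  refine LinearMap.ext fun w => ?_
  have e : contr i (ExteriorAlgebra.ι ℂ (Finsupp.single j 1) * w)
      = (Finsupp.single j (1 : ℂ) i) • w - ExteriorAlgebra.ι ℂ (Finsupp.single j 1) * contr i w :=
    CliffordAlgebra.contractLeft_ι_mul _ _ _
  change contr i (ExteriorAlgebra.ι ℂ (Finsupp.single j 1) * w)
    + ExteriorAlgebra.ι ℂ (Finsupp.single j 1) * contr i w = _
  rw [e, sub_add_cancel]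
  by_cases h : i = j
  · simp [h]
  · simp [h]

theorem contr_contr (i j : ℤ) : contr i * contr j + contr j * contr i = 0 := by
  refine LinearMap.ext fun w => ?_
  have : contr i (contr j w) = -contr j (contr i w) := CliffordAlgebra.contractLeft_comm _ _ _
  simp [this]

theorem wedge_wedge (i j : ℤ) : wedge i * wedge j + wedge j * wedge i = 0 := by
  refine LinearMap.ext fun w => ?_
  have := ExteriorAlgebra.ι_add_mul_swap (R := ℂ) (Finsupp.single i (1 : ℂ)) (Finsupp.single j 1)
  simp only [wedge, LinearMap.add_apply, Module.End.mul_apply, LinearMap.mulLeft_apply,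
    LinearMap.zero_apply, ← mul_assoc, ← add_mul, this, zero_mul]

theorem contr_one (i : ℤ) : contr i 1 = 0 := CliffordAlgebra.contractLeft_one _ _

theorem ghC_ghB (m n : ℤ) :
    ghC m * ghB n + ghB n * ghC m = if m + n = 0 then 1 else 0 := by
  unfold ghC ghB
  split_ifs with h1 h2 h3 h3 h2 h3 h3
  all_goals first | omega | skip
  · rw [add_comm, contr_wedge, if_pos (by omega)]
  · rw [add_comm, contr_wedge, if_neg (by omega)]
  · exact wedge_wedge _ _
  · exact contr_contr _ _
  · rw [contr_wedge, if_pos (by omega)]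
  · rw [contr_wedge, if_neg (by omega)]

theorem ghC_ghC (m n : ℤ) : ghC m * ghC n + ghC n * ghC m = 0 := by
  unfold ghC
  split_ifs with h1 h2 h2
  · exact wedge_wedge _ _
  · rw [add_comm, contr_wedge, if_neg (by omega)]
  · rw [contr_wedge, if_neg (by omega)]
  · exact contr_contr _ _

theorem ghB_ghB (m n : ℤ) : ghB m * ghB n + ghB n * ghB m = 0 := by
  unfold ghB
  split_ifs with h1 h2 h2
  · exact contr_contr _ _
  · rw [contr_wedge, if_neg (by omega)]
  · rw [add_comm, contr_wedge, if_neg (by omega)]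
  · exact wedge_wedge _ _

theorem ghC_vac {m : ℤ} (h : 0 < m) : ghC m 1 = 0 := by
  rw [ghC, if_neg (by omega), contr_one]

theorem ghB_vac {m : ℤ} (h : 0 ≤ m) : ghB m 1 = 0 := by
  rw [ghB, if_pos h, contr_one]

/-- The modes which create from the vacuum, together with those which annihilate it, are all the
exterior multiplications and contractions. -/
theorem wedge_eq (i : ℤ) : wedge i = if i ≤ 0 then ghC i else ghB (-i) := by
  unfold ghC ghB
  split_ifs <;> first | rfl | omega | simp

theorem contr_eq (i : ℤ) : contr i = if i ≤ 0 then ghB (-i) else ghC i := by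
  unfold ghC ghB
  split_ifs <;> first | rfl | omega | simp

/-! ### Ghost systems -/

section GhostSystem

variable {V : Type*} [AddCommGroup V] [Module ℂ V]

/-- The normal ordered product `:c_i b_j:`. -/
def fermiOrd (c b : ℤ → Module.End ℂ V) (i j : ℤ) : Module.End ℂ V :=
  if i = 0 ∧ j = 0 then (1 / 2 : ℂ) • (c 0 * b 0 - b 0 * c 0)
  else if 0 < i then -(b j * c i) else c i * b j

/-- A representation of the ghost modes on a vector space, with their Virasoro operators `L`, their
number operators `N`, `N₀` and their differential `D`. -/
structure GhostSystem (V : Type*) [AddCommGroup V] [Module ℂ V] where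
  c : ℤ → Module.End ℂ V
  b : ℤ → Module.End ℂ V
  L : ℤ → Module.End ℂ V
  N : Module.End ℂ V
  N₀ : Module.End ℂ V
  D : Module.End ℂ V
  annC : AnnType c
  annB : AnnType b
  cb : ∀ m n, c m * b n + b n * c m = if m + n = 0 then 1 else 0
  cc : ∀ m n, c m * c n + c n * c m = 0
  bb : ∀ m n, b m * b n + b n * b m = 0
  sumL : ∀ m : ℤ, LocHasSum (fun k : ℤ => ((k : ℂ) - m) • fermiOrd c b (-k) (m + k)) (L m)
  sumN : LocHasSum (fun k : ℤ => (1 : ℂ) • fermiOrd c b (-k) (0 + k)) N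
  sumN₀ : LocHasSum (fun k : ℤ => (if k = 0 then 0 else 1 : ℂ) • fermiOrd c b (-k) (0 + k)) N₀
  sumD : LocHasSum (fun m : ℤ => if 0 ≤ m then c (-m) * L m else L m * c (-m)) ((2 : ℂ) • D)

theorem eq_zero_of_add_self {V : Type*} [AddCommGroup V] [Module ℂ V] {x : Module.End ℂ V}
    (h : x + x = 0) : x = 0 := by
  rw [← two_smul ℂ] at h
  exact (smul_eq_zero.mp h).resolve_left two_ne_zero

namespace GhostSystem

variable (G : GhostSystem V)

theorem c_mul_c (m n : ℤ) : G.c m * G.c n = -(G.c n * G.c m) :=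
  eq_neg_of_add_eq_zero_left (G.cc m n)

theorem b_mul_b (m n : ℤ) : G.b m * G.b n = -(G.b n * G.b m) :=
  eq_neg_of_add_eq_zero_left (G.bb m n)

theorem c_mul_self (m : ℤ) : G.c m * G.c m = 0 := eq_zero_of_add_self (G.cc m m)

theorem b_mul_self (m : ℤ) : G.b m * G.b m = 0 := eq_zero_of_add_self (G.bb m m)

theorem b_mul_c (m n : ℤ) :
    G.b n * G.c m = (if m + n = 0 then 1 else 0) - G.c m * G.b n := by
  rw [← G.cb, add_sub_cancel_left]

/-- Normal ordering changes a product by a scalar only, so it drops out of every commutator. -/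
theorem ord_eq (i j : ℤ) : ∃ z : ℂ, fermiOrd G.c G.b i j = G.c i * G.b j - z • 1 := by
  unfold fermiOrd
  split_ifs with h h'
  · refine ⟨1 / 2, ?_⟩
    rw [G.b_mul_c, if_pos (by simp), h.1, h.2]
    module
  · refine ⟨if i + j = 0 then 1 else 0, ?_⟩
    rw [G.b_mul_c, neg_sub]
    split_ifs <;> simp
  · exact ⟨0, by simp⟩

theorem ord_comm_c (i j n : ℤ) :
    fermiOrd G.c G.b i j * G.c n - G.c n * fermiOrd G.c G.b i j
      = if n + j = 0 then G.c i else 0 := by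
  obtain ⟨z, hz⟩ := G.ord_eq i j
  have h := mul_comm_eq_anticomm (G.c i) (G.b j) (G.c n)
  rw [hz, sub_mul, mul_sub, smul_mul_assoc, mul_smul_comm, one_mul, mul_one,
    sub_sub_sub_cancel_right, h, add_comm (G.b j * G.c n), G.cb, G.cc]
  split_ifs <;> simp

theorem ord_comm_b (i j n : ℤ) :
    fermiOrd G.c G.b i j * G.b n - G.b n * fermiOrd G.c G.b i j
      = if i + n = 0 then -G.b j else 0 := by
  obtain ⟨z, hz⟩ := G.ord_eq i j
  have h := mul_comm_eq_anticomm (G.c i) (G.b j) (G.b n)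
  rw [hz, sub_mul, mul_sub, smul_mul_assoc, mul_smul_comm, one_mul, mul_one,
    sub_sub_sub_cancel_right, h, G.cb, G.bb]
  split_ifs <;> simp

variable {G} in
-- Of the infinite sum exactly one term fails to commute with a given mode, so no convergence
-- question arises.
theorem quad_comm_c {q : ℤ → ℂ} {m : ℤ} {X : Module.End ℂ V}
    (hX : LocHasSum (fun k => q k • fermiOrd G.c G.b (-k) (m + k)) X) (n : ℤ) :
    X * G.c n - G.c n * X = q (-(m + n)) • G.c (m + n) := by
  have h := (hX.commutator (G.c n)).congr
    (g := fun k => q k • if n + (m + k) = 0 then G.c (-k) else 0) fun k => by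
      rw [smul_mul_assoc, mul_smul_comm, ← smul_sub, G.ord_comm_c]
  rw [h.eq_apply (-(m + n)) fun i hi => by rw [if_neg (by omega), smul_zero], if_pos (by omega),
    neg_neg]

variable {G} in
theorem quad_comm_b {q : ℤ → ℂ} {m : ℤ} {X : Module.End ℂ V}
    (hX : LocHasSum (fun k => q k • fermiOrd G.c G.b (-k) (m + k)) X) (n : ℤ) :
    X * G.b n - G.b n * X = -q n • G.b (m + n) := by
  have h := (hX.commutator (G.b n)).congr
    (g := fun k => q k • if -k + n = 0 then -G.b (m + k) else 0) fun k => by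
      rw [smul_mul_assoc, mul_smul_comm, ← smul_sub, G.ord_comm_b]
  rw [h.eq_apply n fun i hi => by rw [if_neg (by omega), smul_zero], if_pos (by omega),
    smul_neg, neg_smul]

theorem L_comm_c (m n : ℤ) :
    G.L m * G.c n - G.c n * G.L m = -(2 * m + n : ℂ) • G.c (m + n) := by
  rw [quad_comm_c (G.sumL m)]
  congr 1
  push_cast
  ring

theorem L_comm_b (m n : ℤ) :
    G.L m * G.b n - G.b n * G.L m = (m - n : ℂ) • G.b (m + n) := by
  rw [quad_comm_b (G.sumL m)]
  congr 1
  ring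

theorem N_comm_c (n : ℤ) : G.N * G.c n - G.c n * G.N = G.c n := by
  rw [quad_comm_c G.sumN, one_smul, zero_add]

theorem N_comm_b (n : ℤ) : G.N * G.b n - G.b n * G.N = -G.b n := by
  rw [quad_comm_b G.sumN, zero_add, neg_smul, one_smul]

theorem N_eq : G.N = G.N₀ + (G.c 0 * G.b 0 - (1 / 2 : ℂ) • 1) := by
  have h0 := LocHasSum.of_forall_ne
    (f := fun k : ℤ => if k = 0 then fermiOrd G.c G.b 0 0 else 0) 0 (fun i hi => if_neg hi)
  have h := G.sumN.unique ((G.sumN₀.add h0).congr fun k => by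
      by_cases hk : k = 0 <;> simp [hk])
  rw [h, if_pos rfl, fermiOrd, if_pos (by simp), G.b_mul_c, if_pos (by simp)]
  module

theorem N_comm_L (m : ℤ) : G.N * G.L m - G.L m * G.N = 0 := by
  have h := ((G.sumL m).commutator G.N).neg
  have h2 := h.eq_zero fun k => by
    obtain ⟨z, hz⟩ := G.ord_eq (-k) (m + k)
    have h3 := mul_comm_eq_comm (G.c (-k)) (G.b (m + k)) G.N
    have h4 : G.c (-k) * G.N - G.N * G.c (-k) = -G.c (-k) := by
      rw [← neg_sub, G.N_comm_c]
    have h5 : G.b (m + k) * G.N - G.N * G.b (m + k) = G.b (m + k) := by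
      rw [← neg_sub, G.N_comm_b, neg_neg]
    rw [smul_mul_assoc, mul_smul_comm, ← smul_sub, hz, sub_mul, mul_sub, smul_mul_assoc,
      mul_smul_comm, one_mul, mul_one, sub_sub_sub_cancel_right, h3, h4, h5]
    simp
  rwa [neg_sub] at h2

/-! ### The ghost differential -/

/-- In `2 D` each `L_n` arises twice: from contracting `b_n` with the explicit factor `c_{-n}`, and
from `∑ c_{-m} [L_m, b_n]`, which is again the defining sum of `L_n`. -/
theorem D_b (n : ℤ) : G.D * G.b n + G.b n * G.D = G.L n := by
  have h1 := G.sumD.anticommutator (G.b n)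
  have h2 := LocHasSum.of_forall_ne (f := fun m : ℤ => if m = n then G.L n else 0) n
      (fun i hi => if_neg hi)
  have key := h1.unique ((h2.add (G.sumL n)).congr fun m => ?_)
  · have h4 : (2 : ℂ) • (G.D * G.b n + G.b n * G.D) = (2 : ℂ) • G.L n := by
      rw [smul_add, ← smul_mul_assoc, ← mul_smul_comm, key, two_smul, if_pos rfl]
    exact smul_right_injective _ (two_ne_zero' ℂ) h4
  · have hL := G.L_comm_b m n
    have hd : (if m = n then G.L n else 0)
        = (G.c (-m) * G.b n + G.b n * G.c (-m)) * G.L m := by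
      rw [G.cb]
      by_cases h : m = n
      · simp [h]
      · rw [if_neg h, if_neg (by omega), zero_mul]
    have hd' : (if m = n then G.L n else 0)
        = G.L m * (G.c (-m) * G.b n + G.b n * G.c (-m)) := by
      rw [G.cb]
      by_cases h : m = n
      · simp [h]
      · rw [if_neg h, if_neg (by omega), mul_zero]
    by_cases hm : 0 ≤ m
    · have e := mul_anticomm_eq (G.c (-m)) (G.L m) (G.b n)
      rw [if_pos hm, e, ← hd, hL, fermiOrd, add_comm n m]
      -- Only here does the symmetric ordering of `c_0 b_0` differ from the plain product, and then
      -- the coefficient `m - n` vanishes.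
      by_cases h0 : m = 0 ∧ n = 0
      · simp [h0]
      · rw [if_neg (by omega : ¬ (-m = 0 ∧ m + n = 0)), if_neg (by omega : ¬ 0 < -m),
          mul_smul_comm]
    · have e := mul_anticomm_eq' (G.L m) (G.c (-m)) (G.b n)
      rw [if_neg hm, e, ← hd', hL, fermiOrd, if_neg (by omega : ¬ (-m = 0 ∧ n + m = 0)),
        if_pos (by omega : 0 < -m), add_comm n m, smul_mul_assoc, smul_neg]
      exact (sub_eq_add_neg _ _).symm

/-- The anticommutator of the differential with `c_n`. -/
def Q (n : ℤ) : Module.End ℂ V := G.D * G.c n + G.c n * G.D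

/-- The `c`'s anticommute, so only `[L_k, c_n]` contributes to the anticommutator. For `n = 0` this
is the operator `M`. -/
theorem sumQ (n : ℤ) :
    LocHasSum (fun k : ℤ => (-(2 * k + n) / 2 : ℂ) • (G.c (-k) * G.c (k + n))) (G.Q n) := by
  have h := (G.sumD.anticommutator (G.c n)).smul (1 / 2)
  have e : (1 / 2 : ℂ) • ((2 : ℂ) • G.D * G.c n + G.c n * (2 : ℂ) • G.D) = G.Q n := by
    rw [smul_mul_assoc, mul_smul_comm, Q]
    module
  rw [e] at h
  refine h.congr fun m => ?_
  have hL := G.L_comm_c m n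
  have e2 : (-(2 * m + n) / 2 : ℂ) = (1 / 2) * -(2 * m + n : ℂ) := by ring
  rw [e2, mul_smul]
  congr 1
  split_ifs with hm
  · rw [mul_anticomm_eq, G.cc, hL, zero_mul, zero_add, mul_smul_comm, add_comm m n, add_comm n m]
  · rw [mul_anticomm_eq', G.cc, hL, mul_zero, zero_sub, smul_mul_assoc, G.c_mul_c, smul_neg,
      neg_neg]

theorem cc_finite (q : ℤ → ℂ) (i j : ℤ) (w : V) :
    (Function.support fun k : ℤ => (q k • (G.c (i - k) * G.c (k + j))) w).Finite := by
  obtain ⟨K, hK, h⟩ := G.annC w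
  refine (Set.finite_Icc (i - K) (K - j)).subset fun k hk => ?_
  by_contra hn
  rw [Set.mem_Icc] at hn
  apply hk
  by_cases h1 : K < k + j
  · simp [h _ h1]
  · simp [G.c_mul_c (i - k), h (i - k) (by omega)]

/-- `Q_n` transforms like `c_n`. This has to be computed directly: deducing it from the Jacobi
identity would need the value of `[L_m, D]`, which is found only with its help. -/
theorem L_comm_Q (m n : ℤ) :
    G.L m * G.Q n - G.Q n * G.L m = -(2 * m + n : ℂ) • G.Q (m + n) := by
  have hs := ((G.sumQ n).commutator (G.L m)).neg
  rw [neg_sub] at hs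
  -- The shift `k ↦ k + m` turns `c_{m-k} c_{k+n}` into `c_{-k} c_{k+m+n}`, so that both halves of
  -- the commutator become sums over the same products.
  have h1 := (locHasSum_locSum _ (G.cc_finite
    (fun k => (2 * k + n) / 2 * (2 * m - k)) m n)).comp_equiv (Equiv.addRight m)
  have h2 := locHasSum_locSum _ (G.cc_finite
    (fun k => (2 * k + n) / 2 * (2 * m + k + n)) 0 (m + n))
  have h3 := (locHasSum_locSum _ (G.cc_finite
    (fun k => (2 * k + n) / 2 * (2 * m - k)) m n)).add h2
  have h4 := (h1.add h2).unique (((G.sumQ (m + n)).smul (-(2 * m + n : ℂ))).congr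
    fun k => by
      have e1 : m - (k + m) = -k := by ring
      have e2 : k + m + n = k + (m + n) := by ring
      simp only [Equiv.coe_addRight, e1, e2, zero_sub, ← add_smul, smul_smul]
      congr 1
      push_cast
      ring)
  rw [← h4]
  refine hs.unique (h3.congr fun k => ?_)
  have e2 : m - k = m + -k := by ring
  have e3 : k + (m + n) = m + (k + n) := by ring
  have hc : ∀ j, G.c j * G.L m - G.L m * G.c j = (2 * m + j : ℂ) • G.c (m + j) := fun j => by
    rw [← neg_sub, G.L_comm_c, neg_smul, neg_neg]
  rw [smul_mul_assoc, mul_smul_comm, ← smul_sub, mul_comm_eq_comm, hc, hc, e2, e3, zero_sub]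
  rw [smul_mul_assoc, mul_smul_comm]
  push_cast
  module

theorem N_comm_D : G.N * G.D - G.D * G.N = G.D := by
  have h := (G.sumD.commutator G.N).neg
  have h4 : ∀ m, G.c (-m) * G.N - G.N * G.c (-m) = -G.c (-m) := fun m => by
    rw [← neg_sub, G.N_comm_c]
  have h5 : ∀ m, G.L m * G.N - G.N * G.L m = 0 := fun m => by
    rw [← neg_sub, G.N_comm_L, neg_zero]
  have h2 := h.unique (G.sumD.congr fun m => by
    split_ifs
    · rw [mul_comm_eq_comm, h4, h5]
      simp
    · rw [mul_comm_eq_comm, h4, h5]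
      simp)
  rw [neg_sub, smul_mul_assoc, mul_smul_comm, ← smul_sub] at h2
  exact smul_right_injective _ (two_ne_zero' ℂ) h2

/-! ### The Virasoro algebra of the ghosts -/

/-- The failure of the ghost Virasoro operators to represent the Witt algebra. -/
def anomaly (m n : ℤ) : Module.End ℂ V :=
  G.L m * G.L n - G.L n * G.L m - (m - n : ℂ) • G.L (m + n)

/-- By the Jacobi identity `[L_m, L_n]` and `(m - n) L_{m+n}` have the same commutators with the
modes. The anomaly is thus a scalar, determined by its vacuum expectation value. -/
theorem anomaly_comm_c (m n k : ℤ) : G.anomaly m n * G.c k = G.c k * G.anomaly m n := by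
  rw [← sub_eq_zero, anomaly, sub_mul, mul_sub, smul_mul_assoc, mul_smul_comm,
    sub_sub_sub_comm, ← smul_sub, comm_comm_eq, G.L_comm_c, G.L_comm_c, G.L_comm_c]
  simp only [mul_smul_comm, smul_mul_assoc, ← smul_sub, G.L_comm_c]
  have e : n + (m + k) = m + n + k := by ring
  have e' : m + (n + k) = m + n + k := by ring
  rw [e, e']
  push_cast
  module

theorem anomaly_comm_b (m n k : ℤ) : G.anomaly m n * G.b k = G.b k * G.anomaly m n := by
  rw [← sub_eq_zero, anomaly, sub_mul, mul_sub, smul_mul_assoc, mul_smul_comm,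
    sub_sub_sub_comm, ← smul_sub, comm_comm_eq, G.L_comm_b, G.L_comm_b, G.L_comm_b]
  simp only [mul_smul_comm, smul_mul_assoc, ← smul_sub, G.L_comm_b]
  have e : n + (m + k) = m + n + k := by ring
  have e' : m + (n + k) = m + n + k := by ring
  rw [e, e']
  push_cast
  module

theorem L_comm_D_anticomm_c (m n : ℤ) :
    (G.L m * G.D - G.D * G.L m) * G.c n + G.c n * (G.L m * G.D - G.D * G.L m) = 0 := by
  have h := comm_anticomm_eq (G.L m) G.D (G.c n)
  rw [G.L_comm_c] at h
  have e : G.D * G.c n + G.c n * G.D = G.Q n := rfl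
  rw [e, G.L_comm_Q, mul_smul_comm, smul_mul_assoc, ← smul_add] at h
  rw [h]
  exact sub_self _

/-- Once the anomaly is known to be a scalar `z` times `δ_{m+n}`, this and the vanishing
anticommutators with the `c_n` are the relations satisfied by `z c_m`, which identifies `[L_m, D]`.
-/
theorem L_comm_D_anticomm_b (m n : ℤ) :
    (G.L m * G.D - G.D * G.L m) * G.b n + G.b n * (G.L m * G.D - G.D * G.L m)
      = G.anomaly m n := by
  have h := comm_anticomm_eq (G.L m) G.D (G.b n)
  rwa [G.L_comm_b, G.D_b, mul_smul_comm, smul_mul_assoc, ← smul_add, G.D_b] at h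

/-- A vacuum of a ghost system. -/
structure IsVacuum (Ω : V) : Prop where
  c : ∀ m, 0 < m → G.c m Ω = 0
  b : ∀ m, 0 ≤ m → G.b m Ω = 0

variable {G} in
theorem IsVacuum.ord {Ω : V} (hΩ : G.IsVacuum Ω) {i j : ℤ}
    (h : 0 < i ∨ 0 < j ∨ (0 ≤ j ∧ i ≠ 0)) : fermiOrd G.c G.b i j Ω = 0 := by
  unfold fermiOrd
  split_ifs with h1 h2
  · omega
  · simp [hΩ.c i h2]
  · simp [hΩ.b j (by omega)]

variable {G} in
theorem IsVacuum.L {Ω : V} (hΩ : G.IsVacuum Ω) {m : ℤ} (h : 0 ≤ m) : G.L m Ω = 0 :=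
  (G.sumL m).apply_eq_zero _ fun k => by
    by_cases hk : k = 0 ∧ m = 0
    · simp [hk]
    · rw [LinearMap.smul_apply, hΩ.ord (by omega), smul_zero]

variable {G} in
theorem IsVacuum.L_neg_one {Ω : V} (hΩ : G.IsVacuum Ω) : G.L (-1) Ω = G.c 0 (G.b (-1) Ω) := by
  have := (G.sumL (-1)).apply_eq_single Ω 0 fun k hk => by
    rw [LinearMap.smul_apply, hΩ.ord (by omega), smul_zero]
  rw [this]
  simp [fermiOrd]

variable {G} in
theorem IsVacuum.N₀ {Ω : V} (hΩ : G.IsVacuum Ω) : G.N₀ Ω = 0 :=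
  G.sumN₀.apply_eq_zero _ fun k => by
    by_cases hk : k = 0
    · simp [hk]
    · rw [LinearMap.smul_apply, hΩ.ord (by omega), smul_zero]

variable {G} in
theorem IsVacuum.D {Ω : V} (hΩ : G.IsVacuum Ω) : G.D Ω = 0 := by
  have h : (2 : ℂ) • G.D Ω = 0 := G.sumD.apply_eq_zero Ω fun m => by
    split_ifs with hm
    · simp [hΩ.L hm]
    · simp [hΩ.c (-m) (by omega)]
  exact (smul_eq_zero.mp h).resolve_left two_ne_zero

/-- The upper limit is detached from `M` so that induction applies; at `t = M` the value is `-(13 M³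
- M) / 6`. -/
theorem sum_range_anomaly (M t : ℕ) :
    ∑ k ∈ Finset.range t, (-((2 * M - k) * (k + M)) : ℂ)
      = -(2 * M ^ 2 * t + M * (t * (t - 1)) / 2 - (t - 1) * t * (2 * t - 1) / 6) := by
  induction t with
  | zero => simp
  | succ t ih =>
    rw [Finset.sum_range_succ, ih]
    push_cast
    ring

/-- The vacuum expectation value of the anomaly. -/
theorem anomaly_vac {Ω : V} (hΩ : G.IsVacuum Ω) (ε : V →ₗ[ℂ] ℂ) (hε : ε Ω = 1)
    (hc : ∀ m v, m ≤ 0 → ε (G.c m v) = 0) (hb : ∀ m v, m < 0 → ε (G.b m v) = 0)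
    {m : ℤ} (hm : 0 ≤ m) (n : ℤ) :
    ε (G.anomaly m n Ω) = if m + n = 0 then -(13 * (m : ℂ) ^ 3 - m) / 6 else 0 := by
  have hord : ∀ i j v, i + j ≤ 0 → ¬ (i = 0 ∧ j = 0) → ε (fermiOrd G.c G.b i j v) = 0 := by
    intro i j v hij h0
    unfold fermiOrd
    rw [if_neg h0]
    split_ifs with hi
    · simp [hb j _ (by omega)]
    · simp [hc i _ (by omega)]
  have hL : ∀ k v, k ≤ 0 → ε (G.L k v) = 0 := by
    intro k v hk
    rw [(G.sumL k).map_apply]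
    refine (finsum_congr fun j => ?_).trans finsum_zero
    by_cases h0 : j = 0 ∧ k = 0
    · simp [h0]
    · rw [LinearMap.smul_apply, map_smul, hord _ _ _ (by omega) (by omega), smul_zero]
  have hL' : ε (G.L (m + n) Ω) = 0 := by
    by_cases h : 0 ≤ m + n
    · rw [hΩ.L h, map_zero]
    · exact hL _ _ (by omega)
  have hA : ε (G.anomaly m n Ω) = ε (G.L m (G.L n Ω)) := by
    simp [anomaly, hL', hΩ.L hm]
  rw [hA]
  by_cases hn : 0 ≤ n
  · rw [hΩ.L hn, map_zero, map_zero]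
    split_ifs with h
    · have : m = 0 := by omega
      simp [this]
    · rfl
  -- `ε` kills creation modes on the left, so `L_m` has to turn `c_{-k}` into `c_{m-k}`, which must
  -- then contract with `b_{n+k}`. This forces `m + n = 0` and `0 ≤ k < m`.
  have hterm : ∀ k : ℤ, ε (G.L m (((k : ℂ) - n) • fermiOrd G.c G.b (-k) (n + k) Ω))
      = if 0 ≤ k ∧ k < m ∧ m + n = 0 then -((2 * m - k) * (k + m) : ℂ) else 0 := by
    intro k
    by_cases hk : 0 ≤ k ∧ k < -n
    · have e : fermiOrd G.c G.b (-k) (n + k) = G.c (-k) * G.b (n + k) := by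
        rw [fermiOrd, if_neg (by omega), if_neg (by omega)]
      have e1 : ε (G.L m (G.c (-k) (G.b (n + k) Ω)))
          = ε (-(2 * m + (-k : ℤ) : ℂ) • G.c (m + -k) (G.b (n + k) Ω)) := by
        have := congrArg (fun X => ε (X (G.b (n + k) Ω))) (G.L_comm_c m (-k))
        simpa [hc (-k) _ (by omega)] using this
      have e2 : ε (G.c (m + -k) (G.b (n + k) Ω))
          = if 0 ≤ k ∧ k < m ∧ m + n = 0 then 1 else 0 := by
        have := congrArg (fun X => ε (X Ω)) (G.cb (m + -k) (n + k))
        simp only [LinearMap.add_apply, Module.End.mul_apply, map_add,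
          hb (n + k) _ (by omega), add_zero] at this
        by_cases hkm : k < m
        · rw [this]
          by_cases h0 : m + n = 0
          · rw [if_pos (by omega), if_pos (by omega)]
            simpa using hε
          · rw [if_neg (by omega), if_neg (by omega)]
            simp
        · rw [hc _ _ (by omega), if_neg (by omega)]
      rw [e, Module.End.mul_apply, map_smul, map_smul, e1, map_smul, e2]
      split_ifs with h0
      · have : (n : ℂ) = -m := by
          rw [eq_neg_iff_add_eq_zero, add_comm]
          exact_mod_cast h0.2.2
        rw [this]
        push_cast
        simp only [smul_eq_mul]
        ring
      · simp
    · rw [hΩ.ord (by omega), if_neg (by omega)]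
      simp
  have hsum : ε (G.L m (G.L n Ω)) = ∑ᶠ k : ℤ,
      if 0 ≤ k ∧ k < m ∧ m + n = 0 then -((2 * m - k) * (k + m) : ℂ) else 0 := by
    rw [show ε (G.L m (G.L n Ω)) = (ε ∘ₗ G.L m) (G.L n Ω) from rfl, (G.sumL n).map_apply]
    exact finsum_congr fun k => hterm k
  rw [hsum]
  split_ifs with h
  · obtain ⟨M, rfl⟩ := Int.eq_ofNat_of_zero_le hm
    rw [finsum_eq_sum_of_support_subset (s := (Finset.range M).map Nat.castEmbedding),
      Finset.sum_map]
    · have := sum_range_anomaly M M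
      rw [Finset.sum_congr rfl fun k hk => if_pos (by
        simp only [Finset.mem_range] at hk
        simp only [Nat.castEmbedding_apply]
        omega)]
      simp only [Nat.castEmbedding_apply, Int.cast_natCast]
      rw [this]
      ring
    · intro k hk
      by_contra hn
      refine hk (if_neg fun h' => hn ?_)
      simp only [Finset.coe_map, Set.mem_image, Finset.mem_coe, Finset.mem_range]
      exact ⟨k.toNat, by omega, by simp; omega⟩
  · exact (finsum_congr fun k => if_neg (by omega)).trans finsum_zero

end GhostSystem

end GhostSystem

/-! ### Vectors annihilated by contractions -/

section FermiSpan

variable {V : Type*} [AddCommGroup V] [Module ℂ V]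

/-- Words in the creation operators `w i`, `i ∈ A`, applied to vectors of `V₀`, with the sum of
the degrees of their letters. -/
inductive FermiWord (w : ℤ → Module.End ℂ V) (V₀ : Submodule ℂ V) (deg : ℤ → ℤ) (A : Set ℤ) :
    ℤ → V → Prop
  | base {v : V} (h : v ∈ V₀) : FermiWord w V₀ deg A 0 v
  | step {i q : ℤ} {v : V} (hi : i ∈ A) (h : FermiWord w V₀ deg A q v) :
      FermiWord w V₀ deg A (q + deg i) (w i v)

/-- The span of the words with letters in `A`. -/
def fermiSpan (w : ℤ → Module.End ℂ V) (V₀ : Submodule ℂ V) (deg : ℤ → ℤ) (A : Set ℤ) :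
    Submodule ℂ V :=
  Submodule.span ℂ {v | ∃ q, FermiWord w V₀ deg A q v}

variable {w d : ℤ → Module.End ℂ V} {V₀ : Submodule ℂ V} {deg : ℤ → ℤ} {A B : Set ℤ}

theorem FermiWord.mono (hAB : A ⊆ B) {q : ℤ} {v : V} (h : FermiWord w V₀ deg A q v) :
    FermiWord w V₀ deg B q v := by
  induction h with
  | base h => exact .base h
  | step hi _ ih => exact .step (hAB hi) ih

theorem fermiSpan_mono (hAB : A ⊆ B) : fermiSpan w V₀ deg A ≤ fermiSpan w V₀ deg B :=
  Submodule.span_mono fun _ ⟨q, hq⟩ => ⟨q, hq.mono hAB⟩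

theorem wedge_mem_fermiSpan {i : ℤ} (hi : i ∈ A) {v : V} (h : v ∈ fermiSpan w V₀ deg A) :
    w i v ∈ fermiSpan w V₀ deg A := by
  refine (Submodule.span_le.mpr ?_ : fermiSpan w V₀ deg A ≤ (fermiSpan w V₀ deg A).comap (w i)) h
  rintro v ⟨q, hq⟩
  exact Submodule.subset_span ⟨_, hq.step hi⟩

theorem exists_finset_fermiSpan {v : V} (h : v ∈ fermiSpan w V₀ deg Set.univ) :
    ∃ J : Finset ℤ, v ∈ fermiSpan w V₀ deg J := by
  classical
  induction h using Submodule.span_induction with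
  | mem v hv =>
    obtain ⟨q, hq⟩ := hv
    induction hq with
    | base h => exact ⟨∅, Submodule.subset_span ⟨0, .base h⟩⟩
    | @step i _ _ _ _ ih =>
      obtain ⟨J, hJ⟩ := ih
      exact ⟨insert i J, wedge_mem_fermiSpan (by simp)
        (fermiSpan_mono (Finset.coe_subset.mpr (Finset.subset_insert i J)) hJ)⟩
  | zero => exact ⟨∅, Submodule.zero_mem _⟩
  | add x y _ _ hx hy =>
    obtain ⟨J, hJ⟩ := hx
    obtain ⟨J', hJ'⟩ := hy
    exact ⟨J ∪ J', Submodule.add_mem _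
      (fermiSpan_mono (Finset.coe_subset.mpr Finset.subset_union_left) hJ)
      (fermiSpan_mono (Finset.coe_subset.mpr Finset.subset_union_right) hJ')⟩
  | smul z x _ hx =>
    obtain ⟨J, hJ⟩ := hx
    exact ⟨J, Submodule.smul_mem _ z hJ⟩

/-- The product `d_i w_i` is the projection onto the words free of the letter `i`. -/
theorem contr_wedge_mem_fermiSpan
    (hdw : ∀ i j, d i * w j + w j * d i = if i = j then 1 else 0)
    (hww : ∀ i j, w i * w j + w j * w i = 0) (hd : ∀ i, ∀ v ∈ V₀, d i v = 0)
    {i : ℤ} {v : V} (h : v ∈ fermiSpan w V₀ deg (insert i A)) :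
    d i (w i v) ∈ fermiSpan w V₀ deg A := by
  refine (Submodule.span_le.mpr ?_ : fermiSpan w V₀ deg (insert i A) ≤
    (fermiSpan w V₀ deg A).comap (d i * w i)) h
  rintro v ⟨q, hq⟩
  change d i (w i v) ∈ fermiSpan w V₀ deg A
  have hself : ∀ u, w i (w i u) = 0 := fun u =>
    congrArg (fun X => X u) (eq_zero_of_add_self (hww i i))
  induction hq with
  | @base v h =>
    have := congrArg (fun X => X v) (hdw i i)
    simp only [LinearMap.add_apply, Module.End.mul_apply, hd i v h, map_zero, add_zero,
      if_true, Module.End.one_apply] at this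
    rw [this]
    exact Submodule.subset_span ⟨0, .base h⟩
  | @step j q v hj _ ih =>
    by_cases hij : j = i
    · rw [hij, hself, map_zero]
      exact Submodule.zero_mem _
    · have h1 := congrArg (fun X => X v) (hww i j)
      have h2 := congrArg (fun X => X (w i v)) (hdw i j)
      rw [if_neg (Ne.symm hij)] at h2
      simp only [LinearMap.add_apply, Module.End.mul_apply, LinearMap.zero_apply] at h1 h2
      rw [eq_neg_of_add_eq_zero_left h1, map_neg, eq_neg_of_add_eq_zero_left h2, neg_neg]
      exact wedge_mem_fermiSpan (hj.resolve_left hij) ih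

/-- A vector annihilated by the contractions `d i`, `i ∉ A`, is spanned by words with letters
in `A`. -/
theorem mem_fermiSpan_of_contr_eq_zero
    (hdw : ∀ i j, d i * w j + w j * d i = if i = j then 1 else 0)
    (hww : ∀ i j, w i * w j + w j * w i = 0) (hd : ∀ i, ∀ v ∈ V₀, d i v = 0)
    {v : V} (h : v ∈ fermiSpan w V₀ deg Set.univ) (hv : ∀ i, i ∉ A → d i v = 0) :
    v ∈ fermiSpan w V₀ deg A := by
  classical
  obtain ⟨J, hJ⟩ := exists_finset_fermiSpan h
  have hJ' : v ∈ fermiSpan w V₀ deg (A ∪ J) := fermiSpan_mono Set.subset_union_right hJ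
  clear hJ h
  induction J using Finset.induction_on with
  | empty => simpa using hJ'
  | insert i J _ ih =>
    refine ih ?_
    have hins : A ∪ ((insert i J : Finset ℤ) : Set ℤ) = insert i (A ∪ J) := by
      rw [Finset.coe_insert, Set.union_insert]
    rw [hins] at hJ'
    by_cases hi : i ∈ A
    · rwa [Set.insert_eq_of_mem (Set.mem_union_left _ hi)] at hJ'
    -- Since `d_i v = 0`, the anticommutator gives `v = d_i w_i v`, so the projection removes the
    -- letter `i` without changing `v`.
    · have h1 := contr_wedge_mem_fermiSpan hdw hww hd hJ'
      have h2 := congrArg (fun X => X v) (hdw i i)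
      simp only [LinearMap.add_apply, Module.End.mul_apply, hv i hi, map_zero, add_zero,
        if_true, Module.End.one_apply] at h2
      rwa [h2] at h1

end FermiSpan

/-! ### The ghost Fock space -/

theorem annType_ghC : AnnType ghC := fun w => by
  obtain ⟨K, hK, h⟩ := gh_bound w
  exact ⟨K, hK, fun n hn => (h n hn).1⟩

theorem annType_ghB : AnnType ghB := fun w => by
  obtain ⟨K, hK, h⟩ := gh_bound w
  exact ⟨K, hK, fun n hn => (h n hn).2⟩

theorem locHasSum_ghD :
    LocHasSum (fun m : ℤ => if 0 ≤ m then ghC (-m) * ghL m else ghL m * ghC (-m))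
      ((2 : ℂ) • ghD) := by
  have h := LocHasSum.int_split
    (F := fun m : ℤ => if 0 ≤ m then ghC (-m) * ghL m else ghL m * ghC (-m))
    ((locHasSum_locSum (fun n : ℕ => ghC (-((n : ℤ) + 1)) * ghL ((n : ℤ) + 1)) (fun w => by
        obtain ⟨K, -, h⟩ := ghL_annType w
        exact nat_support_finite _ K fun n hn => by simp [h _ hn])).congr fun n => by
      rw [if_pos (by omega)])
    ((locHasSum_locSum (fun n : ℕ => ghL (-((n : ℤ) + 1)) * ghC ((n : ℤ) + 1)) (fun w => by
        obtain ⟨K, -, h⟩ := gh_bound w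
        exact nat_support_finite _ K fun n hn => by simp [(h _ hn).1])).congr fun n => by
      rw [if_neg (by omega), neg_neg])
  convert h using 1
  rw [ghD, if_pos le_rfl, neg_zero]
  module

/-- The ghost system of the ghost Fock space. -/
def ghostSystem : GhostSystem GhostSpace where
  c := ghC
  b := ghB
  L := ghL
  N := ghNumber
  N₀ := ghNumberRel
  D := ghD
  annC := annType_ghC
  annB := annType_ghB
  cb := ghC_ghB
  cc := ghC_ghC
  bb := ghB_ghB
  sumL m := locHasSum_locSum _ (ghQuad_finite _ m)
  sumN := locHasSum_locSum _ (ghQuad_finite _ 0)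
  sumN₀ := locHasSum_locSum _ (ghQuad_finite _ 0)
  sumD := locHasSum_ghD

theorem isVacuum_one : ghostSystem.IsVacuum (1 : GhostSpace) where
  c _ h := ghC_vac h
  b _ h := ghB_vac h

/-- A subspace of the ghost space which contains the vacuum and is stable under the modes is the
whole space. -/
theorem ghost_induction (U : Submodule ℂ GhostSpace) (h1 : (1 : GhostSpace) ∈ U)
    (hw : ∀ i, ∀ w ∈ U, wedge i w ∈ U) (w : GhostSpace) : w ∈ U := by
  induction w using CliffordAlgebra.left_induction with
  | algebraMap r =>
    rw [Algebra.algebraMap_eq_smul_one]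
    exact U.smul_mem _ h1
  | add x y hx hy => exact U.add_mem hx hy
  | ι_mul x v hx =>
    induction v using Finsupp.induction_linear with
    | zero => simp
    | add v w hv hw =>
      rw [map_add, add_mul]
      exact U.add_mem hv hw
    | single i z =>
      have : CliffordAlgebra.ι (0 : QuadraticForm ℂ (ℤ →₀ ℂ)) (Finsupp.single i z) * x
          = z • wedge i x := by
        have e : Finsupp.single i z = z • Finsupp.single i (1 : ℂ) := by simp
        rw [e, map_smul, smul_mul_assoc]
        rfl
      rw [this]
      exact U.smul_mem _ (hw i x hx)

theorem ghost_ext {X Y : Module.End ℂ GhostSpace} (h1 : X 1 = Y 1)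
    (hw : ∀ i w, X w = Y w → X (wedge i w) = Y (wedge i w)) : X = Y :=
  LinearMap.ext fun w => ghost_induction (LinearMap.eqLocus X Y) h1 (fun i w h => hw i w h) w

theorem mem_fermiSpan_univ (w : GhostSpace) :
    w ∈ fermiSpan wedge (Submodule.span ℂ {1}) (fun _ => 0) Set.univ :=
  ghost_induction (fermiSpan wedge (Submodule.span ℂ {1}) (fun _ => 0) Set.univ)
    (Submodule.subset_span ⟨0, .base (Submodule.mem_span_singleton_self 1)⟩)
    (fun i _ h => wedge_mem_fermiSpan (Set.mem_univ i) h) w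

/-- A vector annihilated by all contractions is a multiple of the vacuum. -/
theorem eq_smul_one_of_contr_eq_zero {w : GhostSpace} (h : ∀ i, contr i w = 0) :
    w = ExteriorAlgebra.algebraMapInv w • 1 := by
  have hw := mem_fermiSpan_of_contr_eq_zero (w := wedge) (d := contr)
    (V₀ := Submodule.span ℂ {(1 : GhostSpace)}) (deg := fun _ => 0) (A := ∅) contr_wedge wedge_wedge
    (fun i v hv => by
      obtain ⟨z, rfl⟩ := Submodule.mem_span_singleton.mp hv
      rw [map_smul, contr_one, smul_zero]) (mem_fermiSpan_univ w) (fun i _ => h i)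
  have h0 : w ∈ Submodule.span ℂ {(1 : GhostSpace)} := by
    refine (Submodule.span_le.mpr ?_ : fermiSpan wedge _ _ ∅ ≤ _) hw
    rintro v ⟨q, hq⟩
    cases hq with
    | base h => exact h
    | step hi _ => exact absurd hi (Set.notMem_empty _)
  obtain ⟨z, rfl⟩ := Submodule.mem_span_singleton.mp h0
  simp

theorem algebraMapInv_wedge (i : ℤ) (w : GhostSpace) :
    ExteriorAlgebra.algebraMapInv (wedge i w) = 0 := by
  change ExteriorAlgebra.algebraMapInv (ExteriorAlgebra.ι ℂ (Finsupp.single i 1) * w) = 0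
  rw [map_mul]
  simp [ExteriorAlgebra.algebraMapInv]

/-- The Virasoro algebra of the ghosts. -/
theorem ghL_anomaly {m : ℤ} (hm : 0 ≤ m) (n : ℤ) :
    ghostSystem.anomaly m n
      = (if m + n = 0 then -(13 * (m : ℂ) ^ 3 - m) / 6 else 0 : ℂ) • 1 := by
  have hwedge : ∀ i w, ghostSystem.anomaly m n (wedge i w)
      = wedge i (ghostSystem.anomaly m n w) := fun i w => by
    rw [wedge_eq]
    split_ifs
    · exact congrArg (fun X => X w) (ghostSystem.anomaly_comm_c m n i)
    · exact congrArg (fun X => X w) (ghostSystem.anomaly_comm_b m n (-i))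
  have hcontr : ∀ i w, ghostSystem.anomaly m n (contr i w)
      = contr i (ghostSystem.anomaly m n w) := fun i w => by
    rw [contr_eq]
    split_ifs
    · exact congrArg (fun X => X w) (ghostSystem.anomaly_comm_b m n (-i))
    · exact congrArg (fun X => X w) (ghostSystem.anomaly_comm_c m n i)
  have hvac := ghostSystem.anomaly_vac isVacuum_one ExteriorAlgebra.algebraMapInv.toLinearMap
    (by simp) (fun k v hk => by
      have := algebraMapInv_wedge k v
      rwa [wedge_eq, if_pos hk] at this)
    (fun k v hk => by
      have := algebraMapInv_wedge (-k) v
      rwa [wedge_eq, if_neg (by omega), neg_neg] at this) hm n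
  -- The anomaly commutes with the modes, so its value on the vacuum is killed by all contractions
  -- and is a multiple of the vacuum.
  have h1 := eq_smul_one_of_contr_eq_zero (w := ghostSystem.anomaly m n 1) fun i => by
    rw [← hcontr, contr_one, map_zero]
  refine ghost_ext ?_ fun i w h => ?_
  · rw [h1]
    exact congrArg (fun z : ℂ => z • (1 : GhostSpace)) hvac
  · rw [hwedge, h, LinearMap.smul_apply, LinearMap.smul_apply, map_smul, Module.End.one_apply,
      Module.End.one_apply]

/-- Both sides agree on the vacuum and have equal anticommutators with all creation modes, which
generate the Fock space. With `b_{-m}` the anticommutator is the anomaly, whence the coefficient. -/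
theorem ghL_comm_ghD {m : ℤ} (hm : 0 ≤ m) :
    ghL m * ghD - ghD * ghL m = (-(13 * (m : ℂ) ^ 3 - m) / 6 : ℂ) • ghC m := by
  have hc := ghostSystem.L_comm_D_anticomm_c m
  have hb := ghostSystem.L_comm_D_anticomm_b m
  have hL1 : ghL m 1 = 0 := isVacuum_one.L hm
  have hD1 : ghD 1 = 0 := isVacuum_one.D
  refine ghost_ext ?_ fun i w h => ?_
  · simp only [LinearMap.sub_apply, Module.End.mul_apply, hL1, hD1, map_zero, sub_zero,
      LinearMap.smul_apply]
    rcases hm.lt_or_eq with h | h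
    · rw [ghC_vac h, smul_zero]
    · simp [← h]
  · have key : ∀ x : Module.End ℂ GhostSpace,
        (ghL m * ghD - ghD * ghL m) * x + x * (ghL m * ghD - ghD * ghL m)
          = (-(13 * (m : ℂ) ^ 3 - m) / 6 : ℂ) • (ghC m * x + x * ghC m) →
        (ghL m * ghD - ghD * ghL m) (x w)
          = ((-(13 * (m : ℂ) ^ 3 - m) / 6 : ℂ) • ghC m) (x w) := fun x hx => by
      have := congrArg (fun X => X w) hx
      simp only [LinearMap.add_apply, Module.End.mul_apply, LinearMap.smul_apply, h,
        map_smul, smul_add] at this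
      exact add_right_cancel this
    rw [wedge_eq]
    split_ifs
    · refine key _ ((hc i).trans ?_)
      rw [ghC_ghC, smul_zero]
    · refine key _ ((hb (-i)).trans ?_)
      rw [ghL_anomaly hm, ghC_ghB]
      split_ifs <;> simp

/-! ### Boson systems -/

section BosonSystem

/-- A representation of the modes `y s m` of free bosons with polarisations `s ∈ P`, metric `g`,
zero modes `z`, and their Virasoro operators `L` with background charges `γ`. -/
structure BosonSystem (V P : Type*) [AddCommGroup V] [Module ℂ V] [Fintype P] [DecidableEq P] where
  y : P → ℤ → Module.End ℂ V
  g : P → ℂ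
  z : P → ℂ
  γ : P → ℂ
  h₀ : ℂ
  quad : P → ℤ → Module.End ℂ V
  L : ℤ → Module.End ℂ V
  g_mul_self : ∀ s, g s * g s = 1
  comm : ∀ s t m n, y s m * y t n - y t n * y s m
    = if s = t ∧ m + n = 0 then (m * g s : ℂ) • 1 else 0
  y_zero : ∀ s, y s 0 = z s • 1
  sumQuad : ∀ s m, LocHasSum (fun k : ℤ => nOrd (y s) (m + k) (-k)) (quad s m)
  L_eq : ∀ m, L m = (1 / 2 : ℂ) • ∑ s, g s • quad s m + ∑ s, (γ s * m : ℂ) • y s m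
    + (if m = 0 then h₀ else 0) • 1

namespace BosonSystem

variable {V P : Type*} [AddCommGroup V] [Module ℂ V] [Fintype P] [DecidableEq P]
  (B : BosonSystem V P)

theorem comm_eq_smul (s t : P) (m n : ℤ) : B.y s m * B.y t n - B.y t n * B.y s m
    = (if s = t ∧ m + n = 0 then (m * B.g s : ℂ) else 0) • 1 := by
  rw [B.comm, ite_smul, zero_smul]

theorem nOrd_comm (s t : P) (i j n : ℤ) :
    nOrd (B.y s) i j * B.y t n - B.y t n * nOrd (B.y s) i j
      = (if s = t ∧ j + n = 0 then (j * B.g s : ℂ) else 0) • B.y s i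
        + (if s = t ∧ i + n = 0 then (i * B.g s : ℂ) else 0) • B.y s j := by
  unfold nOrd
  by_cases hij : i ≤ j
  · rw [if_pos hij, mul_comm_eq_comm, B.comm_eq_smul, B.comm_eq_smul, mul_smul_comm, mul_one,
      smul_mul_assoc, one_mul, add_comm]
  · rw [if_neg hij, mul_comm_eq_comm, B.comm_eq_smul, B.comm_eq_smul, mul_smul_comm, mul_one, smul_mul_assoc,
      one_mul]

theorem quad_comm (s t : P) (m n : ℤ) :
    B.quad s m * B.y t n - B.y t n * B.quad s m
      = (if s = t then -(2 * n * B.g s : ℂ) else 0) • B.y s (m + n) := by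
  have h := (B.sumQuad s m).commutator (B.y t n)
  have h1 := LocHasSum.of_forall_ne (f := fun k : ℤ =>
    (if s = t ∧ -k + n = 0 then (((-k : ℤ) : ℂ) * B.g s : ℂ) else 0) • B.y s (m + k)) n
    fun i hi => by rw [if_neg (by omega), zero_smul]
  have h2 := LocHasSum.of_forall_ne (f := fun k : ℤ =>
    (if s = t ∧ m + k + n = 0 then (((m + k : ℤ) : ℂ) * B.g s : ℂ) else 0) • B.y s (-k)) (-(m + n))
    fun i hi => by rw [if_neg (by omega), zero_smul]
  rw [(h.congr fun k => B.nOrd_comm s t (m + k) (-k) n).unique (h1.add h2)]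
  by_cases hst : s = t
  · rw [if_pos ⟨hst, by omega⟩, if_pos ⟨hst, by omega⟩, if_pos hst, neg_neg, ← add_smul]
    congr 1
    push_cast
    ring
  · simp [hst]

theorem sum_g_quad_comm (m : ℤ) (t : P) (n : ℤ) :
    (∑ s, B.g s • B.quad s m) * B.y t n - B.y t n * ∑ s, B.g s • B.quad s m
      = (-2 * n : ℂ) • B.y t (m + n) := by
  rw [Finset.sum_mul, Finset.mul_sum, ← Finset.sum_sub_distrib, Finset.sum_eq_single t]
  · rw [smul_mul_assoc, mul_smul_comm, ← smul_sub, B.quad_comm, if_pos rfl, smul_smul]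
    congr 1
    linear_combination (-2 * n : ℂ) * B.g_mul_self t
  · intro s _ hs
    rw [smul_mul_assoc, mul_smul_comm, ← smul_sub, B.quad_comm, if_neg hs, zero_smul, smul_zero]
  · simp

theorem sum_γ_comm (m : ℤ) (t : P) (n : ℤ) :
    (∑ s, (B.γ s * m : ℂ) • B.y s m) * B.y t n - B.y t n * ∑ s, (B.γ s * m : ℂ) • B.y s m
      = (if m + n = 0 then B.γ t * B.g t * m ^ 2 else 0 : ℂ) • 1 := by
  rw [Finset.sum_mul, Finset.mul_sum, ← Finset.sum_sub_distrib, Finset.sum_eq_single t]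
  · rw [smul_mul_assoc, mul_smul_comm, ← smul_sub, B.comm]
    by_cases h : m + n = 0
    · rw [if_pos ⟨rfl, h⟩, if_pos h, smul_smul]
      congr 1
      ring
    · simp [h]
  · intro s _ hs
    rw [smul_mul_assoc, mul_smul_comm, ← smul_sub, B.comm, if_neg (by tauto), smul_zero]
  · simp

theorem L_comm_y (m : ℤ) (t : P) (n : ℤ) :
    B.L m * B.y t n - B.y t n * B.L m = (-n : ℂ) • B.y t (m + n)
      + (if m + n = 0 then B.γ t * B.g t * m ^ 2 else 0 : ℂ) • 1 := by
  have h1 := B.sum_g_quad_comm m t n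
  have h2 := B.sum_γ_comm m t n
  rw [← h2, B.L_eq]
  have e : (-n : ℂ) • B.y t (m + n) = (1 / 2 : ℂ) • ((-2 * n : ℂ) • B.y t (m + n)) := by
    rw [smul_smul]
    congr 1
    ring
  rw [e, ← h1]
  simp only [add_mul, mul_add, smul_mul_assoc, mul_smul_comm, one_mul, mul_one]
  module

/-- The failure of the Virasoro operators to represent the Witt algebra. -/
def anomaly (m n : ℤ) : Module.End ℂ V :=
  B.L m * B.L n - B.L n * B.L m - (m - n : ℂ) • B.L (m + n)

/-- The Jacobi argument again; the scalars which the background charge adds to `[L_m, y_k]` occur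
only for `m + n + k = 0`, where they cancel. -/
theorem anomaly_comm (m n : ℤ) (t : P) (k : ℤ) :
    B.anomaly m n * B.y t k = B.y t k * B.anomaly m n := by
  rw [← sub_eq_zero, anomaly, sub_mul, mul_sub, smul_mul_assoc, mul_smul_comm,
    sub_sub_sub_comm, ← smul_sub, comm_comm_eq, B.L_comm_y, B.L_comm_y, B.L_comm_y]
  have e1 : ∀ (X : Module.End ℂ V) (a b : ℂ) (Y : Module.End ℂ V),
      X * (a • Y + b • 1) - (a • Y + b • 1) * X = a • (X * Y - Y * X) := fun X a b Y => by
    rw [mul_add, add_mul, mul_smul_comm, smul_mul_assoc, mul_smul_comm, smul_mul_assoc, mul_one,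
      one_mul, add_sub_add_right_eq_sub, smul_sub]
  rw [e1, e1, B.L_comm_y, B.L_comm_y]
  have e : n + (m + k) = m + n + k := by ring
  have e' : m + (n + k) = m + n + k := by ring
  rw [e, e']
  by_cases h : m + n + k = 0
  · simp only [h, if_true]
    have hk : (k : ℂ) = -(m + n) := by
      rw [eq_neg_iff_add_eq_zero, add_comm]
      exact_mod_cast h
    push_cast
    rw [hk]
    module
  · simp only [h, if_false]
    push_cast
    module

/-- A vacuum of a boson system. -/
def IsVacuum (Ω : V) : Prop := ∀ s m, 0 < m → B.y s m Ω = 0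

/-- The energy of the vacuum. -/
def vacEnergy : ℂ := (1 / 2) * ∑ s, B.g s * B.z s ^ 2 + B.h₀

variable {B}

theorem IsVacuum.nOrd {Ω : V} (hΩ : B.IsVacuum Ω) (s : P) {i j : ℤ} (h : 0 < i ∨ 0 < j) :
    nOrd (B.y s) i j Ω = 0 :=
  nOrd_apply_eq_zero (K := 0) (fun n hn => hΩ s n hn) h

theorem IsVacuum.L_pos {Ω : V} (hΩ : B.IsVacuum Ω) {m : ℤ} (h : 0 < m) : B.L m Ω = 0 := by
  have hq : ∀ s, B.quad s m Ω = 0 := fun s =>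
    (B.sumQuad s m).apply_eq_zero Ω fun k => hΩ.nOrd s (by omega)
  rw [B.L_eq, if_neg h.ne']
  simp [hq, hΩ _ m h]

theorem IsVacuum.L_zero {Ω : V} (hΩ : B.IsVacuum Ω) : B.L 0 Ω = B.vacEnergy • Ω := by
  have hq : ∀ s, B.quad s 0 Ω = (B.z s ^ 2) • Ω := fun s => by
    rw [(B.sumQuad s 0).apply_eq_single Ω 0 fun k hk => hΩ.nOrd s (by omega)]
    simp [AnomalousString.nOrd, B.y_zero, smul_smul, pow_two]
  rw [B.L_eq, if_pos rfl, vacEnergy]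
  simp [hq, smul_smul, ← Finset.sum_smul, add_smul]

theorem coeff_nOrd (ε : V →ₗ[ℂ] ℂ) (hε : ∀ s m v, m < 0 → ε (B.y s m v) = 0) (s : P) {i j : ℤ}
    (h : i < 0 ∨ j < 0) (v : V) : ε (nOrd (B.y s) i j v) = 0 := by
  unfold nOrd
  split_ifs with hij
  · exact hε s i _ (by omega)
  · exact hε s j _ (by omega)

theorem coeff_L_neg (ε : V →ₗ[ℂ] ℂ) (hε : ∀ s m v, m < 0 → ε (B.y s m v) = 0) {m : ℤ}
    (h : m < 0) (v : V) : ε (B.L m v) = 0 := by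
  have hq : ∀ s, ε (B.quad s m v) = 0 := fun s => by
    rw [(B.sumQuad s m).map_apply]
    exact (finsum_congr fun k => coeff_nOrd ε hε s (by omega) v).trans finsum_zero
  rw [B.L_eq, if_neg h.ne]
  simp [hq, hε _ m _ h]

theorem sum_range_mul_sub (M t : ℕ) :
    ∑ k ∈ Finset.range t, (((M : ℂ) - k) * k)
      = M * (t * (t - 1)) / 2 - (t - 1) * t * (2 * t - 1) / 6 := by
  induction t with
  | zero => simp
  | succ t ih =>
    rw [Finset.sum_range_succ, ih]
    push_cast
    ring

section Coeff

variable {Ω : V} (hΩ : B.IsVacuum Ω) (ε : V →ₗ[ℂ] ℂ) (h1 : ε Ω = 1)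
  (hε : ∀ s m v, m < 0 → ε (B.y s m v) = 0)
include hΩ h1 hε

theorem coeff_y (s : P) (k : ℤ) : ε (B.y s k Ω) = if k = 0 then B.z s else 0 := by
  rcases lt_trichotomy k 0 with h | h | h
  · rw [hε s k _ h, if_neg h.ne]
  · rw [h, B.y_zero]
    simp [h1]
  · rw [hΩ s k h, map_zero, if_neg h.ne']

omit hΩ h1 in
theorem coeff_L_y (m : ℤ) (s : P) {j : ℤ} (hj : j < 0) (v : V) :
    ε (B.L m (B.y s j v)) = (-j : ℂ) * ε (B.y s (m + j) v)
      + (if m + j = 0 then B.γ s * B.g s * m ^ 2 else 0) * ε v := by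
  have := congrArg (fun X => ε (X v)) (B.L_comm_y m s j)
  simpa only [LinearMap.sub_apply, LinearMap.add_apply, LinearMap.smul_apply,
    Module.End.mul_apply, Module.End.one_apply, map_sub, map_add, map_smul, hε s j _ hj, sub_zero,
    smul_eq_mul] using this

/-- For `0 < k < m` two non-zero modes contract and give `(m - k) k g`. The end terms `k = 0` and `k
= m` contain a zero mode; only they see the momentum and the background charge. -/
theorem coeff_L_nOrd {m n : ℤ} (hn : n < 0) (s : P) (k : ℤ) :
    ε (B.L m (nOrd (B.y s) (n + k) (-k) Ω))
      = if m + n = 0 ∧ 0 ≤ k ∧ k ≤ m then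
          (m - k) * k * B.g s
            + (if k = 0 then B.z s * (m * B.z s + B.γ s * B.g s * m ^ 2) else 0)
            + (if k = m then B.z s * (m * B.z s + B.γ s * B.g s * m ^ 2) else 0)
        else 0 := by
  by_cases hk : 0 ≤ k ∧ k ≤ -n
  swap
  · rw [hΩ.nOrd s (by omega), if_neg (by omega), map_zero, map_zero]
  have hend : B.z s * ε (B.L m (B.y s n Ω))
      = if m + n = 0 then B.z s * (m * B.z s + B.γ s * B.g s * m ^ 2) else 0 := by
    rw [coeff_L_y ε hε m s hn, coeff_y hΩ ε h1 hε, h1]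
    split_ifs with h0
    · have : (n : ℂ) = -m := by
        rw [eq_neg_iff_add_eq_zero, add_comm]
        exact_mod_cast h0
      rw [this]
      ring
    · simp
  by_cases hk0 : k = 0 ∨ k = -n
  · have hv : nOrd (B.y s) (n + k) (-k) Ω = B.z s • B.y s n Ω := by
      rcases hk0 with rfl | rfl
      · rw [nOrd, if_pos (by omega)]
        simp [B.y_zero]
      · rw [nOrd, if_neg (by omega)]
        simp [B.y_zero]
    rw [hv, map_smul, map_smul, smul_eq_mul, hend]
    by_cases h0 : m + n = 0
    · rw [if_pos h0, if_pos (by omega)]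
      rcases hk0 with rfl | rfl
      · rw [if_pos rfl, if_neg (by omega)]
        simp
      · have e : -n = m := by omega
        rw [e, if_neg (by omega), if_pos rfl]
        simp
    · rw [if_neg h0, if_neg (by omega)]
  · have hv : nOrd (B.y s) (n + k) (-k) Ω = B.y s (n + k) (B.y s (-k) Ω) := by
      unfold nOrd
      split_ifs
      · rfl
      · have := congrArg (fun X => X Ω) (B.comm s s (n + k) (-k))
        rw [if_neg (by omega)] at this
        simp only [LinearMap.sub_apply, Module.End.mul_apply, LinearMap.zero_apply] at this
        exact (sub_eq_zero.mp this).symm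
    have hc := congrArg (fun X => ε (X Ω)) (B.comm s s (m + (n + k)) (-k))
    simp only [LinearMap.sub_apply, Module.End.mul_apply, map_sub, hε s (-k) _ (by omega),
      sub_zero] at hc
    rw [hv, coeff_L_y ε hε m s (by omega), hε s (-k) _ (by omega), mul_zero, add_zero, hc]
    by_cases h0 : m + n = 0
    · rw [if_pos ⟨trivial, by omega⟩, if_pos (by omega), if_neg (by omega), if_neg (by omega)]
      have : (n : ℂ) = -m := by
        rw [eq_neg_iff_add_eq_zero, add_comm]
        exact_mod_cast h0
      push_cast
      simp only [LinearMap.smul_apply, Module.End.one_apply, map_smul, h1, smul_eq_mul, this]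
      ring
    · rw [if_neg (by omega), if_neg (by omega)]
      simp

theorem coeff_L_quad {m n : ℤ} (hm : 0 ≤ m) (hn : n < 0) (s : P) :
    ε (B.L m (B.quad s n Ω)) = if m + n = 0 then
      ((m : ℂ) ^ 3 - m) / 6 * B.g s + 2 * B.z s * (m * B.z s + B.γ s * B.g s * m ^ 2) else 0 := by
  rw [show ε (B.L m (B.quad s n Ω)) = (ε ∘ₗ B.L m) (B.quad s n Ω) from rfl,
    (B.sumQuad s n).map_apply]
  refine (finsum_congr fun k => coeff_L_nOrd hΩ ε h1 hε hn s k).trans ?_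
  split_ifs with h
  swap
  · exact (finsum_congr fun k => if_neg (by tauto)).trans finsum_zero
  obtain ⟨M, rfl⟩ := Int.eq_ofNat_of_zero_le hm
  rw [finsum_eq_sum_of_support_subset (s := (Finset.range (M + 1)).map Nat.castEmbedding),
    Finset.sum_map]
  · rw [Finset.sum_congr rfl fun k hk => if_pos (by
      simp only [Finset.mem_range] at hk
      simp only [Nat.castEmbedding_apply]
      omega)]
    simp only [Nat.castEmbedding_apply, Int.cast_natCast, Finset.sum_add_distrib,
      Nat.cast_eq_zero, Nat.cast_inj, Finset.sum_ite_eq', Finset.mem_range, ← Finset.sum_mul]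
    rw [sum_range_mul_sub, if_pos (by omega), if_pos (by omega)]
    push_cast
    ring
  · intro k hk
    by_contra hn
    refine hk (if_neg fun h' => hn ?_)
    simp only [Finset.coe_map, Set.mem_image, Finset.mem_coe, Finset.mem_range]
    exact ⟨k.toNat, by omega, by simp; omega⟩

/-- The vacuum expectation value of the anomaly. -/
theorem anomaly_vac {m : ℤ} (hm : 0 ≤ m) (n : ℤ) :
    ε (B.anomaly m n Ω) = if m + n = 0 then
      Fintype.card P * ((m : ℂ) ^ 3 - m) / 12 - m ^ 3 * ∑ s, B.γ s ^ 2 * B.g s - 2 * m * B.h₀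
      else 0 := by
  have hA : ε (B.anomaly m n Ω) = ε (B.L m (B.L n Ω)) - ε (B.L n (B.L m Ω))
      - (m - n) * ε (B.L (m + n) Ω) := by simp [anomaly]
  rw [hA]
  by_cases hn : 0 ≤ n
  · have hz : ∀ i j : ℤ, 0 ≤ i → 0 ≤ j → 0 < i + j → B.L i (B.L j Ω) = 0 := by
      intro i j hi hj hij
      rcases hj.lt_or_eq with h | h
      · rw [hΩ.L_pos h, map_zero]
      · rw [← h, hΩ.L_zero, map_smul, hΩ.L_pos (by omega), smul_zero]
    by_cases h0 : m + n = 0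
    · have e1 : m = 0 := by omega
      have e2 : n = 0 := by omega
      rw [e1, e2]
      simp
    · rw [hz m n hm hn (by omega), hz n m hn hm (by omega), hΩ.L_pos (by omega), if_neg h0]
      simp
  · have hn' : n < 0 := by omega
    have e2 : ε (B.L n (B.L m Ω)) = 0 := coeff_L_neg ε hε hn' _
    have e3 : ε (B.L (m + n) Ω) = if m + n = 0 then B.vacEnergy else 0 := by
      rcases lt_trichotomy (m + n) 0 with h | h | h
      · rw [coeff_L_neg ε hε h, if_neg h.ne]
      · rw [h, hΩ.L_zero, if_pos rfl, map_smul, h1, smul_eq_mul, mul_one]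
      · rw [hΩ.L_pos h, map_zero, if_neg h.ne']
    have e1 : ε (B.L m (B.L n Ω)) = (1 / 2) * ∑ s, B.g s * ε (B.L m (B.quad s n Ω))
        + ∑ s, B.γ s * n * ε (B.L m (B.y s n Ω)) := by
      rw [B.L_eq n, if_neg hn'.ne]
      simp [map_sum]
    rw [e1, e2, e3]
    by_cases h0 : m + n = 0
    · have hnm : (n : ℂ) = -m := by
        rw [eq_neg_iff_add_eq_zero, add_comm]
        exact_mod_cast h0
      simp only [coeff_L_quad hΩ ε h1 hε hm hn', coeff_L_y ε hε m _ hn', coeff_y hΩ ε h1 hε,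
        h0, if_true, h1, hnm, vacEnergy]
      -- The terms linear in `γ` from the quadratic and from the linear part cancel, and the `z²`
      -- terms cancel against `2 m` times the vacuum energy, of which `-2 m h₀` remains.
      have hs : ∀ s, B.g s * (((m : ℂ) ^ 3 - m) / 6 * B.g s
            + 2 * B.z s * (m * B.z s + B.γ s * B.g s * m ^ 2))
          = ((m : ℂ) ^ 3 - m) / 6 + 2 * m * (B.g s * B.z s ^ 2)
            + 2 * m ^ 2 * (B.γ s * B.z s) := fun s => by
        linear_combination (((m : ℂ) ^ 3 - m) / 6 + 2 * B.z s * B.γ s * m ^ 2) * B.g_mul_self s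
      have hs' : ∀ s, B.γ s * -(m : ℂ) * (- -(m : ℂ) * B.z s + B.γ s * B.g s * m ^ 2 * 1)
          = -(m : ℂ) ^ 2 * (B.γ s * B.z s) - m ^ 3 * (B.γ s ^ 2 * B.g s) := fun s => by ring
      simp only [hs, hs', Finset.sum_add_distrib, Finset.sum_sub_distrib, ← Finset.mul_sum,
        Finset.sum_const, Finset.card_univ, nsmul_eq_mul]
      ring
    · simp only [coeff_L_quad hΩ ε h1 hε hm hn', coeff_L_y ε hε m _ hn', coeff_y hΩ ε h1 hε,
        h0, if_false]
      simp

end Coeff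

end BosonSystem

end BosonSystem

/-! ### The matter Fock space -/

theorem pderiv_comm {σ : Type*} (i j : σ) (f : MvPolynomial σ ℂ) :
    MvPolynomial.pderiv i (MvPolynomial.pderiv j f)
      = MvPolynomial.pderiv j (MvPolynomial.pderiv i f) := by
  classical
  have key : ∀ D E : Derivation ℂ (MvPolynomial σ ℂ) (MvPolynomial σ ℂ),
      (∀ k, D (E (MvPolynomial.X k)) = E (D (MvPolynomial.X k))) → ∀ f, D (E f) = E (D f) := by
    intro D E h f
    have : ⁅D, E⁆ = 0 := MvPolynomial.derivation_ext fun k => by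
      rw [Derivation.commutator_apply, h, sub_self, Derivation.zero_apply]
    have h' := congrArg (fun D => D f) this
    simp only [Derivation.commutator_apply, Derivation.zero_apply] at h'
    exact sub_eq_zero.mp h'
  refine key _ _ (fun k => ?_) f
  rw [MvPolynomial.pderiv_X, MvPolynomial.pderiv_X, Pi.single_apply, Pi.single_apply]
  split_ifs <;> simp

theorem boson_ofNat_succ {d : ℕ} (s : Fin d ⊕ Unit) (g z : ℂ) (n : ℕ) (f : Fock d) :
    boson s g z ((n : ℤ) + 1) f = (((n : ℂ) + 1) * g) • MvPolynomial.pderiv (s, n) f := rfl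

theorem boson_neg {d : ℕ} (s : Fin d ⊕ Unit) (g z : ℂ) (n : ℕ) (f : Fock d) :
    boson s g z (-((n : ℤ) + 1)) f = MvPolynomial.X (s, n) * f := by
  have : -((n : ℤ) + 1) = Int.negSucc n := by omega
  rw [this]
  rfl

theorem boson_zero {d : ℕ} (s : Fin d ⊕ Unit) (g z : ℂ) : boson s g z 0 = z • 1 := rfl

theorem int_cases (m : ℤ) : m = 0 ∨ (∃ n : ℕ, m = (n : ℤ) + 1) ∨ ∃ n : ℕ, m = -((n : ℤ) + 1) := by
  rcases lt_trichotomy m 0 with h | h | h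
  · exact Or.inr (Or.inr ⟨(-m - 1).toNat, by omega⟩)
  · exact Or.inl h
  · exact Or.inr (Or.inl ⟨(m - 1).toNat, by omega⟩)

theorem boson_pos_comm_neg {d : ℕ} (s t : Fin d ⊕ Unit) (g z g' z' : ℂ) (m n : ℕ) (f : Fock d) :
    boson s g z ((m : ℤ) + 1) (boson t g' z' (-((n : ℤ) + 1)) f)
      - boson t g' z' (-((n : ℤ) + 1)) (boson s g z ((m : ℤ) + 1) f)
      = if s = t ∧ m = n then (((m : ℂ) + 1) * g) • f else 0 := by
  classical
  rw [boson_neg, boson_ofNat_succ, boson_neg, boson_ofNat_succ, MvPolynomial.pderiv_mul,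
    MvPolynomial.pderiv_X, Pi.single_apply, mul_smul_comm, ← smul_sub, add_sub_cancel_right]
  by_cases h : s = t ∧ m = n
  · rw [if_pos h, if_pos (by rw [h.1, h.2]), one_mul]
  · rw [if_neg h, if_neg (by simpa [Prod.ext_iff, eq_comm] using h), zero_mul, smul_zero]

theorem boson_comm {d : ℕ} (g z : Fin d ⊕ Unit → ℂ) (s t : Fin d ⊕ Unit) (m n : ℤ) :
    boson s (g s) (z s) m * boson t (g t) (z t) n - boson t (g t) (z t) n * boson s (g s) (z s) m
      = if s = t ∧ m + n = 0 then (m * g s : ℂ) • 1 else 0 := by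
  refine LinearMap.ext fun f => ?_
  rw [LinearMap.sub_apply, Module.End.mul_apply, Module.End.mul_apply]
  rcases int_cases m with rfl | ⟨a, rfl⟩ | ⟨a, rfl⟩
  · rw [boson_zero]
    have : (if s = t ∧ 0 + n = 0 then (((0 : ℤ) : ℂ) * g s) • (1 : Module.End ℂ (Fock d)) else 0) = 0 := by
      simp
    rw [this]
    simp
  · rcases int_cases n with rfl | ⟨b, rfl⟩ | ⟨b, rfl⟩
    · rw [boson_zero, if_neg (by omega)]
      simp
    · rw [if_neg (by omega), boson_ofNat_succ, boson_ofNat_succ, boson_ofNat_succ,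
        boson_ofNat_succ, Derivation.map_smul, Derivation.map_smul, pderiv_comm, smul_comm]
      simp
    · rw [boson_pos_comm_neg]
      by_cases h : s = t ∧ a = b
      · rw [if_pos h, if_pos ⟨h.1, by omega⟩]
        simp
      · rw [if_neg h, if_neg fun h' => h ⟨h'.1, by omega⟩]
        simp
  · rcases int_cases n with rfl | ⟨b, rfl⟩ | ⟨b, rfl⟩
    · rw [boson_zero, if_neg (by omega)]
      simp
    · rw [← neg_sub, boson_pos_comm_neg]
      by_cases h : t = s ∧ b = a
      · rw [if_pos h, if_pos ⟨h.1.symm, by omega⟩, h.1, h.2]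
        simp only [LinearMap.smul_apply, Module.End.one_apply]
        push_cast
        module
      · rw [if_neg h, if_neg (by rintro ⟨rfl, h'⟩; exact h ⟨rfl, by omega⟩)]
        simp
    · rw [if_neg (by omega), boson_neg, boson_neg, boson_neg, boson_neg, mul_left_comm]
      simp

namespace Model

variable (S : Model)

/-- The metric on all polarisations. -/
def metric : Fin S.d ⊕ Unit → ℂ := Sum.elim S.η fun _ => 1

/-- The zero modes of all polarisations. -/
def zeroMode (p : Fin S.d → ℝ) : Fin S.d ⊕ Unit → ℂ := Sum.elim (S.aZero p) fun _ => 0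

theorem metric_mul_self (s : Fin S.d ⊕ Unit) : S.metric s * S.metric s = 1 := by
  rcases s with μ | _
  · simp only [metric, Sum.elim_inl, η]
    split_ifs <;> norm_num
  · simp [metric]

/-- The boson system of the matter Fock space. -/
def bosonSystem (p : Fin S.d → ℝ) : BosonSystem (Fock S.d) (Fin S.d ⊕ Unit) where
  y s := boson s (S.metric s) (S.zeroMode p s)
  g := S.metric
  z := S.zeroMode p
  γ := Sum.elim (fun _ => 0) fun _ => 2 * Complex.I * Complex.sqrt (S.β : ℂ)
  h₀ := 2 * (S.β : ℂ)
  quad s := bosonQuad s (S.metric s) (S.zeroMode p s)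
  L := S.L p
  g_mul_self := S.metric_mul_self
  comm s t m n := boson_comm _ _ s t m n
  y_zero _ := rfl
  sumQuad s m := locHasSum_locSum _ (nOrd_finite (boson_annType _ _ _) m)
  L_eq m := by
    rw [L, Fintype.sum_sum_type, Fintype.sum_sum_type]
    simp only [metric, zeroMode, Sum.elim_inl, Sum.elim_inr, Finset.univ_unique, zero_mul,
      zero_smul, Finset.sum_const_zero, zero_add, Finset.sum_singleton, smul_add]
    have : ∀ X : Module.End ℂ (Fock S.d), (1 : ℂ) • X = X := fun X => one_smul _ X
    rw [this]
    rfl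

theorem isVacuum_matter (p : Fin S.d → ℝ) : (S.bosonSystem p).IsVacuum (1 : Fock S.d) := by
  intro s m hm
  obtain ⟨n, rfl⟩ : ∃ n : ℕ, m = (n : ℤ) + 1 := ⟨(m - 1).toNat, by omega⟩
  change boson s (S.metric s) (S.zeroMode p s) ((n : ℤ) + 1) 1 = 0
  rw [boson_ofNat_succ, MvPolynomial.pderiv_one, smul_zero]

end Model

/-- A subspace of the Fock space which contains the vacuum and is stable under the creation
operators is the whole space. -/
theorem fock_induction {d : ℕ} (U : Submodule ℂ (Fock d)) (h1 : (1 : Fock d) ∈ U)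
    (hX : ∀ i, ∀ f ∈ U, MvPolynomial.X i * f ∈ U) (f : Fock d) : f ∈ U := by
  induction f using MvPolynomial.induction_on with
  | C z =>
    rw [← mul_one (MvPolynomial.C z), ← MvPolynomial.smul_eq_C_mul]
    exact U.smul_mem _ h1
  | add x y hx hy => exact U.add_mem hx hy
  | mul_X x i hx =>
    rw [mul_comm]
    exact hX i x hx

theorem eq_C_of_pderiv_eq_zero {σ : Type*} {f : MvPolynomial σ ℂ}
    (h : ∀ i, MvPolynomial.pderiv i f = 0) :
    f = MvPolynomial.C (MvPolynomial.constantCoeff f) := by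
  classical
  ext m
  rw [MvPolynomial.coeff_C]
  split_ifs with hm
  · rw [← hm]
    rfl
  · obtain ⟨i, hi⟩ : ∃ i, m i ≠ 0 := by
      by_contra! hc
      exact hm (Finsupp.ext fun i => (hc i).symm)
    have h2 := congrArg (MvPolynomial.coeff (m - Finsupp.single i 1)) (h i)
    rw [MvPolynomial.coeff_pderiv, MvPolynomial.coeff_zero] at h2
    have h3 : m - Finsupp.single i 1 + Finsupp.single i 1 = m :=
      tsub_add_cancel_of_le (by
        rw [Finsupp.single_le_iff]
        omega)
    rw [h3] at h2
    exact (mul_eq_zero.mp h2).resolve_right (Nat.cast_add_one_ne_zero _)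

namespace Model

variable (S : Model)

/-- The Virasoro algebra of the matter. -/
theorem L_anomaly (p : Fin S.d → ℝ) {m : ℤ} (hm : 0 ≤ m) (n : ℤ) :
    (S.bosonSystem p).anomaly m n
      = (if m + n = 0 then (S.d + 1 + 48 * S.β : ℂ) / 12 * ((m : ℂ) ^ 3 - m) else 0 : ℂ) • 1 := by
  set B := S.bosonSystem p with hB
  have hcomm : ∀ s k f, B.anomaly m n (boson s (S.metric s) (S.zeroMode p s) k f)
      = boson s (S.metric s) (S.zeroMode p s) k (B.anomaly m n f) := fun s k f =>
    congrArg (fun X => X f) (B.anomaly_comm m n s k)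
  have hg : ∀ s, S.metric s ≠ 0 := fun s h => by
    have := S.metric_mul_self s
    rw [h] at this
    simp at this
  have h1 := eq_C_of_pderiv_eq_zero (f := B.anomaly m n 1) fun i => by
    have := hcomm i.1 ((i.2 : ℤ) + 1) 1
    rw [boson_ofNat_succ, boson_ofNat_succ, MvPolynomial.pderiv_one, smul_zero, map_zero] at this
    refine (smul_eq_zero.mp this.symm).resolve_left (mul_ne_zero (Nat.cast_add_one_ne_zero _) (hg _))
  have hvac := BosonSystem.anomaly_vac (S.isVacuum_matter p)
    (MvPolynomial.lcoeff ℂ 0) (by simp [MvPolynomial.lcoeff]) (fun s k f hk => by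
      obtain ⟨j, rfl⟩ : ∃ j : ℕ, k = -((j : ℤ) + 1) := ⟨(-k - 1).toNat, by omega⟩
      change MvPolynomial.constantCoeff
        (boson s (S.metric s) (S.zeroMode p s) (-((j : ℤ) + 1)) f) = 0
      rw [boson_neg]
      simp) hm n
  have hsq : Complex.sqrt (S.β : ℂ) ^ 2 = S.β := by
    have := Complex.cpow_nat_inv_pow (S.β : ℂ) two_ne_zero
    exact_mod_cast this
  have hval : (if m + n = 0 then
      Fintype.card (Fin S.d ⊕ Unit) * ((m : ℂ) ^ 3 - m) / 12 - m ^ 3 * ∑ s, B.γ s ^ 2 * B.g s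
        - 2 * m * B.h₀ else 0)
      = (if m + n = 0 then (S.d + 1 + 48 * S.β : ℂ) / 12 * ((m : ℂ) ^ 3 - m) else 0 : ℂ) := by
    -- The charge `2 i √β` contributes `4 β m³` and the constant `2 β` in `L_0` contributes `-4 β
    -- m`. Together they are `4 β (m³ - m)`, so the anomaly has the standard cubic form.
    have hs : ∑ s, B.γ s ^ 2 * B.g s = -4 * S.β := by
      rw [Fintype.sum_sum_type]
      simp only [hB, bosonSystem, Sum.elim_inl, Sum.elim_inr, metric, Finset.univ_unique,
        Finset.sum_singleton]
      simp [mul_pow, hsq]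
      norm_num
    have hh : B.h₀ = 2 * S.β := rfl
    rw [hs, hh]
    split_ifs
    · simp
      ring
    · rfl
  rw [hval] at hvac
  refine LinearMap.ext fun f => fock_induction (LinearMap.eqLocus (B.anomaly m n) _) ?_
    (fun i f hf => ?_) f
  · rw [LinearMap.mem_eqLocus, h1]
    change MvPolynomial.constantCoeff _ = _ at hvac
    rw [hvac, LinearMap.smul_apply, Module.End.one_apply, MvPolynomial.smul_eq_C_mul, mul_one]
  · rw [LinearMap.mem_eqLocus] at hf ⊢
    have := hcomm i.1 (-((i.2 : ℤ) + 1)) f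
    rw [boson_neg, boson_neg] at this
    rw [this, hf, LinearMap.smul_apply, LinearMap.smul_apply, Module.End.one_apply,
      Module.End.one_apply, mul_smul_comm]

end Model

/-! ### Transport of systems of modes along homomorphisms of operator algebras -/

section Transport

variable {V V' : Type*} [AddCommGroup V] [Module ℂ V] [AddCommGroup V'] [Module ℂ V']
  (φ : Module.End ℂ V →ₐ[ℂ] Module.End ℂ V')

/-- A homomorphism of operator algebras compatible with locally finite sums. -/
structure IsLocal : Prop where
  locHasSum : ∀ {f : ℤ → Module.End ℂ V} {X : Module.End ℂ V}, LocHasSum f X →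
    LocHasSum (fun i => φ (f i)) (φ X)
  annType : ∀ {x : ℤ → Module.End ℂ V}, AnnType x → AnnType fun n => φ (x n)

theorem map_fermiOrd (c b : ℤ → Module.End ℂ V) (i j : ℤ) :
    φ (fermiOrd c b i j) = fermiOrd (fun n => φ (c n)) (fun n => φ (b n)) i j := by
  unfold fermiOrd
  split_ifs <;> simp

theorem map_nOrd (x : ℤ → Module.End ℂ V) (i j : ℤ) :
    φ (nOrd x i j) = nOrd (fun n => φ (x n)) i j := by
  unfold nOrd
  split_ifs <;> simp

variable {φ}

/-- The image of a ghost system. -/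
def GhostSystem.map (G : GhostSystem V) (hφ : IsLocal φ) : GhostSystem V' where
  c n := φ (G.c n)
  b n := φ (G.b n)
  L n := φ (G.L n)
  N := φ G.N
  N₀ := φ G.N₀
  D := φ G.D
  annC := hφ.annType G.annC
  annB := hφ.annType G.annB
  cb m n := by
    rw [← map_mul, ← map_mul, ← map_add, G.cb]
    split_ifs <;> simp
  cc m n := by rw [← map_mul, ← map_mul, ← map_add, G.cc, map_zero]
  bb m n := by rw [← map_mul, ← map_mul, ← map_add, G.bb, map_zero]
  sumL m := (hφ.locHasSum (G.sumL m)).congr fun k => by rw [map_smul, map_fermiOrd]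
  sumN := (hφ.locHasSum G.sumN).congr fun k => by rw [map_smul, map_fermiOrd]
  sumN₀ := (hφ.locHasSum G.sumN₀).congr fun k => by rw [map_smul, map_fermiOrd]
  sumD := by
    have := (hφ.locHasSum G.sumD).congr
      (g := fun m : ℤ => if 0 ≤ m then φ (G.c (-m)) * φ (G.L m) else φ (G.L m) * φ (G.c (-m)))
      fun m => by split_ifs <;> simp
    rwa [map_smul] at this

variable {P : Type*} [Fintype P] [DecidableEq P]

/-- The image of a boson system. -/
def BosonSystem.map (B : BosonSystem V P) (hφ : IsLocal φ) : BosonSystem V' P where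
  y s n := φ (B.y s n)
  g := B.g
  z := B.z
  γ := B.γ
  h₀ := B.h₀
  quad s m := φ (B.quad s m)
  L m := φ (B.L m)
  g_mul_self := B.g_mul_self
  comm s t m n := by
    rw [← map_mul, ← map_mul, ← map_sub, B.comm]
    split_ifs <;> simp
  y_zero s := by rw [B.y_zero, map_smul, map_one]
  sumQuad s m := (hφ.locHasSum (B.sumQuad s m)).congr fun k => by rw [map_nOrd]
  L_eq m := by
    rw [B.L_eq]
    simp only [map_add, map_smul, map_sum, map_one]

theorem BosonSystem.map_anomaly (B : BosonSystem V P) (hφ : IsLocal φ) (m n : ℤ) :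
    (B.map hφ).anomaly m n = φ (B.anomaly m n) := by
  simp [BosonSystem.anomaly, BosonSystem.map]

end Transport

section Tensor

variable (M N : Type*) [AddCommGroup M] [Module ℂ M] [AddCommGroup N] [Module ℂ N]

theorem isLocal_lTensor : IsLocal (Module.End.lTensorAlgHom ℂ N M) where
  locHasSum {f X} h := fun v => by
    induction v using TensorProduct.induction_on with
    | zero => simp
    | tmul m n =>
      refine ⟨(h n).1.subset fun i hi hz => hi ?_, ?_⟩
      · change m ⊗ₜ[ℂ] f i n = 0
        rw [show f i n = 0 from hz, TensorProduct.tmul_zero]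
      · exact h.map_apply (TensorProduct.mk ℂ M N m) n
    | add x y hx hy =>
      refine ⟨(hx.1.union hy.1).subset fun i hi => ?_, ?_⟩
      · by_contra hn
        simp only [Set.mem_union, Function.mem_support, not_or, not_not] at hn
        exact hi (by simp only [map_add, hn.1, hn.2, add_zero])
      · simp only [map_add]
        rw [finsum_add_distrib hx.1 hy.1, ← hx.2, ← hy.2]
  annType {x} h := fun v => by
    induction v using TensorProduct.induction_on with
    | zero => exact ⟨0, le_rfl, fun n _ => map_zero _⟩
    | tmul m n =>
      obtain ⟨K, hK, h⟩ := h n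
      exact ⟨K, hK, fun k hk => by
        change m ⊗ₜ[ℂ] x k n = 0
        rw [h k hk, TensorProduct.tmul_zero]⟩
    | add v w hv hw =>
      obtain ⟨K, hK, h⟩ := hv
      obtain ⟨K', hK', h'⟩ := hw
      exact ⟨max K K', le_max_of_le_left hK, fun n hn => by
        rw [map_add, h n (by omega), h' n (by omega), add_zero]⟩

theorem isLocal_rTensor : IsLocal (Module.End.rTensorAlgHom ℂ M N) where
  locHasSum {f X} h := fun v => by
    induction v using TensorProduct.induction_on with
    | zero => simp
    | tmul m n =>
      refine ⟨(h m).1.subset fun i hi hz => hi ?_, ?_⟩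
      · change f i m ⊗ₜ[ℂ] n = 0
        rw [show f i m = 0 from hz, TensorProduct.zero_tmul]
      · exact h.map_apply ((TensorProduct.mk ℂ M N).flip n) m
    | add x y hx hy =>
      refine ⟨(hx.1.union hy.1).subset fun i hi => ?_, ?_⟩
      · by_contra hn
        simp only [Set.mem_union, Function.mem_support, not_or, not_not] at hn
        exact hi (by simp only [map_add, hn.1, hn.2, add_zero])
      · simp only [map_add]
        rw [finsum_add_distrib hx.1 hy.1, ← hx.2, ← hy.2]
  annType {x} h := fun v => by
    induction v using TensorProduct.induction_on with
    | zero => exact ⟨0, le_rfl, fun n _ => map_zero _⟩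
    | tmul m n =>
      obtain ⟨K, hK, h⟩ := h m
      exact ⟨K, hK, fun k hk => by
        change x k m ⊗ₜ[ℂ] n = 0
        rw [h k hk, TensorProduct.zero_tmul]⟩
    | add v w hv hw =>
      obtain ⟨K, hK, h⟩ := hv
      obtain ⟨K', hK', h'⟩ := hw
      exact ⟨max K K', le_max_of_le_left hK, fun n hn => by
        rw [map_add, h n (by omega), h' n (by omega), add_zero]⟩

theorem rTensor_mul_lTensor (x : Module.End ℂ M) (y : Module.End ℂ N) :
    Module.End.rTensorAlgHom ℂ M N x * Module.End.lTensorAlgHom ℂ N M y = TensorProduct.map x y :=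
  TensorProduct.ext' fun _ _ => rfl

theorem lTensor_mul_rTensor (x : Module.End ℂ M) (y : Module.End ℂ N) :
    Module.End.lTensorAlgHom ℂ N M y * Module.End.rTensorAlgHom ℂ M N x = TensorProduct.map x y :=
  TensorProduct.ext' fun _ _ => rfl

end Tensor

/-! ### String systems -/

/-- The ghost modes which create from the vacuum. -/
def GhostSystem.wedge {V : Type*} [AddCommGroup V] [Module ℂ V] (G : GhostSystem V) (i : ℤ) :
    Module.End ℂ V :=
  if i ≤ 0 then G.c i else G.b (-i)

/-- The ghost modes which annihilate the vacuum. -/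
def GhostSystem.contr {V : Type*} [AddCommGroup V] [Module ℂ V] (G : GhostSystem V) (i : ℤ) :
    Module.End ℂ V :=
  if i ≤ 0 then G.b (-i) else G.c i

/-- Commuting systems of matter modes and ghost modes, generated by the ghost modes from the
vectors `vac v`, `v ∈ W`, and by all modes from `vac Ω`, with the differential `D`. -/
structure StringSystem (V W P : Type*) [AddCommGroup V] [Module ℂ V] [AddCommGroup W] [Module ℂ W]
    [Fintype P] [DecidableEq P] where
  G : GhostSystem V
  B : BosonSystem V P
  a : ℂ
  κ : ℂ
  D : Module.End ℂ V
  LW : ℤ → Module.End ℂ W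
  vac : W →ₗ[ℂ] V
  Ω : W
  y_c : ∀ s m n, B.y s m * G.c n = G.c n * B.y s m
  y_b : ∀ s m n, B.y s m * G.b n = G.b n * B.y s m
  annY : ∀ s, AnnType (B.y s)
  annL : AnnType B.L
  ghost_comm : ∀ m : ℤ, 0 ≤ m →
    G.L m * G.D - G.D * G.L m = (-(13 * (m : ℂ) ^ 3 - m) / 6 : ℂ) • G.c m
  matter_anomaly : ∀ m n : ℤ, 0 ≤ m →
    B.anomaly m n = (if m + n = 0 then (κ + 26) / 12 * ((m : ℂ) ^ 3 - m) else 0 : ℂ) • 1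
  sumD : LocHasSum (fun m : ℤ => (B.L m - (if m = 0 then a else 0) • 1) * G.c (-m)) (D - G.D)
  vac_injective : Function.Injective vac
  vac_vacuum : ∀ v, G.IsVacuum (vac v)
  Ω_vacuum : B.IsVacuum (vac Ω)
  L_vac : ∀ m v, B.L m (vac v) = vac (LW m v)
  ghost_induction : ∀ U : Submodule ℂ V, (∀ v, vac v ∈ U) →
    (∀ i, ∀ u ∈ U, G.wedge i u ∈ U) → ∀ u, u ∈ U
  matter_induction : ∀ U : Submodule ℂ V, vac Ω ∈ U →
    (∀ s m, m < 0 → ∀ u ∈ U, B.y s m u ∈ U) → ∀ v, vac v ∈ U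

namespace Model

variable (S : Model)

/-- The string system of the differential space. -/
def stringSystem (p : Fin S.d → ℝ) : StringSystem S.C (Fock S.d) (Fin S.d ⊕ Unit) where
  G := ghostSystem.map (isLocal_lTensor (Fock S.d) GhostSpace)
  B := (S.bosonSystem p).map (isLocal_rTensor (Fock S.d) GhostSpace)
  a := S.a
  κ := S.κ
  D := S.D p
  LW := S.L p
  vac := S.vac
  Ω := 1
  y_c s m n := (rTensor_mul_lTensor _ _ _ _).trans (lTensor_mul_rTensor _ _ _ _).symm
  y_b s m n := (rTensor_mul_lTensor _ _ _ _).trans (lTensor_mul_rTensor _ _ _ _).symm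
  annY s := (isLocal_rTensor (Fock S.d) GhostSpace).annType (boson_annType _ _ _)
  annL v := by
    obtain ⟨K, hK, h⟩ := (isLocal_rTensor (Fock S.d) GhostSpace).annType (S.Lshift_annType p S.a) v
    refine ⟨K, hK, fun n hn => ?_⟩
    have e : S.Lshift p S.a n = S.L p n := by
      rw [Model.Lshift, if_neg (by omega)]
      exact LinearMap.ext fun f => by simp
    have h' : (Module.End.rTensorAlgHom ℂ (Fock S.d) GhostSpace (S.Lshift p S.a n)) v = 0 := h n hn
    rw [e] at h'
    exact h'
  ghost_comm m hm := by
    have := congrArg (Module.End.lTensorAlgHom ℂ GhostSpace (Fock S.d)) (ghL_comm_ghD hm)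
    rw [map_sub, map_mul, map_mul, map_smul] at this
    exact this
  matter_anomaly m n hm := by
    rw [BosonSystem.map_anomaly, S.L_anomaly p hm, map_smul, map_one]
    congr 2
    -- The central charge `d + 1 + 48 β` equals `κ + 26`.
    rw [Model.κ]
    push_cast
    ring
  sumD := by
    have h := locHasSum_locSum _ (S.D_finite p)
    have e : S.D p - (ghostSystem.map (isLocal_lTensor (Fock S.d) GhostSpace)).D
      = locSum (fun m : ℤ => TensorProduct.map (S.Lshift p S.a m) (ghC (-m))) (S.D_finite p) :=
      LinearMap.ext fun v => add_sub_cancel_right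
        (locSum (fun m : ℤ => TensorProduct.map (S.Lshift p S.a m) (ghC (-m))) (S.D_finite p) v)
        (S.gh ghD v)
    rw [e]
    refine h.congr fun m => ?_
    rw [← rTensor_mul_lTensor, Lshift, map_sub, map_smul, map_one]
    rfl
  vac_injective v w h := by
    have := congrArg (TensorProduct.lift
      ((LinearMap.lsmul ℂ (Fock S.d)).flip.compl₂ ExteriorAlgebra.algebraMapInv.toLinearMap)) h
    simpa [vac] using this
  vac_vacuum v :=
    { c := fun m hm => by
        change v ⊗ₜ[ℂ] (ghC m 1) = 0
        rw [ghC_vac hm, TensorProduct.tmul_zero]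
      b := fun m hm => by
        change v ⊗ₜ[ℂ] (ghB m 1) = 0
        rw [ghB_vac hm, TensorProduct.tmul_zero] }
  Ω_vacuum s m hm := by
    change ((S.bosonSystem p).y s m 1) ⊗ₜ[ℂ] (1 : GhostSpace) = 0
    rw [S.isVacuum_matter p s m hm, TensorProduct.zero_tmul]
  L_vac m v := rfl
  ghost_induction U h1 hw u := by
    induction u using TensorProduct.induction_on with
    | zero => exact U.zero_mem
    | tmul v w =>
      refine ghost_induction (U.comap (TensorProduct.mk ℂ (Fock S.d) GhostSpace v)) (h1 v)
        (fun i w hi => ?_) w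
      have := hw i _ hi
      rw [GhostSystem.wedge] at this
      change v ⊗ₜ[ℂ] (wedge i w) ∈ U
      rw [wedge_eq]
      split_ifs at this ⊢
      · exact this
      · exact this
    | add x y hx hy => exact U.add_mem hx hy
  matter_induction U h1 hy v := by
    refine fock_induction (U.comap S.vac) h1 (fun i f hf => ?_) v
    have := hy i.1 (-((i.2 : ℤ) + 1)) (by omega) _ hf
    have e := boson_neg i.1 (S.metric i.1) (S.zeroMode p i.1) i.2 f
    change (MvPolynomial.X i * f) ⊗ₜ[ℂ] (1 : GhostSpace) ∈ U
    rw [← e]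
    exact this

end Model

/-! ### Operators commuting with the modes -/

section Commutant

variable {V P : Type*} [AddCommGroup V] [Module ℂ V] [Fintype P] [DecidableEq P]

/-- A locally finite sum of operators commuting with `Z` commutes with `Z`. -/
theorem LocHasSum.commute {ι : Type*} {f : ι → Module.End ℂ V} {X Z : Module.End ℂ V}
    (hX : LocHasSum f X) (h : ∀ i, Commute (f i) Z) : Commute X Z :=
  sub_eq_zero.mp ((hX.commutator Z).eq_zero fun i => sub_eq_zero.mpr (h i))

theorem commute_nOrd {x : ℤ → Module.End ℂ V} {Z : Module.End ℂ V} (h : ∀ n, Commute (x n) Z)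
    (i j : ℤ) : Commute (nOrd x i j) Z := by
  unfold nOrd
  split_ifs
  · exact (h i).mul_left (h j)
  · exact (h j).mul_left (h i)

theorem commute_fermiOrd {c b : ℤ → Module.End ℂ V} {Z : Module.End ℂ V}
    (hc : ∀ n, Commute (c n) Z) (hb : ∀ n, Commute (b n) Z) (i j : ℤ) :
    Commute (fermiOrd c b i j) Z := by
  unfold fermiOrd
  split_ifs
  · exact (((hc 0).mul_left (hb 0)).sub_left ((hb 0).mul_left (hc 0))).smul_left _
  · exact ((hb j).mul_left (hc i)).neg_left
  · exact (hc i).mul_left (hb j)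

theorem BosonSystem.commute_L (B : BosonSystem V P) {Z : Module.End ℂ V}
    (h : ∀ s n, Commute (B.y s n) Z) (m : ℤ) : Commute (B.L m) Z := by
  rw [B.L_eq]
  refine (((Commute.sum_left _ _ _ fun s _ => ?_).smul_left _).add_left
    (Commute.sum_left _ _ _ fun s _ => (h s m).smul_left _)).add_left
    ((Commute.one_left Z).smul_left _)
  exact ((B.sumQuad s m).commute fun k => commute_nOrd (h s) _ _).smul_left _

namespace GhostSystem

variable (G : GhostSystem V) {Z : Module.End ℂ V} (hc : ∀ n, Commute (G.c n) Z)
  (hb : ∀ n, Commute (G.b n) Z)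
include hc hb

theorem commute_L (m : ℤ) : Commute (G.L m) Z :=
  (G.sumL m).commute fun _ => (commute_fermiOrd hc hb _ _).smul_left _

theorem commute_N : Commute G.N Z :=
  G.sumN.commute fun _ => (commute_fermiOrd hc hb _ _).smul_left _

theorem commute_D : Commute G.D Z := by
  have h : Commute ((2 : ℂ) • G.D) Z := G.sumD.commute fun m => by
    split_ifs
    · exact (hc _).mul_left (G.commute_L hc hb m)
    · exact (G.commute_L hc hb m).mul_left (hc _)
  have := h.smul_left (1 / 2 : ℂ)
  rwa [smul_smul, one_div, inv_mul_cancel₀ two_ne_zero, one_smul] at this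

end GhostSystem

end Commutant

/-! ### The ghost-extended constraints and the differential -/

namespace StringSystem

variable {V W P : Type*} [AddCommGroup V] [Module ℂ V] [AddCommGroup W] [Module ℂ W]
  [Fintype P] [DecidableEq P] (X : StringSystem V W P)

/-- The matter constraints `L_m - a δ_{m,0}`. -/
def Lmat (m : ℤ) : Module.End ℂ V := X.B.L m - (if m = 0 then X.a else 0) • 1

/-- The ghost extended constraints, with intercept `a - t`. -/
def Lt (t : ℂ) (m : ℤ) : Module.End ℂ V :=
  X.Lmat m + X.G.L m + (if m = 0 then t else 0) • 1

/-- The differential with intercept `a - t`. -/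
def Dt (t : ℂ) : Module.End ℂ V := X.D + t • X.G.c 0

theorem commute_BL_c (m n : ℤ) : Commute (X.B.L m) (X.G.c n) :=
  X.B.commute_L (fun s k => X.y_c s k n) m

theorem commute_BL_b (m n : ℤ) : Commute (X.B.L m) (X.G.b n) :=
  X.B.commute_L (fun s k => X.y_b s k n) m

theorem commute_Lmat_c (m n : ℤ) : Commute (X.Lmat m) (X.G.c n) :=
  (X.commute_BL_c m n).sub_left ((Commute.one_left _).smul_left _)

theorem commute_Lmat_b (m n : ℤ) : Commute (X.Lmat m) (X.G.b n) :=
  (X.commute_BL_b m n).sub_left ((Commute.one_left _).smul_left _)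

theorem commute_GL_y (m : ℤ) (s : P) (n : ℤ) : Commute (X.G.L m) (X.B.y s n) :=
  X.G.commute_L (fun k => (X.y_c s n k).symm) (fun k => (X.y_b s n k).symm) m

theorem commute_GD_y (s : P) (n : ℤ) : Commute X.G.D (X.B.y s n) :=
  X.G.commute_D (fun k => (X.y_c s n k).symm) (fun k => (X.y_b s n k).symm)

theorem commute_N_Lmat (m : ℤ) : Commute X.G.N (X.Lmat m) :=
  X.G.commute_N (fun k => (X.commute_Lmat_c m k).symm) (fun k => (X.commute_Lmat_b m k).symm)

theorem commute_GL_Lmat (m n : ℤ) : Commute (X.G.L m) (X.Lmat n) :=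
  X.G.commute_L (fun k => (X.commute_Lmat_c n k).symm) (fun k => (X.commute_Lmat_b n k).symm) m

theorem commute_GD_Lmat (n : ℤ) : Commute X.G.D (X.Lmat n) :=
  X.G.commute_D (fun k => (X.commute_Lmat_c n k).symm) (fun k => (X.commute_Lmat_b n k).symm)

theorem Lt_comm_c (t : ℂ) (m n : ℤ) :
    X.Lt t m * X.G.c n - X.G.c n * X.Lt t m = -(2 * m + n : ℂ) • X.G.c (m + n) := by
  rw [← X.G.L_comm_c, Lt, add_mul, add_mul, mul_add, mul_add, (X.commute_Lmat_c m n).eq,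
    smul_mul_assoc, mul_smul_comm, one_mul, mul_one]
  abel

theorem Lt_comm_b (t : ℂ) (m n : ℤ) :
    X.Lt t m * X.G.b n - X.G.b n * X.Lt t m = (m - n : ℂ) • X.G.b (m + n) := by
  rw [← X.G.L_comm_b, Lt, add_mul, add_mul, mul_add, mul_add, (X.commute_Lmat_b m n).eq,
    smul_mul_assoc, mul_smul_comm, one_mul, mul_one]
  abel

theorem Lt_comm_y (t : ℂ) (m : ℤ) (s : P) (n : ℤ) :
    X.Lt t m * X.B.y s n - X.B.y s n * X.Lt t m = (-n : ℂ) • X.B.y s (m + n)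
      + (if m + n = 0 then X.B.γ s * X.B.g s * m ^ 2 else 0 : ℂ) • 1 := by
  rw [← X.B.L_comm_y, Lt, Lmat, add_mul, add_mul, mul_add, mul_add, (X.commute_GL_y m s n).eq,
    smul_mul_assoc, mul_smul_comm, one_mul, mul_one, sub_mul, mul_sub, smul_mul_assoc,
    mul_smul_comm, one_mul, mul_one]
  abel

theorem commute_N_Lt (t : ℂ) (m : ℤ) : Commute X.G.N (X.Lt t m) :=
  ((X.commute_N_Lmat m).add_right (sub_eq_zero.mp (X.G.N_comm_L m))).add_right
    ((Commute.one_right _).smul_right _)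

theorem D_b (n : ℤ) : X.D * X.G.b n + X.G.b n * X.D = X.Lt 0 n := by
  have h := X.sumD.anticommutator (X.G.b n)
  have h2 := h.eq_apply n fun m hm => by
    have e := X.commute_Lmat_b m n
    have h3 := mul_anticomm_eq' (X.Lmat m) (X.G.c (-m)) (X.G.b n)
    rw [X.G.cb, if_neg (by omega), mul_zero, sub_eq_zero.mpr e.eq, zero_mul, sub_zero] at h3
    exact h3
  have h3 := mul_anticomm_eq' (X.Lmat n) (X.G.c (-n)) (X.G.b n)
  rw [X.G.cb, if_pos (by omega), mul_one, sub_eq_zero.mpr (X.commute_Lmat_b n n).eq, zero_mul,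
    sub_zero] at h3
  have h4 := h2.trans h3
  rw [Lt, ite_self, zero_smul, add_zero, ← h4, ← X.G.D_b]
  rw [sub_mul, mul_sub]
  abel

theorem D_c (n : ℤ) : X.D * X.G.c n + X.G.c n * X.D = X.G.Q n := by
  have h := X.sumD.anticommutator (X.G.c n)
  have h2 := h.eq_zero fun m => by
    have h3 := mul_anticomm_eq' (X.Lmat m) (X.G.c (-m)) (X.G.c n)
    rw [X.G.cc, mul_zero, sub_eq_zero.mpr (X.commute_Lmat_c m n).eq, zero_mul, sub_zero] at h3
    exact h3
  rw [sub_mul, mul_sub, sub_add_sub_comm, sub_eq_zero] at h2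
  exact h2

theorem sumD_comm_y (s : P) (hs : X.B.γ s = 0) (n : ℤ) :
    LocHasSum (fun m : ℤ => (-n : ℂ) • (X.B.y s (m + n) * X.G.c (-m)))
      (X.D * X.B.y s n - X.B.y s n * X.D) := by
  have h := (X.sumD.commutator (X.B.y s n)).congr
      (g := fun m : ℤ => (-n : ℂ) • (X.B.y s (m + n) * X.G.c (-m))) fun m => by
    have e : X.Lmat m * X.B.y s n - X.B.y s n * X.Lmat m = (-n : ℂ) • X.B.y s (m + n) := by
      rw [Lmat, sub_mul, mul_sub, smul_mul_assoc, one_mul, mul_smul_comm, mul_one,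
        sub_sub_sub_cancel_right, X.B.L_comm_y, hs]
      simp
    have e2 := mul_comm_eq_comm (X.Lmat m) (X.G.c (-m)) (X.B.y s n)
    rw [sub_eq_zero.mpr (X.y_c s n (-m)).symm, mul_zero, add_zero, e, smul_mul_assoc] at e2
    exact e2
  rwa [sub_mul, mul_sub, (X.commute_GD_y s n).eq, sub_sub_sub_cancel_right] at h

theorem N_comm_D : X.G.N * X.D - X.D * X.G.N = X.D := by
  have h := (X.sumD.commutator X.G.N).neg
  have h2 := h.unique (X.sumD.congr fun m => by
    have e := mul_comm_eq_comm (X.Lmat m) (X.G.c (-m)) X.G.N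
    have h4 : X.G.c (-m) * X.G.N - X.G.N * X.G.c (-m) = -X.G.c (-m) := by
      rw [← neg_sub, X.G.N_comm_c]
    rw [sub_eq_zero.mpr (X.commute_N_Lmat m).symm.eq, zero_mul, zero_add, h4, mul_neg] at e
    rw [← neg_eq_iff_eq_neg] at e
    exact e.symm)
  rw [neg_sub, sub_mul, mul_sub, sub_sub_sub_comm, X.G.N_comm_D, sub_left_inj] at h2
  exact h2

/-- The coefficient of the anomaly, with intercept `a - t`. -/
def A (t : ℂ) (m : ℤ) : ℂ := X.κ / 12 * ((m : ℂ) ^ 3 - m) - 2 * m * (1 - X.a + t)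

theorem Lmat_c_finite (j : ℤ) (q : ℤ → ℂ) (v : V) :
    (Function.support fun k : ℤ => (q k • (X.Lmat k * X.G.c (j - k))) v).Finite := by
  obtain ⟨K, hK, h⟩ := X.annL v
  obtain ⟨K', hK', h'⟩ := X.G.annC v
  refine (Set.finite_Icc (j - K') K).subset fun k hk => ?_
  by_contra hn
  rw [Set.mem_Icc] at hn
  apply hk
  by_cases h1 : K < k
  · have : X.Lmat k v = 0 := by
      rw [Lmat, if_neg (by omega)]
      simp [h k h1]
    simp only [(X.commute_Lmat_c k (j - k)).eq]
    simp [this]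
  · simp [h' (j - k) (by omega)]

/-- The extra central term `2 m a` comes from rewriting `2 m L_0` as `2 m (L_0 - a) + 2 m a` when `m
+ k = 0`. -/
theorem Lmat_comm (m k : ℤ) (hm : 0 ≤ m) : X.Lmat k * X.Lmat m - X.Lmat m * X.Lmat k
    = -(m - k : ℂ) • X.Lmat (m + k)
      + (if m + k = 0 then -((X.κ + 26) / 12 * ((m : ℂ) ^ 3 - m) + 2 * m * X.a) else 0 : ℂ)
        • 1 := by
  have h := X.matter_anomaly m k hm
  rw [BosonSystem.anomaly, sub_eq_iff_eq_add] at h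
  have e : ∀ z z' : ℂ, (X.B.L k - z • 1) * (X.B.L m - z' • 1)
      - (X.B.L m - z' • 1) * (X.B.L k - z • 1)
      = -(X.B.L m * X.B.L k - X.B.L k * X.B.L m) := fun z z' => by
    simp only [sub_mul, mul_sub, smul_mul_assoc, mul_smul_comm, one_mul, mul_one]
    module
  rw [Lmat, Lmat, Lmat, e, h]
  by_cases h0 : m + k = 0
  · have : (k : ℂ) = -m := by
      rw [eq_neg_iff_add_eq_zero, add_comm]
      exact_mod_cast h0
    rw [if_pos h0, if_pos h0, if_pos h0, this]
    module
  · rw [if_neg h0, if_neg h0, if_neg h0]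
    module

/-- The sums of `L c` cancel after a shift of index, and only central terms survive. The matter
gives `(κ + 26)(m³ - m)/12 + 2 m a` and the ghosts `-(13 m³ - m)/6`: the `26` cancels and `-2 m (1 -
a)` is left over. -/
theorem Lt_comm_D (m : ℤ) (hm : 0 ≤ m) :
    X.Lt 0 m * X.D - X.D * X.Lt 0 m = X.A 0 m • X.G.c m := by
  have hs := X.sumD.commutator (X.Lmat m + X.G.L m)
  have h1 := locHasSum_locSum _ (X.Lmat_c_finite m fun k => (2 * m - k : ℂ))
  have h2 := h1.comp_equiv (Equiv.addRight m)
  have h3 := LocHasSum.of_forall_ne (f := fun k : ℤ =>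
    (if m + k = 0 then -((X.κ + 26) / 12 * ((m : ℂ) ^ 3 - m) + 2 * m * X.a) else 0 : ℂ)
        • X.G.c (-k)) (-m) fun i hi => by rw [if_neg (by omega), zero_smul]
  have h4 := hs.unique (((h1.sub h2).add h3).congr fun k => by
    have e1 := mul_comm_eq_comm (X.Lmat k) (X.G.c (-k)) (X.Lmat m + X.G.L m)
    have e2 : X.Lmat k * (X.Lmat m + X.G.L m) - (X.Lmat m + X.G.L m) * X.Lmat k
        = X.Lmat k * X.Lmat m - X.Lmat m * X.Lmat k := by
      rw [mul_add, add_mul, (X.commute_GL_Lmat m k).eq, add_sub_add_right_eq_sub]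
    have e3 : X.G.c (-k) * (X.Lmat m + X.G.L m) - (X.Lmat m + X.G.L m) * X.G.c (-k)
        = (2 * m - k : ℂ) • X.G.c (m - k) := by
      have := X.G.L_comm_c m (-k)
      rw [mul_add, add_mul, (X.commute_Lmat_c m (-k)).eq, add_sub_add_left_eq_sub, ← neg_sub,
        this, sub_eq_add_neg m k]
      push_cast
      module
    have e4 : X.Lmat (k + m) * X.G.c (m - (k + m)) = X.Lmat (m + k) * X.G.c (-k) := by
      rw [add_comm k m, sub_add_cancel_left]
    rw [e2, e3, X.Lmat_comm m k hm] at e1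
    refine Eq.trans ?_ e1.symm
    rw [Equiv.coe_addRight, e4, add_mul, smul_mul_assoc, smul_mul_assoc, one_mul, mul_smul_comm]
    push_cast
    module)
  have h5 := X.ghost_comm m hm
  have h6 : X.Lt 0 m = X.Lmat m + X.G.L m := by
    rw [Lt, ite_self, zero_smul, add_zero]
  have h7 := (X.commute_GD_Lmat m).eq
  rw [sub_self, zero_add, if_pos (by omega), neg_neg] at h4
  have h8 : X.Lt 0 m * X.D - X.D * X.Lt 0 m
      = (X.G.L m * X.G.D - X.G.D * X.G.L m) - (X.G.D * X.Lmat m - X.Lmat m * X.G.D)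
        - ((X.D - X.G.D) * (X.Lmat m + X.G.L m) - (X.Lmat m + X.G.L m) * (X.D - X.G.D)) := by
    rw [h6]
    simp only [sub_mul, mul_sub, add_mul, mul_add]
    abel
  rw [h8, h4, h5, sub_eq_zero.mpr h7, A, ← sub_eq_zero]
  module

theorem Dt_b (t : ℂ) (n : ℤ) : X.Dt t * X.G.b n + X.G.b n * X.Dt t = X.Lt t n := by
  have h := X.D_b n
  have h2 := X.G.cb 0 n
  have e : X.Dt t * X.G.b n + X.G.b n * X.Dt t = (X.D * X.G.b n + X.G.b n * X.D)
      + t • (X.G.c 0 * X.G.b n + X.G.b n * X.G.c 0) := by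
    rw [Dt, add_mul, mul_add, smul_mul_assoc, mul_smul_comm]
    module
  rw [e, h, h2, Lt, Lt, ite_self, zero_smul, add_zero, zero_add]
  split_ifs <;> simp

theorem Dt_c (t : ℂ) (n : ℤ) : X.Dt t * X.G.c n + X.G.c n * X.Dt t = X.G.Q n := by
  have e : X.Dt t * X.G.c n + X.G.c n * X.Dt t = (X.D * X.G.c n + X.G.c n * X.D)
      + t • (X.G.c 0 * X.G.c n + X.G.c n * X.G.c 0) := by
    rw [Dt, add_mul, mul_add, smul_mul_assoc, mul_smul_comm]
    module
  rw [e, X.D_c, X.G.cc, smul_zero, add_zero]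

theorem Lt_comm_Dt (t : ℂ) (m : ℤ) (hm : 0 ≤ m) :
    X.Lt t m * X.Dt t - X.Dt t * X.Lt t m = X.A t m • X.G.c m := by
  have h := X.Lt_comm_D m hm
  have h2 := X.Lt_comm_c 0 m 0
  have e : X.Lt t m = X.Lt 0 m + (if m = 0 then t else 0) • 1 := by
    simp only [Lt, ite_self, zero_smul, add_zero]
  have e2 : X.Lt t m * X.Dt t - X.Dt t * X.Lt t m = (X.Lt 0 m * X.D - X.D * X.Lt 0 m)
      + t • (X.Lt 0 m * X.G.c 0 - X.G.c 0 * X.Lt 0 m) := by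
    rw [e, Dt]
    simp only [add_mul, mul_add, smul_mul_assoc, mul_smul_comm, one_mul, mul_one]
    module
  rw [e2, h, h2, A, A, Int.cast_zero, add_zero m, add_zero, add_zero]
  module

theorem N_comm_Dt (t : ℂ) : X.G.N * X.Dt t - X.Dt t * X.G.N = X.Dt t := by
  have h := X.N_comm_D
  have h2 := X.G.N_comm_c 0
  have e2 : X.G.N * X.Dt t - X.Dt t * X.G.N = (X.G.N * X.D - X.D * X.G.N)
      + t • (X.G.N * X.G.c 0 - X.G.c 0 * X.G.N) := by
    rw [Dt]
    simp only [add_mul, mul_add, smul_mul_assoc, mul_smul_comm]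
    module
  rw [e2, h, h2, Dt]

end StringSystem

namespace GhostSystem

variable {V : Type*} [AddCommGroup V] [Module ℂ V] (G : GhostSystem V)

theorem contr_mul_wedge (i j : ℤ) :
    G.contr i * G.wedge j + G.wedge j * G.contr i = if i = j then 1 else 0 := by
  unfold contr wedge
  split_ifs with h1 h2 h3 h3 h2 h3 h3
  all_goals first | omega | skip
  · rw [add_comm, G.cb, if_pos (by omega)]
  · rw [add_comm, G.cb, if_neg (by omega)]
  · exact G.bb _ _
  · exact G.cc _ _
  · rw [G.cb, if_pos (by omega)]
  · rw [G.cb, if_neg (by omega)]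

theorem wedge_mul_wedge (i j : ℤ) : G.wedge i * G.wedge j + G.wedge j * G.wedge i = 0 := by
  unfold wedge
  split_ifs with h1 h2 h2
  · exact G.cc _ _
  · rw [G.cb, if_neg (by omega)]
  · rw [add_comm, G.cb, if_neg (by omega)]
  · exact G.bb _ _

theorem c_c_apply (m n : ℤ) (v : V) : G.c m (G.c n v) = -G.c n (G.c m v) :=
  congrArg (fun X => X v) (G.c_mul_c m n)

theorem b_b_apply (m n : ℤ) (v : V) : G.b m (G.b n v) = -G.b n (G.b m v) :=
  congrArg (fun X => X v) (G.b_mul_b m n)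

theorem c_c_self (m : ℤ) (v : V) : G.c m (G.c m v) = 0 :=
  congrArg (fun X => X v) (G.c_mul_self m)

theorem b_b_self (m : ℤ) (v : V) : G.b m (G.b m v) = 0 :=
  congrArg (fun X => X v) (G.b_mul_self m)

theorem c_b_of_ne {m n : ℤ} (h : m + n ≠ 0) (v : V) : G.c m (G.b n v) = -G.b n (G.c m v) := by
  have := congrArg (fun X => X v) (G.cb m n)
  rw [if_neg h] at this
  exact eq_neg_of_add_eq_zero_left this

theorem c_b_add_b_c {m n : ℤ} (h : m + n = 0) (v : V) : G.c m (G.b n v) + G.b n (G.c m v) = v := by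
  have := congrArg (fun X => X v) (G.cb m n)
  rw [if_pos h] at this
  exact this

end GhostSystem

/-! ### Polarized subspaces and the grading by ghost number -/

namespace StringSystem

variable {V W P : Type*} [AddCommGroup V] [Module ℂ V] [AddCommGroup W] [Module ℂ W]
  [Fintype P] [DecidableEq P] (X : StringSystem V W P)

/-- Vectors annihilated by the modes `c_n`, `n ≥ m₀`. -/
def Pann (m₀ : ℤ) : Submodule ℂ V where
  carrier := {v | ∀ n, m₀ ≤ n → X.G.c n v = 0}
  zero_mem' := fun n _ => map_zero _
  add_mem' := fun hv hw n hn => by rw [map_add, hv n hn, hw n hn, add_zero]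
  smul_mem' := fun z v hv n hn => by rw [map_smul, hv n hn, smul_zero]

/-- Vectors of ghost number `q - 1 / 2`. -/
def Ndeg (q : ℤ) : Submodule ℂ V := X.G.N.eigenspace (q - 1 / 2)

theorem Pann_mono {m n : ℤ} (h : m ≤ n) : X.Pann m ≤ X.Pann n := fun _ hv k hk =>
  hv k (h.trans hk)

variable {X} in
theorem mem_Ndeg {q : ℤ} {v : V} : v ∈ X.Ndeg q ↔ X.G.N v = (q - 1 / 2 : ℂ) • v :=
  Module.End.mem_eigenspace_iff

theorem Ndeg_of_comm {Y : Module.End ℂ V} {k : ℤ} (h : X.G.N * Y - Y * X.G.N = (k : ℂ) • Y) {q : ℤ}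
    {v : V} (hv : v ∈ X.Ndeg q) : Y v ∈ X.Ndeg (q + k) := by
  rw [mem_Ndeg] at hv ⊢
  have := congrArg (fun X => X v) h
  simp only [LinearMap.sub_apply, Module.End.mul_apply, LinearMap.smul_apply, hv, map_smul] at this
  rw [sub_eq_iff_eq_add.mp this]
  push_cast
  module

variable {X} {q : ℤ} {v : V}

theorem c_mem_Ndeg (n : ℤ) (hv : v ∈ X.Ndeg q) : X.G.c n v ∈ X.Ndeg (q + 1) :=
  X.Ndeg_of_comm (by rw [X.G.N_comm_c]; simp) hv

theorem b_mem_Ndeg (n : ℤ) (hv : v ∈ X.Ndeg q) : X.G.b n v ∈ X.Ndeg (q - 1) :=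
  X.Ndeg_of_comm (k := -1) (by rw [X.G.N_comm_b]; simp) hv

theorem Dt_mem_Ndeg (t : ℂ) (hv : v ∈ X.Ndeg q) : X.Dt t v ∈ X.Ndeg (q + 1) :=
  X.Ndeg_of_comm (by rw [X.N_comm_Dt]; simp) hv

theorem mem_Ndeg_of_commute {Y : Module.End ℂ V} (h : Commute X.G.N Y) (hv : v ∈ X.Ndeg q) :
    Y v ∈ X.Ndeg q := by
  have := X.Ndeg_of_comm (Y := Y) (k := 0) (by rw [h.eq]; simp) hv
  rwa [add_zero] at this

theorem vac_mem_Ndeg (w : W) : X.vac w ∈ X.Ndeg 0 := by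
  rw [mem_Ndeg, X.G.N_eq]
  simp [(X.vac_vacuum w).N₀, (X.vac_vacuum w).b 0 le_rfl]

variable (X) in
/-- The words in ghost creation operators with letters in `A` and ghost number `q - 1 / 2`. -/
def GWord (A : Set ℤ) (q : ℤ) (v : V) : Prop :=
  FermiWord X.G.wedge (LinearMap.range X.vac) (fun i => if i ≤ 0 then 1 else -1) A q v

variable (X) in
/-- The span of the words in ghost creation operators with letters in `A`. -/
def gSpan (A : Set ℤ) : Submodule ℂ V :=
  fermiSpan X.G.wedge (LinearMap.range X.vac) (fun i => if i ≤ 0 then 1 else -1) A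

theorem GWord.mem_Ndeg {A : Set ℤ} (h : X.GWord A q v) : v ∈ X.Ndeg q := by
  unfold GWord at h
  induction h with
  | base h =>
    obtain ⟨w, rfl⟩ := h
    exact vac_mem_Ndeg w
  | @step i q v hi _ ih =>
    by_cases h0 : i ≤ 0
    · simpa [GhostSystem.wedge, h0] using c_mem_Ndeg i ih
    · simpa [GhostSystem.wedge, h0, ← sub_eq_add_neg] using b_mem_Ndeg (-i) ih

theorem GWord.mem_Pann {m₀ : ℤ} (hm : 1 ≤ m₀) (h : X.GWord {i | i < m₀} q v) : v ∈ X.Pann m₀ := by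
  intro n hn
  unfold GWord at h
  induction h with
  | base h =>
    obtain ⟨w, rfl⟩ := h
    exact (X.vac_vacuum w).c n (by omega)
  | @step i q v hi _ ih =>
    have hi' : i < m₀ := hi
    have h := congrArg (fun X => X v) (X.G.contr_mul_wedge n i)
    rw [if_neg (by omega)] at h
    simp only [GhostSystem.contr, if_neg (by omega : ¬ n ≤ 0), LinearMap.add_apply,
      Module.End.mul_apply, ih, map_zero, add_zero, LinearMap.zero_apply] at h
    exact h

theorem contr_vac (i : ℤ) (w : W) : X.G.contr i (X.vac w) = 0 := by
  unfold GhostSystem.contr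
  split_ifs
  · exact (X.vac_vacuum w).b _ (by omega)
  · exact (X.vac_vacuum w).c _ (by omega)

theorem mem_gSpan {A : Set ℤ} (hv : ∀ i, i ∉ A → X.G.contr i v = 0) : v ∈ X.gSpan A :=
  mem_fermiSpan_of_contr_eq_zero X.G.contr_mul_wedge X.G.wedge_mul_wedge
    (fun i u (hu : u ∈ LinearMap.range X.vac) => by
      obtain ⟨w, rfl⟩ := hu
      exact contr_vac i w)
    (X.ghost_induction (X.gSpan Set.univ)
      (fun w => Submodule.subset_span ⟨0, .base ⟨w, rfl⟩⟩)
      (fun i _ h => wedge_mem_fermiSpan (Set.mem_univ i) h) v) hv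

theorem gSpan_le (A : Set ℤ) : X.gSpan A ≤ ⨆ q, Submodule.span ℂ {u | X.GWord A q u} :=
  Submodule.span_le.mpr fun _ ⟨q, hq⟩ =>
    Submodule.mem_iSup_of_mem q (Submodule.subset_span hq)

theorem span_GWord_le (A : Set ℤ) (q : ℤ) : Submodule.span ℂ {u | X.GWord A q u} ≤ X.Ndeg q :=
  Submodule.span_le.mpr fun _ h => h.mem_Ndeg

/-- Words are eigenvectors of the ghost number operator, so independence of eigenspaces discards all
words of another degree. -/
theorem mem_span_GWord {A : Set ℤ} (h : v ∈ X.gSpan A) (hv : v ∈ X.Ndeg q) :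
    v ∈ Submodule.span ℂ {u | X.GWord A q u} := by
  have := mem_iSup_of_eigenvector X.G.N _ (fun q : ℤ => (q - 1 / 2 : ℂ)) (span_GWord_le A)
    (q - 1 / 2) (mem_Ndeg.mp hv) (gSpan_le A h)
  refine (iSup_le ?_ : (⨆ i : {i : ℤ // (i - 1 / 2 : ℂ) = q - 1 / 2},
    Submodule.span ℂ {u | X.GWord A i u}) ≤ _) this
  rintro ⟨i, hi⟩
  have : i = q := by
    have := sub_left_inj.mp hi
    exact_mod_cast this
  subst this
  exact le_rfl

theorem eq_zero_of_N_ne {z : ℂ} (hz : ∀ q : ℤ, (q - 1 / 2 : ℂ) ≠ z) (hv : X.G.N v = z • v) :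
    v = 0 := by
  have h : v ∈ X.gSpan Set.univ := mem_gSpan fun i hi => absurd (Set.mem_univ i) hi
  have := mem_iSup_of_eigenvector X.G.N _ (fun q : ℤ => (q - 1 / 2 : ℂ))
    (span_GWord_le Set.univ) z hv (gSpan_le _ h)
  refine (iSup_le ?_ : (⨆ i : {i : ℤ // (i - 1 / 2 : ℂ) = z},
    Submodule.span ℂ {u | X.GWord Set.univ i u}) ≤ ⊥) this
  rintro ⟨i, hi⟩
  exact absurd hi (hz i)

theorem Pann.mem_gSpan {m₀ : ℤ} (hm : 1 ≤ m₀) (hv : v ∈ X.Pann m₀) : v ∈ X.gSpan {i | i < m₀} :=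
  StringSystem.mem_gSpan fun i hi => by
    have hi' : ¬ i < m₀ := hi
    rw [GhostSystem.contr, if_neg (by omega)]
    exact hv i (by omega)

/-- It suffices to verify linear statements on vectors of definite ghost number. -/
theorem Pann_le {m₀ : ℤ} (hm : 1 ≤ m₀) (U : Submodule ℂ V)
    (h : ∀ q, ∀ v ∈ X.Pann m₀, v ∈ X.Ndeg q → v ∈ U) : X.Pann m₀ ≤ U := fun _ hv =>
  (Submodule.span_le.mpr fun u ⟨q, hq⟩ => h q u (GWord.mem_Pann hm hq) (GWord.mem_Ndeg hq) :
    X.gSpan {i | i < m₀} ≤ U) (Pann.mem_gSpan hm hv)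

theorem GWord.nonneg {A : Set ℤ} (hA : ∀ i ∈ A, i ≤ 0) (h : X.GWord A q v) :
    0 ≤ q ∧ (q = 0 → v ∈ LinearMap.range X.vac) := by
  unfold GWord at h
  induction h with
  | base h => exact ⟨le_rfl, fun _ => h⟩
  | @step i q v hi _ ih =>
    rw [if_pos (hA i hi)]
    exact ⟨by omega, fun h => by omega⟩

/-- A vector killed by all `c_n`, `n ≥ 1`, contains no antighost letter, and the remaining letters
only raise the degree. -/
theorem eq_zero_of_mem_Pann_one (hv : v ∈ X.Pann 1) (hq : v ∈ X.Ndeg q) (h : q < 0) : v = 0 := by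
  have h1 := mem_span_GWord (Pann.mem_gSpan le_rfl hv) hq
  refine (Submodule.span_le.mpr fun u hu => ?_ :
    Submodule.span ℂ {u | X.GWord {i | i < 1} q u} ≤ ⊥) h1
  have := GWord.nonneg (fun i (hi : i < 1) => by omega) hu
  omega

theorem mem_range_vac (hv : v ∈ X.Pann 1) (hq : v ∈ X.Ndeg 0) : v ∈ LinearMap.range X.vac := by
  have h1 := mem_span_GWord (Pann.mem_gSpan le_rfl hv) hq
  exact (Submodule.span_le.mpr fun u hu =>
    (GWord.nonneg (fun i (hi : i < 1) => by omega) hu).2 rfl :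
    Submodule.span ℂ {u | X.GWord {i | i < 1} 0 u} ≤ _) h1

theorem eq_zero_of_b_eq_zero (hv : v ∈ X.Pann 1) (hq : v ∈ X.Ndeg q) (h : q ≠ 0)
    (hb : ∀ n, 0 ≤ n → X.G.b n v = 0) : v = 0 := by
  have h0 : v ∈ X.gSpan ∅ := mem_gSpan fun i _ => by
    rw [GhostSystem.contr]
    split_ifs
    · exact hb _ (by omega)
    · exact hv i (by omega)
  have h1 := mem_span_GWord h0 hq
  refine (Submodule.span_le.mpr fun u hu => ?_ :
    Submodule.span ℂ {u | X.GWord ∅ q u} ≤ ⊥) h1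
  have hu' : X.GWord ∅ q u := hu
  unfold GWord at hu'
  cases hu' with
  | base _ => exact absurd rfl h
  | step hi _ => exact absurd hi (Set.notMem_empty _)

theorem b_mem_Pann {m₀ n : ℤ} (h : 0 < m₀ + n) (hv : v ∈ X.Pann m₀) : X.G.b n v ∈ X.Pann m₀ :=
  fun k hk => by rw [X.G.c_b_of_ne (by omega), hv k hk, map_zero, neg_zero]

theorem c_mem_Pann {m₀ : ℤ} (n : ℤ) (hv : v ∈ X.Pann m₀) : X.G.c n v ∈ X.Pann m₀ :=
  fun k hk => by rw [X.G.c_c_apply, hv k hk, map_zero, neg_zero]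

theorem c_one_mem_Pann (hv : v ∈ X.Pann 2) : X.G.c 1 v ∈ X.Pann 1 := fun k hk => by
  rcases hk.eq_or_lt with rfl | h
  · exact X.G.c_c_self 1 v
  · exact c_mem_Pann 1 hv k (by omega)

theorem c_one_b_mem_Pann (hv : v ∈ X.Pann 2) : X.G.c 1 (X.G.b (-1) v) ∈ X.Pann 1 :=
  c_one_mem_Pann (b_mem_Pann (by norm_num) hv)

/-- In `v = c_1 b_{-1} v + b_{-1} c_1 v` both `c_1 b_{-1} v` and `c_1 v` lie in `Pann 1`. The single
admissible antighost `b_{-1}` lowers the degree by one only. -/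
theorem eq_zero_of_lt_neg_one {m₀ : ℤ} (hm : m₀ ≤ 2) (hv : v ∈ X.Pann m₀) (hq : v ∈ X.Ndeg q)
    (h : q < -1) : v = 0 := by
  have hv' := X.Pann_mono hm hv
  rw [← X.G.c_b_add_b_c (by norm_num : (1 : ℤ) + -1 = 0) v,
    eq_zero_of_mem_Pann_one (c_one_mem_Pann hv') (c_mem_Ndeg 1 hq) (by omega),
    eq_zero_of_mem_Pann_one (c_one_b_mem_Pann hv') (c_mem_Ndeg 1 (b_mem_Ndeg (-1) hq)) (by omega),
    map_zero, add_zero]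

/-- The same splitting reduces to `Pann 1`, where a vector killed by all annihilation modes is a
matter state and has degree zero. Identities in positive degree can therefore be tested by applying
the `b_n`. -/
theorem eq_zero_of_b_eq_zero_of_pos {m₀ : ℤ} (hm : m₀ ≤ 2) (hv : v ∈ X.Pann m₀) (hq : v ∈ X.Ndeg q)
    (h : 0 < q) (hb : ∀ n, 0 ≤ n → X.G.b n v = 0) : v = 0 := by
  have hv' := X.Pann_mono hm hv
  rw [← X.G.c_b_add_b_c (by norm_num : (1 : ℤ) + -1 = 0) v,
    eq_zero_of_b_eq_zero (c_one_mem_Pann hv') (c_mem_Ndeg 1 hq) (by omega) fun n hn => by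
      have := X.G.c_b_of_ne (by omega : 1 + n ≠ 0) v
      rw [hb n hn, map_zero] at this
      exact neg_eq_zero.mp this.symm,
    eq_zero_of_b_eq_zero (c_one_b_mem_Pann hv') (c_mem_Ndeg 1 (b_mem_Ndeg (-1) hq)) (by omega)
      fun n hn => by
        have := X.G.c_b_of_ne (by omega : 1 + n ≠ 0) (X.G.b (-1) v)
        rw [X.G.b_b_apply, hb n hn, map_zero, neg_zero, map_zero] at this
        exact neg_eq_zero.mp this.symm,
    map_zero, add_zero]

/-! ### The differential on the polarized subspaces -/

theorem Dt_b_apply (t : ℂ) (n : ℤ) (v : V) :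
    X.Dt t (X.G.b n v) = X.Lt t n v - X.G.b n (X.Dt t v) :=
  eq_sub_of_add_eq (congrArg (fun X => X v) (X.Dt_b t n))

theorem Dt_c_apply (t : ℂ) (n : ℤ) (v : V) :
    X.Dt t (X.G.c n v) = X.G.Q n v - X.G.c n (X.Dt t v) :=
  eq_sub_of_add_eq (congrArg (fun X => X v) (X.Dt_c t n))

theorem Lt_Dt_apply (t : ℂ) {m : ℤ} (hm : 0 ≤ m) (v : V) :
    X.Lt t m (X.Dt t v) = X.Dt t (X.Lt t m v) + X.A t m • X.G.c m v :=
  sub_eq_iff_eq_add'.mp (congrArg (fun X => X v) (X.Lt_comm_Dt t m hm))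

theorem Lt_c_apply (t : ℂ) (m n : ℤ) (v : V) :
    X.Lt t m (X.G.c n v) = X.G.c n (X.Lt t m v) + (-(2 * m + n : ℂ)) • X.G.c (m + n) v :=
  sub_eq_iff_eq_add'.mp (congrArg (fun Y : Module.End ℂ V => Y v) (X.Lt_comm_c t m n))

theorem Lt_b_apply (t : ℂ) (m n : ℤ) (v : V) :
    X.Lt t m (X.G.b n v) = X.G.b n (X.Lt t m v) + (m - n : ℂ) • X.G.b (m + n) v :=
  sub_eq_iff_eq_add'.mp (congrArg (fun X => X v) (X.Lt_comm_b t m n))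

variable (X) in
theorem A_zero (t : ℂ) : X.A t 0 = 0 := by simp [A]

theorem Lt_zero_Dt (t : ℂ) (v : V) : X.Lt t 0 (X.Dt t v) = X.Dt t (X.Lt t 0 v) := by
  rw [Lt_Dt_apply t le_rfl, X.A_zero, zero_smul, add_zero]

/-- The indices of the two factors add up to `n ≥ m₀`, so at least one of them is `≥ m₀`, except for
`c_1 c_1 = 0` when `n = m₀ = 2`. This is where the bound `m₀ ≤ 2` enters. -/
theorem Q_eq_zero {m₀ n : ℤ} (hm : 1 ≤ m₀) (hm' : m₀ ≤ 2) (hn : m₀ ≤ n) (hv : v ∈ X.Pann m₀) :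
    X.G.Q n v = 0 :=
  (X.G.sumQ n).apply_eq_zero v fun k => by
    rw [LinearMap.smul_apply, Module.End.mul_apply]
    by_cases h1 : m₀ ≤ k + n
    · rw [hv _ h1, map_zero, smul_zero]
    · by_cases h2 : m₀ ≤ -k
      · rw [X.G.c_c_apply, hv _ h2, map_zero, neg_zero, smul_zero]
      · have e : k + n = -k := by omega
        rw [e, X.G.c_c_self, smul_zero]

theorem Dt_mem_Pann {m₀ : ℤ} (hm : 1 ≤ m₀) (hm' : m₀ ≤ 2) (t : ℂ) (hv : v ∈ X.Pann m₀) :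
    X.Dt t v ∈ X.Pann m₀ := fun n hn => by
  have := Dt_c_apply (X := X) t n v
  rw [hv n hn, map_zero, Q_eq_zero hm hm' hn hv, zero_sub] at this
  exact neg_eq_zero.mp this.symm

/-- The differential squares to zero on the polarized subspaces. -/
theorem Dt_Dt {m₀ : ℤ} (hm : 1 ≤ m₀) (hm' : m₀ ≤ 2) {t : ℂ}
    (hA : ∀ m, 1 ≤ m → m < m₀ → X.A t m = 0) (hv : v ∈ X.Pann m₀) : X.Dt t (X.Dt t v) = 0 := by
  -- Induction on the degree `k - 2`, starting at `-2`, where the polarized space is zero.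
  have key : ∀ k : ℕ, ∀ u ∈ X.Pann m₀, u ∈ X.Ndeg (k - 2) → X.Dt t (X.Dt t u) = 0 := by
    intro k
    induction k with
    | zero =>
      intro u hu hq
      rw [eq_zero_of_lt_neg_one hm' hu hq (by norm_num), map_zero, map_zero]
    | succ k ih =>
      intro u hu hq
      refine eq_zero_of_b_eq_zero_of_pos hm' (Dt_mem_Pann hm hm' t (Dt_mem_Pann hm hm' t hu))
        (Dt_mem_Ndeg t (Dt_mem_Ndeg t hq)) (by push_cast; omega) fun n hn => ?_
      have h1 := ih _ (b_mem_Pann (n := n) (by omega) hu)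
        (by
          have := b_mem_Ndeg n hq
          rwa [show ((k + 1 : ℕ) : ℤ) - 2 - 1 = (k : ℤ) - 2 by push_cast; ring] at this)
      -- `D² b_n - b_n D²` equals `-A_n c_n`, which vanishes on the polarized space: below `m₀` the
      -- coefficient is zero, from `m₀` on the operator is.
      have hAc : X.A t n • X.G.c n u = 0 := by
        rcases hn.eq_or_lt with h | h
        · rw [← h, X.A_zero, zero_smul]
        · by_cases h2 : n < m₀
          · rw [hA n (by omega) h2, zero_smul]
          · rw [hu n (by omega), smul_zero]
      rw [Dt_b_apply, map_sub, Dt_b_apply, Lt_Dt_apply t hn, hAc, add_zero] at h1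
      simpa using h1
  refine (Pann_le hm (LinearMap.ker (X.Dt t * X.Dt t)) fun q u hu hq => ?_) hv
  by_cases h : q < -1
  · rw [eq_zero_of_lt_neg_one hm' hu hq h]
    exact Submodule.zero_mem _
  · refine key (q + 2).toNat u hu ?_
    rwa [show ((q + 2).toNat : ℤ) - 2 = q by omega]

end StringSystem

theorem LocHasSum.remove {ι V : Type*} [DecidableEq ι] [AddCommGroup V] [Module ℂ V]
    {f : ι → Module.End ℂ V} {X : Module.End ℂ V} (hX : LocHasSum f X) (i₀ : ι) :
    LocHasSum (fun i => if i = i₀ then 0 else f i) (X - f i₀) := by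
  have h := LocHasSum.of_forall_ne (f := fun i => if i = i₀ then f i else 0) i₀
    fun i hi => if_neg hi
  rw [if_pos rfl] at h
  refine (hX.sub h).congr fun i => ?_
  split_ifs <;> simp

theorem mul_add_mul_eq {R : Type*} [Ring R] (x y z : R) :
    x * y * z + z * (x * y) = (z * x - x * z) * y + x * (z * y + y * z) := by noncomm_ring

namespace StringSystem

variable {V W P : Type*} [AddCommGroup V] [Module ℂ V] [AddCommGroup W] [Module ℂ W]
  [Fintype P] [DecidableEq P]

/-! ### Light-cone modes -/

/-- Matter modes `x` adapted to a null polarisation `s` with non-vanishing zero mode. The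
polarisation dual to `r` is `σ r`, and `τ` is the boost weight. -/
structure LightCone (X : StringSystem V W P) where
  x : P → ℤ → Module.End ℂ V
  ζ : P → ℂ
  g : P → ℂ
  σ : P → P
  τ : P → ℤ
  s : P
  comm : ∀ r r' i j, x r i * x r' j - x r' j * x r i
    = (if r' = σ r ∧ i + j = 0 then (i * g r : ℂ) else 0) • 1
  x_zero : ∀ r, x r 0 = ζ r • 1
  ζ_ne : ζ s ≠ 0
  x_Ω : ∀ r j, 0 < j → x r j (X.vac X.Ω) = 0
  x_c : ∀ r i j, Commute (x r i) (X.G.c j)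
  x_b : ∀ r i j, Commute (x r i) (X.G.b j)
  annX : ∀ r, AnnType (x r)
  y_mem : ∀ r j, X.B.y r j ∈ Submodule.span ℂ (Set.range fun r' => x r' j)
  form : ∀ i j, ∑ r, X.B.g r • nOrd (X.B.y r) i j
    = ∑ r, g r • (if i ≤ j then x r i * x (σ r) j else x r j * x (σ r) i)
  sum_γ : ∀ m : ℤ, ∑ r, (X.B.γ r * m : ℂ) • X.B.y r m = ∑ r, (X.B.γ r * m : ℂ) • x r m
  γ_τ : ∀ r, X.B.γ r = 0 ∨ τ r = 0
  σ_σ : ∀ r, σ (σ r) = r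
  g_s : g s = 1
  g_σ : g (σ s) = 1
  τ_s : τ s = -1
  τ_σ : ∀ r, τ (σ r) = -τ r
  τ_nonneg : ∀ r, r ≠ s → 0 ≤ τ r
  D_comm : ∀ n : ℤ, LocHasSum (fun m : ℤ => (-n : ℂ) • (x s (m + n) * X.G.c (-m)))
    (X.D * x s n - x s n * X.D)
  E_comm : ∀ (t : ℂ) (n : ℤ), X.Lt t 0 * x s n - x s n * X.Lt t 0 = (-n : ℂ) • x s n

/-- The letters of the words in matter and ghost modes. -/
inductive Letter (P : Type*)
  | boson (r : P) (j : ℤ)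
  | c (j : ℤ)
  | b (j : ℤ)

namespace LightCone

variable {X : StringSystem V W P} (Y : X.LightCone)

/-- The frequency of a letter. -/
def freq : Letter P → ℤ
  | .boson _ j => j
  | .c j => j
  | .b j => j

/-- The operator of a letter. -/
def op : Letter P → Module.End ℂ V
  | .boson r j => Y.x r j
  | .c j => X.G.c j
  | .b j => X.G.b j

/-- The order of a letter. -/
def ord : Letter P → ℤ
  | .boson r j => -j + Y.τ r
  | .c j => -j
  | .b j => -j

/-- The ghost number of a letter. -/
def ghn : Letter P → ℤ
  | .boson _ _ => 0
  | .c _ => 1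
  | .b _ => -1

/-- The light-cone weight of a letter. -/
def wt : Letter P → ℤ
  | .boson r j => if r = Y.s then -j else 0
  | .c j => -j
  | .b _ => 0

/-- Any two letters commute or anticommute up to a multiple of the identity, which vanishes unless
their orders and ghost numbers are opposite. -/
theorem op_mul_op (A B : Letter P) : ∃ ε z : ℂ, Y.op A * Y.op B = ε • (Y.op B * Y.op A) + z • 1 ∧
    (z ≠ 0 → Y.ord A + Y.ord B = 0 ∧ ghn A + ghn B = 0) := by
  have hcomm : ∀ {Z Z' : Module.End ℂ V}, Commute Z Z' → Z * Z' = (1 : ℂ) • (Z' * Z) + (0 : ℂ) • 1 :=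
    fun h => by rw [h.eq, one_smul, zero_smul, add_zero]
  rcases A with ⟨r, i⟩ | i | i <;> rcases B with ⟨r', j⟩ | j | j
  · refine ⟨1, if r' = Y.σ r ∧ i + j = 0 then (i * Y.g r : ℂ) else 0, ?_, ?_⟩
    · rw [one_smul]
      exact sub_eq_iff_eq_add'.mp (Y.comm r r' i j)
    · intro h
      have h' : r' = Y.σ r ∧ i + j = 0 := by
        by_contra hn
        exact h (if_neg hn)
      refine ⟨?_, rfl⟩
      simp only [ord, h'.1, Y.τ_σ]
      omega
  · exact ⟨1, 0, hcomm (Y.x_c r i j), fun h => absurd rfl h⟩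
  · exact ⟨1, 0, hcomm (Y.x_b r i j), fun h => absurd rfl h⟩
  · exact ⟨1, 0, hcomm (Y.x_c r' j i).symm, fun h => absurd rfl h⟩
  · refine ⟨-1, 0, ?_, fun h => absurd rfl h⟩
    rw [zero_smul, add_zero, neg_smul, one_smul]
    exact X.G.c_mul_c i j
  · refine ⟨-1, if i + j = 0 then 1 else 0, ?_, fun h => ?_⟩
    · have := X.G.b_mul_c i j
      rw [eq_sub_iff_add_eq] at this
      change X.G.c i * X.G.b j = _ • (X.G.b j * X.G.c i) + _
      rw [neg_smul, one_smul, ite_smul, one_smul, zero_smul, ← this]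
      abel
    · have h' : i + j = 0 := by
        by_contra hn
        exact h (if_neg hn)
      refine ⟨?_, rfl⟩
      simp only [ord]
      omega
  · exact ⟨1, 0, hcomm (Y.x_b r' j i).symm, fun h => absurd rfl h⟩
  · refine ⟨-1, if j + i = 0 then 1 else 0, ?_, fun h => ?_⟩
    · have := X.G.b_mul_c j i
      change X.G.b i * X.G.c j = _ • (X.G.c j * X.G.b i) + _
      rw [neg_smul, one_smul, ite_smul, one_smul, zero_smul, this]
      abel
    · have h' : j + i = 0 := by
        by_contra hn
        exact h (if_neg hn)
      refine ⟨?_, rfl⟩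
      simp only [ord]
      omega
  · refine ⟨-1, 0, ?_, fun h => absurd rfl h⟩
    rw [zero_smul, add_zero, neg_smul, one_smul]
    exact X.G.b_mul_b i j

/-- Words of creation operators of non-zero frequency, with order `f`, light-cone weight `l` and
ghost number `r`. -/
inductive Word : ℤ → ℤ → ℤ → V → Prop
  | vac : Word 0 0 0 (X.vac X.Ω)
  | step {A : Letter P} {f l r : ℤ} {v : V} (hA : freq A < 0) (h : Word f l r v) :
      Word (f + Y.ord A) (l + Y.wt A) (r + ghn A) (Y.op A v)

variable {Y}

/-- A creation mode has order `-j + τ ≥ 1 - 1 = 0`. A letter `c_j` has weight `-j ≥ 1`, its ghost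
number, while `b_j` lowers the ghost number but not the weight. So the weight is positive in
positive degrees and the filtration is bounded below. -/
theorem Word.bounds {f l r : ℤ} {v : V} (h : Y.Word f l r v) : 0 ≤ f ∧ r ≤ l := by
  induction h with
  | vac => simp
  | @step A f l r v hA _ ih =>
    rcases A with ⟨s, j⟩ | j | j
    · have h1 : -1 ≤ Y.τ s := by
        by_cases hs : s = Y.s
        · rw [hs, Y.τ_s]
        · have := Y.τ_nonneg s hs
          omega
      simp only [freq] at hA
      simp only [ord, wt, ghn]
      split_ifs <;> omega
    · simp only [freq] at hA
      simp only [ord, wt, ghn]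
      omega
    · simp only [freq] at hA
      simp only [ord, wt, ghn]
      omega

theorem Word.mem_Ndeg {f l r : ℤ} {v : V} (h : Y.Word f l r v) : v ∈ X.Ndeg r := by
  induction h with
  | vac => exact vac_mem_Ndeg _
  | @step A f l r v hA _ ih =>
    rcases A with ⟨s, j⟩ | j | j
    · simpa [ghn, op] using mem_Ndeg_of_commute (X.G.commute_N (fun k => (Y.x_c s j k).symm)
        fun k => (Y.x_b s j k).symm) ih
    · exact c_mem_Ndeg j ih
    · exact b_mem_Ndeg j ih

theorem Word.b_zero {f l r : ℤ} {v : V} (h : Y.Word f l r v) : X.G.b 0 v = 0 := by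
  induction h with
  | vac => exact (X.vac_vacuum _).b 0 le_rfl
  | @step A f l r v hA _ ih =>
    rcases A with ⟨s, j⟩ | j | j
    · have := congrArg (fun Z : Module.End ℂ V => Z v) (Y.x_b s j 0).eq
      simp only [Module.End.mul_apply, ih, map_zero] at this
      exact this.symm
    · have hj : j < 0 := hA
      have := X.G.c_b_of_ne (by omega : j + 0 ≠ 0) v
      rw [ih, map_zero] at this
      exact neg_eq_zero.mp this.symm
    · change X.G.b 0 (X.G.b j v) = 0
      rw [X.G.b_b_apply, ih, map_zero, neg_zero]

variable (Y) in
/-- The span of the words of order at most `n` and ghost number `r`. -/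
def F (n r : ℤ) : Submodule ℂ V := Submodule.span ℂ {v | ∃ f l, f ≤ n ∧ Y.Word f l r v}

theorem F_mono {m n : ℤ} (h : m ≤ n) (r : ℤ) : Y.F m r ≤ Y.F n r :=
  Submodule.span_mono fun _ ⟨f, l, hf, hw⟩ => ⟨f, l, hf.trans h, hw⟩

variable (Y) in
/-- Operators which raise the order by at most `j` and the ghost number by `q`. -/
def HasOrder (Z : Module.End ℂ V) (j q : ℤ) : Prop :=
  ∀ n r, ∀ v ∈ Y.F n r, Z v ∈ Y.F (n + j) (r + q)

namespace HasOrder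

variable {Z Z' : Module.End ℂ V} {j j' q q' : ℤ}

theorem of_word (h : ∀ f l r v, Y.Word f l r v → Z v ∈ Y.F (f + j) (r + q)) :
    Y.HasOrder Z j q := fun n r v hv => by
  refine (Submodule.span_le.mpr ?_ : Y.F n r ≤ (Y.F (n + j) (r + q)).comap Z) hv
  rintro u ⟨f, l, hf, hw⟩
  exact F_mono (by omega) _ (h f l r u hw)

theorem mono (h : Y.HasOrder Z j q) (hj : j ≤ j') : Y.HasOrder Z j' q := fun n r v hv =>
  F_mono (by omega) _ (h n r v hv)

theorem add (h : Y.HasOrder Z j q) (h' : Y.HasOrder Z' j q) : Y.HasOrder (Z + Z') j q :=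
  fun n r v hv => Submodule.add_mem _ (h n r v hv) (h' n r v hv)

theorem smul (z : ℂ) (h : Y.HasOrder Z j q) : Y.HasOrder (z • Z) j q :=
  fun n r v hv => Submodule.smul_mem _ z (h n r v hv)

theorem mul (h : Y.HasOrder Z j q) (h' : Y.HasOrder Z' j' q') :
    Y.HasOrder (Z * Z') (j' + j) (q' + q) := fun n r v hv => by
  have := h _ _ _ (h' n r v hv)
  rwa [add_assoc, add_assoc] at this

theorem congr (h : Y.HasOrder Z j q) (hj : j = j') (hq : q = q') : Y.HasOrder Z j' q' := by
  rwa [← hj, ← hq]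

theorem sum {ι : Type*} (s : Finset ι) {f : ι → Module.End ℂ V}
    (h : ∀ i ∈ s, Y.HasOrder (f i) j q) : Y.HasOrder (∑ i ∈ s, f i) j q := fun n r v hv => by
  rw [LinearMap.sum_apply]
  exact Submodule.sum_mem _ fun i hi => h i hi n r v hv

theorem locHasSum {ι : Type*} {f : ι → Module.End ℂ V} (hZ : LocHasSum f Z)
    (h : ∀ i, Y.HasOrder (f i) j q) : Y.HasOrder Z j q := fun n r v hv =>
  hZ.apply_mem v _ fun i => h i n r v hv

theorem zero : Y.HasOrder (0 : Module.End ℂ V) j q := fun _ _ _ _ => Submodule.zero_mem _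

end HasOrder

/-- An annihilation mode is moved to the right until it meets the vacuum; each contraction on the
way removes a letter of exactly the opposite order and ghost number. Frequency zero is excluded
because `c_0` and `b_0` are no letters and bosonic zero modes are scalars. -/
theorem hasOrder_op (A : Letter P) (hA : freq A ≠ 0) : Y.HasOrder (Y.op A) (Y.ord A) (ghn A) := by
  refine HasOrder.of_word fun f l r v hv => ?_
  rcases hA.lt_or_gt with h | h
  · exact Submodule.subset_span ⟨_, _, le_rfl, hv.step h⟩
  · induction hv with
    | vac =>
      have : Y.op A (X.vac X.Ω) = 0 := by
        rcases A with ⟨s, j⟩ | j | j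
        · exact Y.x_Ω s j h
        · exact (X.vac_vacuum _).c j h
        · exact (X.vac_vacuum _).b j (le_of_lt h)
      rw [this]
      exact Submodule.zero_mem _
    | @step B f l r v hB hv ih =>
      obtain ⟨ε, z, e, hz⟩ := Y.op_mul_op A B
      have e' := congrArg (fun Z => Z v) e
      simp only [Module.End.mul_apply, LinearMap.add_apply, LinearMap.smul_apply,
        Module.End.one_apply] at e'
      rw [e']
      refine Submodule.add_mem _ (Submodule.smul_mem _ _ ?_) ?_
      · have hB' : Y.HasOrder (Y.op B) (Y.ord B) (ghn B) := HasOrder.of_word fun f l r v hv =>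
          Submodule.subset_span ⟨_, _, le_rfl, hv.step hB⟩
        have := hB' _ _ _ ih
        rwa [add_right_comm, add_right_comm r] at this
      · by_cases h0 : z = 0
        · rw [h0, zero_smul]
          exact Submodule.zero_mem _
        · obtain ⟨h1, h2⟩ := hz h0
          exact Submodule.smul_mem _ _ (Submodule.subset_span ⟨f, l, by omega, by
            rwa [show r + ghn B + ghn A = r by omega]⟩)

theorem hasOrder_x (r : P) {j : ℤ} (h : j ≠ 0) : Y.HasOrder (Y.x r j) (-j + Y.τ r) 0 :=
  hasOrder_op (.boson r j) h

theorem hasOrder_c {j : ℤ} (h : j ≠ 0) : Y.HasOrder (X.G.c j) (-j) 1 :=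
  hasOrder_op (.c j) h

theorem hasOrder_b {j : ℤ} (h : j ≠ 0) : Y.HasOrder (X.G.b j) (-j) (-1) :=
  hasOrder_op (.b j) h

theorem hasOrder_b_zero (j q : ℤ) : Y.HasOrder (X.G.b 0) j q :=
  HasOrder.of_word fun _ _ _ _ hv => by
    rw [hv.b_zero]
    exact Submodule.zero_mem _

/-! ### The contracting homotopy -/

theorem homotopy_finite (v : V) : (Function.support fun n : ℕ =>
    (Y.x Y.s (-((n : ℤ) + 1)) * X.G.b ((n : ℤ) + 1)) v).Finite := by
  obtain ⟨K, -, h⟩ := X.G.annB v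
  exact nat_support_finite _ K fun n hn => by simp [h _ hn]

theorem weight_finite (v : V) : (Function.support fun n : ℕ =>
    (Y.x Y.s (-((n : ℤ) + 1)) * Y.x (Y.σ Y.s) ((n : ℤ) + 1)
      + ((n : ℂ) + 1) • (X.G.c (-((n : ℤ) + 1)) * X.G.b ((n : ℤ) + 1))) v).Finite := by
  obtain ⟨K, -, h⟩ := X.G.annB v
  obtain ⟨K', -, h'⟩ := Y.annX (Y.σ Y.s) v
  exact nat_support_finite _ (max K K') fun n hn => by
    simp [h _ (lt_of_le_of_lt (le_max_left _ _) hn), h' _ (lt_of_le_of_lt (le_max_right _ _) hn)]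

variable (Y) in
/-- The homotopy operator `∑_{m > 0} x_{-m} b_m`. -/
def homotopy : Module.End ℂ V :=
  locSum (fun n : ℕ => Y.x Y.s (-((n : ℤ) + 1)) * X.G.b ((n : ℤ) + 1)) homotopy_finite

variable (Y) in
/-- The light-cone weight operator. -/
def weight : Module.End ℂ V :=
  locSum (fun n : ℕ => Y.x Y.s (-((n : ℤ) + 1)) * Y.x (Y.σ Y.s) ((n : ℤ) + 1)
      + ((n : ℂ) + 1) • (X.G.c (-((n : ℤ) + 1)) * X.G.b ((n : ℤ) + 1))) weight_finite

variable (Y) in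
/-- The anticommutator of the differential with the homotopy operator. -/
def laplacian : Module.End ℂ V := Y.homotopy * X.D + X.D * Y.homotopy

theorem weight_term_comm (A : Letter P) (hA : freq A < 0) (n : ℕ) :
    (Y.x Y.s (-((n : ℤ) + 1)) * Y.x (Y.σ Y.s) ((n : ℤ) + 1)
      + ((n : ℂ) + 1) • (X.G.c (-((n : ℤ) + 1)) * X.G.b ((n : ℤ) + 1))) * Y.op A
      - Y.op A * (Y.x Y.s (-((n : ℤ) + 1)) * Y.x (Y.σ Y.s) ((n : ℤ) + 1)
      + ((n : ℂ) + 1) • (X.G.c (-((n : ℤ) + 1)) * X.G.b ((n : ℤ) + 1)))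
      = if (n : ℤ) + 1 + freq A = 0 then (Y.wt A : ℂ) • Y.op A else 0 := by
  have hadd : ∀ (M N Z : Module.End ℂ V) (z : ℂ), (M + z • N) * Z - Z * (M + z • N)
      = (M * Z - Z * M) + z • (N * Z - Z * N) := fun M N Z z => by
    rw [add_mul, mul_add, smul_mul_assoc, mul_smul_comm]
    module
  rw [hadd]
  rcases A with ⟨r, j⟩ | j | j
  · have h1 := mul_comm_eq_comm (Y.x Y.s (-((n : ℤ) + 1))) (Y.x (Y.σ Y.s) ((n : ℤ) + 1)) (Y.x r j)
    have h2 := ((Y.x_c r j (-((n : ℤ) + 1))).symm.mul_left (Y.x_b r j ((n : ℤ) + 1)).symm).eq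
    have hj : j < 0 := hA
    rw [Y.comm, Y.comm, if_neg (by omega), zero_smul, zero_mul, zero_add, Y.σ_σ, Y.g_σ] at h1
    rw [show freq (Letter.boson r j) = j from rfl, show Y.op (Letter.boson r j) = Y.x r j from rfl,
      show Y.wt (Letter.boson r j) = if r = Y.s then -j else 0 from rfl]
    rw [h1, h2, sub_self, smul_zero, add_zero, mul_smul_comm, mul_one]
    by_cases h : (n : ℤ) + 1 + j = 0
    · have e : -((n : ℤ) + 1) = j := by omega
      have e' : ((n : ℤ) : ℂ) + 1 = -j := by
        rw [← e]
        push_cast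
        ring
      by_cases hr : r = Y.s
      · rw [if_pos ⟨hr, h⟩, if_pos h, if_pos hr, e, hr]
        push_cast
        rw [← e']
        simp
      · rw [if_neg (by tauto), if_pos h, if_neg hr, Int.cast_zero, zero_smul, zero_smul]
    · rw [if_neg (by tauto), if_neg h, zero_smul]
  · have h1 := mul_comm_eq_anticomm (X.G.c (-((n : ℤ) + 1))) (X.G.b ((n : ℤ) + 1)) (X.G.c j)
    have h2 := ((Y.x_c Y.s (-((n : ℤ) + 1)) j).mul_left (Y.x_c (Y.σ Y.s) ((n : ℤ) + 1) j)).eq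
    rw [add_comm (X.G.b _ * X.G.c j), X.G.cb, X.G.cc, zero_mul, sub_zero] at h1
    rw [show freq (Letter.c j) = j from rfl, show Y.op (Letter.c j) = X.G.c j from rfl,
      show Y.wt (Letter.c j) = -j from rfl]
    rw [h1, h2, sub_self, zero_add]
    by_cases h : (n : ℤ) + 1 + j = 0
    · have e : -((n : ℤ) + 1) = j := by omega
      have e' : (n : ℂ) + 1 = -j := by
        rw [← e]
        push_cast
        ring
      rw [if_pos h, if_pos (by omega), e, mul_one, e']
      push_cast
      rfl
    · rw [if_neg h, if_neg (by omega), mul_zero, smul_zero]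
  · have h1 := mul_comm_eq_anticomm (X.G.c (-((n : ℤ) + 1))) (X.G.b ((n : ℤ) + 1)) (X.G.b j)
    have h2 := ((Y.x_b Y.s (-((n : ℤ) + 1)) j).mul_left (Y.x_b (Y.σ Y.s) ((n : ℤ) + 1) j)).eq
    have hj : j < 0 := hA
    rw [X.G.cb, X.G.bb, mul_zero, if_neg (by omega), zero_mul, sub_zero] at h1
    rw [show freq (Letter.b j) = j from rfl, show Y.op (Letter.b j) = X.G.b j from rfl,
      show Y.wt (Letter.b j) = 0 from rfl]
    rw [h1, h2, sub_self, smul_zero, add_zero, Int.cast_zero, zero_smul, ite_self]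

theorem weight_comm (A : Letter P) (hA : freq A < 0) :
    Y.weight * Y.op A - Y.op A * Y.weight = (Y.wt A : ℂ) • Y.op A := by
  have hs := ((locHasSum_locSum _ (weight_finite (Y := Y))).commutator (Y.op A)).congr
    fun n => weight_term_comm A hA n
  have h := hs.eq_apply (-freq A - 1).toNat fun n hn => if_neg (by omega)
  rwa [if_pos (by omega)] at h

theorem Word.weight {f l r : ℤ} {v : V} (h : Y.Word f l r v) : Y.weight v = (l : ℂ) • v := by
  induction h with
  | vac =>
    rw [Int.cast_zero, zero_smul]
    refine (locHasSum_locSum _ (weight_finite (Y := Y))).apply_eq_zero _ fun n => ?_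
    simp [Y.x_Ω (Y.σ Y.s) ((n : ℤ) + 1) (by omega),
      (X.vac_vacuum X.Ω).b ((n : ℤ) + 1) (by omega)]
  | @step A f l r v hA _ ih =>
    have := congrArg (fun Z : Module.End ℂ V => Z v) (weight_comm (Y := Y) A hA)
    simp only [LinearMap.sub_apply, Module.End.mul_apply, LinearMap.smul_apply, ih, map_smul,
      sub_eq_iff_eq_add] at this
    rw [this, ← add_smul]
    push_cast
    rw [add_comm]

theorem hasOrder_b' (j : ℤ) : Y.HasOrder (X.G.b j) (-j) (-1) := by
  by_cases h : j = 0
  · rw [h]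
    exact hasOrder_b_zero _ _
  · exact hasOrder_b h

/-- Bilinears in non-zero modes have order `-m`, the boost weights of dual polarisations being
opposite. Among the terms with a zero mode only `ζ_s x_{σ s, m}` has the higher order `-m + 1`,
since `τ (σ r) ≤ 0` for `r ≠ s`. -/
theorem hasOrder_matter {m : ℤ} (hm : 0 < m) :
    Y.HasOrder (X.B.L m - Y.ζ Y.s • Y.x (Y.σ Y.s) m) (-m) 0 := by
  have hs := (LocHasSum.sum Finset.univ _ _ fun r (_ : r ∈ Finset.univ) =>
    (X.B.sumQuad r m).smul (X.B.g r)).congr fun k => Y.form (m + k) (-k)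
  -- The indices `k = 0` and `k = -m` are those with a zero mode. They give the same operator, which
  -- cancels the prefactor `1/2` of the quadratic part.
  have h2 := (hs.remove 0).remove (-m)
  set Q := ∑ r, X.B.g r • X.B.quad r m with hQ
  set Zt := ∑ r, (Y.g r * Y.ζ r) • Y.x (Y.σ r) m with hZt
  have e0 : ∑ r, Y.g r • (if m + 0 ≤ -0 then Y.x r (m + 0) * Y.x (Y.σ r) (-0)
      else Y.x r (-0) * Y.x (Y.σ r) (m + 0)) = Zt := Finset.sum_congr rfl fun r _ => by
    rw [if_neg (by omega), neg_zero, add_zero, Y.x_zero, smul_mul_assoc, one_mul, smul_smul]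
  have em : ∑ r, Y.g r • (if m + -m ≤ - -m then Y.x r (m + -m) * Y.x (Y.σ r) (- -m)
      else Y.x r (- -m) * Y.x (Y.σ r) (m + -m)) = Zt := Finset.sum_congr rfl fun r _ => by
    rw [if_pos (by omega), neg_neg, add_neg_cancel, Y.x_zero, smul_mul_assoc, one_mul, smul_smul]
  rw [if_neg (by omega), e0, em] at h2
  have hQo : Y.HasOrder (Q - Zt - Zt) (-m) 0 := HasOrder.locHasSum h2 fun k => by
    split_ifs with h h'
    · exact HasOrder.zero
    · exact HasOrder.zero
    all_goals
      refine HasOrder.sum _ fun r _ => HasOrder.smul _ ?_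
      have hτ := Y.τ_σ r
      exact ((hasOrder_x r (by omega)).mul (hasOrder_x (Y.σ r) (by omega))).congr (by omega) rfl
  have hZo : Y.HasOrder (Zt - Y.ζ Y.s • Y.x (Y.σ Y.s) m) (-m) 0 := by
    rw [hZt, ← Finset.add_sum_erase _ _ (Finset.mem_univ Y.s), Y.g_s, one_mul, add_sub_cancel_left]
    refine HasOrder.sum _ fun r hr => HasOrder.smul _ ((hasOrder_x (Y.σ r) (by omega)).mono ?_)
    have := Y.τ_nonneg r (Finset.ne_of_mem_erase hr)
    have hτ := Y.τ_σ r
    omega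
  have hγo : Y.HasOrder (∑ r, (X.B.γ r * m : ℂ) • X.B.y r m) (-m) 0 := by
    rw [Y.sum_γ]
    refine HasOrder.sum _ fun r _ => ?_
    rcases Y.γ_τ r with h | h
    · rw [h, zero_mul, zero_smul]
      exact HasOrder.zero
    · exact ((hasOrder_x r (by omega)).smul _).congr (by omega) rfl
  have e : X.B.L m - Y.ζ Y.s • Y.x (Y.σ Y.s) m = (1 / 2 : ℂ) • (Q - Zt - Zt)
      + (∑ r, (X.B.γ r * m : ℂ) • X.B.y r m) + (Zt - Y.ζ Y.s • Y.x (Y.σ Y.s) m) := by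
    rw [X.B.L_eq, if_neg (by omega), ← hQ]
    module
  rw [e]
  exact ((hQo.smul _).add hγo).add hZo

/-- The term containing `c_0`, which is not a letter, is split off; in the Laplacian it cancels
against the one from `[D, x_{-m}]`. -/
theorem hasOrder_ghost {m : ℤ} (hm : 0 < m) :
    Y.HasOrder (X.G.L m + (m : ℂ) • (X.G.c 0 * X.G.b m)) (-m) 0 := by
  have h := (X.G.sumL m).remove 0
  have e : X.G.L m - (((0 : ℤ) : ℂ) - m) • fermiOrd X.G.c X.G.b (-0) (m + 0)
      = X.G.L m + (m : ℂ) • (X.G.c 0 * X.G.b m) := by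
    rw [fermiOrd, if_neg (by omega), if_neg (by omega), neg_zero, add_zero, Int.cast_zero]
    module
  rw [e] at h
  refine HasOrder.locHasSum h fun k => ?_
  split_ifs with hk
  · exact HasOrder.zero
  · refine HasOrder.smul _ ?_
    unfold fermiOrd
    rw [if_neg (by omega)]
    split_ifs
    · have := ((hasOrder_b' (Y := Y) (m + k)).mul (hasOrder_c (j := -k) (by omega))).smul (-1)
      rw [neg_smul, one_smul] at this
      exact this.congr (by omega) (by omega)
    · exact ((hasOrder_c (j := -k) (by omega)).mul (hasOrder_b' (Y := Y) (m + k))).congr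
        (by omega) (by omega)

/-- The zero mode of `x` yields the leading term `m ζ c_{-m}`. All other terms retain a factor `x_s`
of boost weight `-1`, which lowers the order by one. -/
theorem hasOrder_D_comm {m : ℤ} (hm : 0 < m) :
    Y.HasOrder (X.D * Y.x Y.s (-m) - Y.x Y.s (-m) * X.D - (m * Y.ζ Y.s : ℂ) • X.G.c (-m)
      - (m : ℂ) • (Y.x Y.s (-m) * X.G.c 0)) (m - 1) 1 := by
  have h := ((Y.D_comm (-m)).remove m).remove 0
  have e1 : (-((-m : ℤ) : ℂ)) • (Y.x Y.s (m + -m) * X.G.c (-m)) = (m * Y.ζ Y.s : ℂ) • X.G.c (-m) := by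
    rw [add_neg_cancel, Y.x_zero, smul_mul_assoc, one_mul, smul_smul]
    push_cast
    rw [neg_neg]
  have e2 : (-((-m : ℤ) : ℂ)) • (Y.x Y.s (0 + -m) * X.G.c (-0)) = (m : ℂ) • (Y.x Y.s (-m) * X.G.c 0) := by
    rw [zero_add, neg_zero]
    push_cast
    rw [neg_neg]
  rw [if_neg (by omega), e1, e2] at h
  have hτ := Y.τ_s
  refine HasOrder.locHasSum h fun k => ?_
  split_ifs
  · exact HasOrder.zero
  · exact HasOrder.zero
  · exact (((hasOrder_x Y.s (by omega)).mul (hasOrder_c (by omega))).smul _).congr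
      (by omega) (by omega)

/-- The leading parts of `[D, x_{-m}] b_m` and `x_{-m} L_m^tot` are `ζ` times the two terms of the
weight operator. What is left loses one unit of order through a mode `x_s`. -/
theorem hasOrder_laplacian_sub : Y.HasOrder (Y.laplacian - Y.ζ Y.s • Y.weight) (-1) 0 := by
  have h := ((locHasSum_locSum _ (homotopy_finite (Y := Y))).anticommutator X.D).sub
    ((locHasSum_locSum _ (weight_finite (Y := Y))).smul (Y.ζ Y.s))
  refine HasOrder.locHasSum h fun n => ?_
  have hm : 0 < (n : ℤ) + 1 := by omega
  have hn : ((n : ℂ) + 1) = (((n : ℤ) + 1 : ℤ) : ℂ) := by push_cast; rfl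
  rw [hn]
  generalize (n : ℤ) + 1 = m at hm
  -- Here the two terms `x_{-m} c_0 b_m`, from the commutator with `D` and from the ghost
  -- constraint, cancel.
  have e : Y.x Y.s (-m) * X.G.b m * X.D + X.D * (Y.x Y.s (-m) * X.G.b m)
      - Y.ζ Y.s • (Y.x Y.s (-m) * Y.x (Y.σ Y.s) m + (m : ℂ) • (X.G.c (-m) * X.G.b m))
      = (X.D * Y.x Y.s (-m) - Y.x Y.s (-m) * X.D - (m * Y.ζ Y.s : ℂ) • X.G.c (-m)
          - (m : ℂ) • (Y.x Y.s (-m) * X.G.c 0)) * X.G.b m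
        + Y.x Y.s (-m) * ((X.B.L m - Y.ζ Y.s • Y.x (Y.σ Y.s) m)
          + (X.G.L m + (m : ℂ) • (X.G.c 0 * X.G.b m))) := by
    have hL : X.Lt 0 m = X.B.L m + X.G.L m := by
      rw [Lt, Lmat, if_neg (by omega), if_neg (by omega), zero_smul, sub_zero, add_zero]
    rw [mul_add_mul_eq, X.D_b, hL]
    generalize X.D * Y.x Y.s (-m) - Y.x Y.s (-m) * X.D = C
    simp only [sub_mul, mul_sub, mul_add, smul_mul_assoc, mul_smul_comm, mul_assoc]
    module
  rw [e]
  have hτ := Y.τ_s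
  refine HasOrder.add ?_ ?_
  · exact ((hasOrder_D_comm hm).mul (hasOrder_b' m)).congr (by omega) (by omega)
  · exact ((hasOrder_x Y.s (by omega)).mul ((hasOrder_matter hm).add (hasOrder_ghost hm))).congr
      (by omega) (by omega)

/-- On a word of weight `l ≥ r ≥ 1` the Laplacian is `ζ l ≠ 0` plus terms of lower order, which
belong to the regular part by induction. There are no words of negative order to start with. -/
theorem F_le_regularPart {r : ℤ} (hr : 1 ≤ r) (n : ℕ) :
    Y.F ((n : ℤ) - 1) r ≤ regularPart Y.laplacian := by
  induction n with
  | zero =>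
    refine Submodule.span_le.mpr ?_
    rintro v ⟨f, l, hf, hw⟩
    have := hw.bounds
    simp only [CharP.cast_eq_zero] at hf
    omega
  | succ n ih =>
    refine Submodule.span_le.mpr ?_
    rintro v ⟨f, l, hf, hw⟩
    have hl : (l : ℂ) ≠ 0 := by
      have := hw.bounds
      exact_mod_cast (by omega : l ≠ 0)
    refine mem_regularPart_of_sub (mul_ne_zero Y.ζ_ne hl) (ih ?_)
    have h1 := hasOrder_laplacian_sub (Y := Y) _ _ v (Submodule.subset_span ⟨f, l, hf, hw⟩)
    rw [LinearMap.sub_apply, LinearMap.smul_apply, hw.weight, smul_smul, add_zero] at h1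
    exact F_mono (by push_cast; omega) _ h1

/-- Words without zero modes of the ghosts suffice: `b_0 v = 0` gives `v = b_0 c_0 v`, and `b_0 c_0`
projects away the letter `c_0`. -/
theorem mem_regularPart {r : ℤ} (hr : 1 ≤ r) {v : V} (hv : v ∈ X.Ndeg r) (hb : X.G.b 0 v = 0) :
    v ∈ regularPart Y.laplacian := by
  let G : ℤ → Submodule ℂ V := fun r => Submodule.span ℂ {u | ∃ f l, Y.Word f l r u}
  have hG : ∀ A : Letter P, freq A < 0 → ∀ u ∈ ⨆ r, G r, Y.op A u ∈ ⨆ r, G r := by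
    intro A hA u hu
    refine (iSup_le fun r => Submodule.span_le.mpr ?_ :
      (⨆ r, G r) ≤ (⨆ r, G r).comap (Y.op A)) hu
    rintro u ⟨f, l, hw⟩
    exact Submodule.mem_iSup_of_mem _ (Submodule.subset_span ⟨_, _, hw.step hA⟩)
  have hvac : ∀ w, X.vac w ∈ ⨆ r, G r := by
    refine X.matter_induction _ (Submodule.mem_iSup_of_mem 0
      (Submodule.subset_span ⟨0, 0, .vac⟩)) fun s m hm u hu => ?_
    have h1 := Y.y_mem s m
    generalize X.B.y s m = Z at h1
    induction h1 using Submodule.span_induction with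
    | mem Z h =>
      obtain ⟨r', rfl⟩ := h
      exact hG (.boson r' m) hm u hu
    | zero => exact Submodule.zero_mem _
    | add Z Z' _ _ h h' => exact Submodule.add_mem _ h h'
    | smul z Z _ h => exact Submodule.smul_mem _ z h
  -- Creation modes of non-zero frequency commute with the even operator `b_0 c_0`, while `c_0`
  -- itself is annihilated by it.
  have hall : ∀ u, X.G.b 0 (X.G.c 0 u) ∈ ⨆ r, G r := by
    have key := X.ghost_induction ((⨆ r, G r).comap (X.G.b 0 * X.G.c 0))
    refine key (fun w => ?_) fun i u hu => ?_
    · have := X.G.c_b_add_b_c (add_zero 0) (X.vac w)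
      rw [(X.vac_vacuum w).b 0 le_rfl, map_zero, zero_add] at this
      change X.G.b 0 (X.G.c 0 (X.vac w)) ∈ ⨆ r, G r
      rw [this]
      exact hvac w
    · change X.G.b 0 (X.G.c 0 (X.G.wedge i u)) ∈ ⨆ r, G r
      have hu' : X.G.b 0 (X.G.c 0 u) ∈ ⨆ r, G r := hu
      rw [GhostSystem.wedge]
      rcases lt_trichotomy i 0 with h | h | h
      · rw [if_pos h.le, X.G.c_c_apply, map_neg]
        have := X.G.c_b_of_ne (by omega : i + 0 ≠ 0) (X.G.c 0 u)
        rw [← this]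
        exact hG (.c i) h _ hu'
      · rw [if_pos h.le, h, X.G.c_c_self, map_zero]
        exact Submodule.zero_mem _
      · rw [if_neg (by omega), X.G.c_b_of_ne (by omega), map_neg, X.G.b_b_apply, neg_neg]
        exact hG (.b (-i)) (by simp only [freq]; omega) _ hu'
  have hv' : v ∈ ⨆ r, G r := by
    have h1 := X.G.c_b_add_b_c (add_zero 0) v
    rw [hb, map_zero, zero_add] at h1
    rw [← h1]
    exact hall v
  have h2 := mem_iSup_of_eigenvector X.G.N G (fun q : ℤ => (q - 1 / 2 : ℂ))
    (fun q => Submodule.span_le.mpr fun u ⟨_, _, hw⟩ => hw.mem_Ndeg) (r - 1 / 2) (mem_Ndeg.mp hv) hv'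
  refine (iSup_le ?_ : (⨆ i : {i : ℤ // (i - 1 / 2 : ℂ) = r - 1 / 2}, G i) ≤ _) h2
  rintro ⟨i, hi⟩
  have : i = r := by
    have := sub_left_inj.mp hi
    exact_mod_cast this
  subst this
  refine Submodule.span_le.mpr ?_
  rintro u ⟨f, l, hw⟩
  exact F_le_regularPart hr (f + 1).toNat (Submodule.subset_span ⟨f, l, by
    have := hw.bounds.1
    omega, hw⟩)

end LightCone

end StringSystem

/-! ### Null combinations of two polarisations -/

section Pairing

variable {V : Type*} [AddCommGroup V] [Module ℂ V]

/-- With `τ² = -g g'` the form `g a² + g' b²` factors like a difference of squares; both mixed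
products are kept because the operators need not commute. -/
theorem null_form (a b a' b' : Module.End ℂ V) {g g' τ : ℂ} (hg : g * g = 1)
    (hτ : τ * τ = -(g * g')) :
    g • (a * a') + g' • (b * b') = (a + τ • b) * ((g / 2) • (a' - τ • b'))
      + ((g / 2) • (a - τ • b)) * (a' + τ • b') := by
  have h : g' = -(g * (τ * τ)) := by
    rw [hτ]
    linear_combination (-g') * hg
  rw [h]
  simp only [add_mul, mul_add, sub_mul, mul_sub, smul_mul_assoc, mul_smul_comm, smul_sub, smul_add,
    smul_smul]
  module

/-- If both square roots `±w` failed, adding `z + w z' = 0` and `z - w z' = 0` would give `z = 0`.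
With complex coefficients the signature of the two polarisations is irrelevant. -/
theorem exists_null_coeff {g g' z z' : ℂ} (hz : z ≠ 0) :
    ∃ τ : ℂ, τ * τ = -(g * g') ∧ z + τ * z' ≠ 0 := by
  obtain ⟨w, hw⟩ := IsAlgClosed.exists_eq_mul_self (-(g * g'))
  by_cases h : z + w * z' = 0
  · refine ⟨-w, by rw [hw]; ring, fun h' => hz ?_⟩
    linear_combination (1 / 2 : ℂ) * h + (1 / 2 : ℂ) * h'
  · exact ⟨w, hw.symm, h⟩

variable {P : Type*} [Fintype P] [DecidableEq P] (B : BosonSystem V P)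

theorem BosonSystem.comm_comb {s t : P} (hst : s ≠ t) (α β α' β' : ℂ) (i j : ℤ) :
    (α • B.y s i + β • B.y t i) * (α' • B.y s j + β' • B.y t j)
      - (α' • B.y s j + β' • B.y t j) * (α • B.y s i + β • B.y t i)
      = (if i + j = 0 then i * (α * α' * B.g s + β * β' * B.g t) else 0 : ℂ) • 1 := by
  have h1 := B.comm_eq_smul s s i j
  have h2 := B.comm_eq_smul t t i j
  have h3 := B.comm_eq_smul s t i j
  have h4 := B.comm_eq_smul t s i j
  rw [if_neg (by tauto), zero_smul] at h3
  rw [if_neg (by tauto), zero_smul] at h4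
  have e : (α • B.y s i + β • B.y t i) * (α' • B.y s j + β' • B.y t j)
      - (α' • B.y s j + β' • B.y t j) * (α • B.y s i + β • B.y t i)
      = (α * α') • (B.y s i * B.y s j - B.y s j * B.y s i)
        + (β * β') • (B.y t i * B.y t j - B.y t j * B.y t i)
        + (α * β') • (B.y s i * B.y t j - B.y t j * B.y s i)
        + (β * α') • (B.y t i * B.y s j - B.y s j * B.y t i) := by
    simp only [add_mul, mul_add, smul_mul_assoc, mul_smul_comm, smul_add, smul_smul]
    module
  rw [e, h1, h2, h3, h4]
  by_cases h : i + j = 0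
  · simp only [h, and_self, if_true]
    module
  · simp [h]

theorem BosonSystem.comm_comb_y {s t r : P} (hs : s ≠ r) (ht : t ≠ r) (α β : ℂ) (i j : ℤ) :
    (α • B.y s i + β • B.y t i) * B.y r j - B.y r j * (α • B.y s i + β • B.y t i) = 0 := by
  have h1 := B.comm_eq_smul s r i j
  have h2 := B.comm_eq_smul t r i j
  rw [if_neg (by tauto), zero_smul] at h1
  rw [if_neg (by tauto), zero_smul] at h2
  have e : (α • B.y s i + β • B.y t i) * B.y r j - B.y r j * (α • B.y s i + β • B.y t i)
      = α • (B.y s i * B.y r j - B.y r j * B.y s i)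
        + β • (B.y t i * B.y r j - B.y r j * B.y t i) := by
    simp only [add_mul, mul_add, smul_mul_assoc, mul_smul_comm]
    module
  rw [e, h1, h2, smul_zero, smul_zero, add_zero]

end Pairing

namespace StringSystem

variable {V W P : Type*} [AddCommGroup V] [Module ℂ V] [AddCommGroup W] [Module ℂ W]
  [Fintype P] [DecidableEq P] (X : StringSystem V W P)

/-- The modes adapted to the null polarisations `y s ± τ y t`. -/
def nullMode (s t : P) (τ : ℂ) (r : P) (j : ℤ) : Module.End ℂ V :=
  if r = s then (1 : ℂ) • X.B.y s j + τ • X.B.y t j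
  else if r = t then (X.B.g s / 2) • X.B.y s j + (-(X.B.g s / 2 * τ)) • X.B.y t j
  else X.B.y r j

theorem nullMode_induction {s t : P} {τ : ℂ} {j : ℤ} {p : Module.End ℂ V → Prop}
    (h : ∀ r, p (X.B.y r j)) (hadd : ∀ Z Z', p Z → p Z' → p (Z + Z'))
    (hsmul : ∀ (z : ℂ) Z, p Z → p (z • Z)) (r : P) : p (X.nullMode s t τ r j) := by
  unfold nullMode
  split_ifs
  · exact hadd _ _ (hsmul _ _ (h s)) (hsmul _ _ (h t))
  · exact hadd _ _ (hsmul _ _ (h s)) (hsmul _ _ (h t))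
  · exact h r

theorem sum_erase_erase {M : Type*} [AddCommMonoid M] {s t : P} (hst : s ≠ t) (f : P → M) :
    ∑ r, f r = f s + (f t + ∑ r ∈ (Finset.univ.erase s).erase t, f r) := by
  rw [Finset.add_sum_erase _ _ (Finset.mem_erase.mpr ⟨hst.symm, Finset.mem_univ t⟩),
    Finset.add_sum_erase _ _ (Finset.mem_univ s)]

/-- A polarisation with non-vanishing zero mode gives rise to light-cone modes. -/
theorem nonempty_lightCone {s t : P} (hst : s ≠ t) (hs : X.B.γ s = 0) (ht : X.B.γ t = 0)
    (hz : X.B.z s ≠ 0) : Nonempty X.LightCone := by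
  obtain ⟨τ, hτ, hζ⟩ := exists_null_coeff (g := X.B.g s) (g' := X.B.g t) (z' := X.B.z t) hz
  have hgs := X.B.g_mul_self s
  have hgt := X.B.g_mul_self t
  have es : ∀ j, X.nullMode s t τ s j = (1 : ℂ) • X.B.y s j + τ • X.B.y t j := fun j => if_pos rfl
  have et : ∀ j, X.nullMode s t τ t j
      = (X.B.g s / 2) • X.B.y s j + (-(X.B.g s / 2 * τ)) • X.B.y t j := fun j => by
    rw [nullMode, if_neg hst.symm, if_pos rfl]
  have er : ∀ r j, r ≠ s → r ≠ t → X.nullMode s t τ r j = X.B.y r j := fun r j h h' => by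
    rw [nullMode, if_neg h, if_neg h']
  have et' : ∀ j, X.nullMode s t τ t j = (X.B.g s / 2) • (X.B.y s j - τ • X.B.y t j) := fun j => by
    rw [et]
    module
  have hrest : ∀ r ∈ (Finset.univ.erase s).erase t, r ≠ s ∧ r ≠ t := fun r hr =>
    ⟨(Finset.mem_erase.mp (Finset.mem_of_mem_erase hr)).1, Finset.ne_of_mem_erase hr⟩
  refine ⟨{
    x := X.nullMode s t τ
    ζ := fun r => if r = s then X.B.z s + τ * X.B.z t
      else if r = t then X.B.g s / 2 * (X.B.z s - τ * X.B.z t) else X.B.z r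
    g := fun r => if r = s then 1 else if r = t then 1 else X.B.g r
    σ := Equiv.swap s t
    τ := fun r => if r = s then -1 else if r = t then 1 else 0
    s := s
    comm := ?_
    x_zero := ?_
    ζ_ne := by rwa [if_pos rfl]
    x_Ω := fun r j hj => X.nullMode_induction (p := fun Z => Z (X.vac X.Ω) = 0)
      (fun r => X.Ω_vacuum r j hj) (fun Z Z' h h' => by rw [LinearMap.add_apply, h, h', add_zero])
      (fun z Z h => by rw [LinearMap.smul_apply, h, smul_zero]) r
    x_c := fun r i j => X.nullMode_induction (p := fun Z => Commute Z (X.G.c j))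
      (fun r => X.y_c r i j) (fun Z Z' h h' => h.add_left h') (fun z Z h => h.smul_left z) r
    x_b := fun r i j => X.nullMode_induction (p := fun Z => Commute Z (X.G.b j))
      (fun r => X.y_b r i j) (fun Z Z' h h' => h.add_left h') (fun z Z h => h.smul_left z) r
    annX := fun r v => by
      choose K hK h using fun r => X.annY r v
      refine ⟨∑ r, K r, Finset.sum_nonneg fun r _ => hK r, fun n hn => ?_⟩
      exact X.nullMode_induction (p := fun Z => Z v = 0)
        (fun r => h r n (lt_of_le_of_lt (Finset.single_le_sum (fun r _ => hK r)
          (Finset.mem_univ r)) hn))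
        (fun Z Z' h h' => by rw [LinearMap.add_apply, h, h', add_zero])
        (fun z Z h => by rw [LinearMap.smul_apply, h, smul_zero]) r
    y_mem := ?_
    form := ?_
    sum_γ := ?_
    γ_τ := fun r => by
      by_cases h : r = s
      · exact Or.inl (h ▸ hs)
      · by_cases h' : r = t
        · exact Or.inl (h' ▸ ht)
        · exact Or.inr (by rw [if_neg h, if_neg h'])
    σ_σ := fun r => Equiv.swap_apply_self s t r
    g_s := if_pos rfl
    g_σ := by rw [Equiv.swap_apply_left, if_neg hst.symm, if_pos rfl]
    τ_s := if_pos rfl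
    τ_σ := fun r => by
      by_cases h : r = s
      · rw [h, Equiv.swap_apply_left, if_neg hst.symm, if_pos rfl, if_pos rfl, neg_neg]
      · by_cases h' : r = t
        · rw [h', Equiv.swap_apply_right, if_pos rfl, if_neg hst.symm, if_pos rfl]
        · rw [Equiv.swap_apply_of_ne_of_ne h h', if_neg h, if_neg h', neg_zero]
    τ_nonneg := fun r h => by
      rw [if_neg h]
      split_ifs <;> norm_num
    D_comm := ?_
    E_comm := ?_ }⟩
  · intro r r' i j
    by_cases h1 : r = s
    · subst h1
      rw [Equiv.swap_apply_left, if_pos rfl, es]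
      by_cases h2 : r' = r
      · rw [h2, es, X.B.comm_comb hst, if_neg (show ¬ (r = t ∧ i + j = 0) by tauto), zero_smul]
        have : (1 * 1 * X.B.g r + τ * τ * X.B.g t : ℂ) = 0 := by
          linear_combination X.B.g t * hτ - X.B.g r * hgt
        rw [this, mul_zero, ite_self, zero_smul]
      · by_cases h3 : r' = t
        · rw [h3, et, X.B.comm_comb hst]
          by_cases h : i + j = 0
          · rw [if_pos h, if_pos ⟨rfl, h⟩]
            congr 1
            linear_combination (i / 2 : ℂ) * hgs
              - (i / 2 * X.B.g r * X.B.g t : ℂ) * hτ + (i / 2 * X.B.g t ^ 2 : ℂ) * hgs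
              + (i / 2 : ℂ) * hgt
          · rw [if_neg h, if_neg (by tauto)]
        · rw [er r' j h2 h3, X.B.comm_comb_y (Ne.symm h2) (Ne.symm h3), if_neg (by tauto), zero_smul]
    · by_cases h1' : r = t
      · subst h1'
        rw [Equiv.swap_apply_right, if_neg h1, if_pos rfl, et]
        by_cases h2 : r' = s
        · rw [h2, es, X.B.comm_comb hst]
          by_cases h : i + j = 0
          · rw [if_pos h, if_pos ⟨rfl, h⟩]
            congr 1
            linear_combination (i / 2 : ℂ) * hgs
              - (i / 2 * X.B.g s * X.B.g r : ℂ) * hτ + (i / 2 * X.B.g r ^ 2 : ℂ) * hgs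
              + (i / 2 : ℂ) * hgt
          · rw [if_neg h, if_neg (by tauto)]
        · by_cases h3 : r' = r
          · rw [h3, et, X.B.comm_comb hst, if_neg (show ¬ (r = s ∧ i + j = 0) by tauto), zero_smul]
            have : (X.B.g s / 2 * (X.B.g s / 2) * X.B.g s
                + -(X.B.g s / 2 * τ) * -(X.B.g s / 2 * τ) * X.B.g r : ℂ) = 0 := by
              linear_combination (X.B.g s ^ 2 / 4 * X.B.g r : ℂ) * hτ
                - (X.B.g s ^ 3 / 4 : ℂ) * hgt
            rw [this, mul_zero, ite_self, zero_smul]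
          · rw [er r' j h2 h3, X.B.comm_comb_y (Ne.symm h2) (Ne.symm h3), if_neg (by tauto),
              zero_smul]
      · rw [Equiv.swap_apply_of_ne_of_ne h1 h1', er r i h1 h1', if_neg h1, if_neg h1']
        by_cases h2 : r' = s
        · rw [h2, es, ← neg_sub, X.B.comm_comb_y (Ne.symm h1) (Ne.symm h1'),
            if_neg (by rintro ⟨h, -⟩; exact h1 h.symm), zero_smul, neg_zero]
        · by_cases h3 : r' = t
          · rw [h3, et, ← neg_sub, X.B.comm_comb_y (Ne.symm h1) (Ne.symm h1'),
              if_neg (by rintro ⟨h, -⟩; exact h1' h.symm), zero_smul, neg_zero]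
          · rw [er r' j h2 h3, X.B.comm_eq_smul]
            by_cases h : r' = r
            · subst h
              simp
            · rw [if_neg (by rintro ⟨h', -⟩; exact h h'.symm), if_neg (by tauto)]
  · intro r
    unfold nullMode
    split_ifs
    · rw [X.B.y_zero, X.B.y_zero]
      module
    · rw [X.B.y_zero, X.B.y_zero]
      module
    · rw [X.B.y_zero]
  · intro r j
    -- The change of basis has to be inverted; `τ² = -g_s g_t` is non-zero because the metric
    -- coefficients square to one.
    have hτ0 : τ ≠ 0 := by
      rintro rfl
      have : X.B.g s * X.B.g t = 0 := by
        rw [zero_mul] at hτ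
        exact neg_eq_zero.mp hτ.symm
      rcases mul_eq_zero.mp this with h | h
      · simp [h] at hgs
      · simp [h] at hgt
    have hmem : ∀ r', X.nullMode s t τ r' j
        ∈ Submodule.span ℂ (Set.range fun r' => X.nullMode s t τ r' j) := fun r' =>
      Submodule.subset_span ⟨r', rfl⟩
    by_cases h : r = s
    · have e : X.B.y r j = (1 / 2 : ℂ) • X.nullMode s t τ s j
          + X.B.g s • X.nullMode s t τ t j := by
        rw [es, et', h, smul_smul, mul_div_assoc', hgs]
        module
      rw [e]
      exact Submodule.add_mem _ (Submodule.smul_mem _ _ (hmem s)) (Submodule.smul_mem _ _ (hmem t))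
    · by_cases h' : r = t
      · have e : X.B.y r j = τ⁻¹ • ((1 / 2 : ℂ) • X.nullMode s t τ s j
            + (-X.B.g s) • X.nullMode s t τ t j) := by
          rw [es, et', h', smul_smul, neg_mul, mul_div_assoc', hgs, eq_inv_smul_iff₀ hτ0]
          module
        rw [e]
        exact Submodule.smul_mem _ _ (Submodule.add_mem _ (Submodule.smul_mem _ _ (hmem s))
          (Submodule.smul_mem _ _ (hmem t)))
      · rw [← er r j h h']
        exact hmem r
  · intro i j
    rw [sum_erase_erase hst, sum_erase_erase hst, Equiv.swap_apply_left, Equiv.swap_apply_right,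
      ← add_assoc, ← add_assoc]
    congr 1
    · rw [if_pos rfl, if_neg hst.symm, if_pos rfl, one_smul, one_smul]
      unfold nOrd
      split_ifs
      · rw [es, es, et', et', one_smul, one_smul]
        exact null_form _ _ _ _ hgs hτ
      · rw [es, es, et', et', one_smul, one_smul]
        exact null_form _ _ _ _ hgs hτ
    · refine Finset.sum_congr rfl fun r hr => ?_
      obtain ⟨h, h'⟩ := hrest r hr
      rw [if_neg h, if_neg h', Equiv.swap_apply_of_ne_of_ne h h', er r i h h', er r j h h']
      rfl
  · intro m
    rw [sum_erase_erase hst, sum_erase_erase hst, hs, ht]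
    simp only [zero_mul, zero_smul, zero_add]
    refine Finset.sum_congr rfl fun r hr => ?_
    obtain ⟨h, h'⟩ := hrest r hr
    rw [er r m h h']
  · intro n
    have h1 := (X.sumD_comm_y s hs n).add ((X.sumD_comm_y t ht n).smul τ)
    have e : X.D * X.nullMode s t τ s n - X.nullMode s t τ s n * X.D
        = (X.D * X.B.y s n - X.B.y s n * X.D) + τ • (X.D * X.B.y t n - X.B.y t n * X.D) := by
      rw [es, one_smul, mul_add, add_mul, mul_smul_comm, smul_mul_assoc]
      module
    rw [e]
    refine h1.congr fun m => ?_
    rw [es, one_smul, add_mul, smul_mul_assoc]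
    module
  · intro u n
    have h1 := X.Lt_comm_y u 0 s n
    have h2 := X.Lt_comm_y u 0 t n
    have e : X.Lt u 0 * X.nullMode s t τ s n - X.nullMode s t τ s n * X.Lt u 0
        = (X.Lt u 0 * X.B.y s n - X.B.y s n * X.Lt u 0)
          + τ • (X.Lt u 0 * X.B.y t n - X.B.y t n * X.Lt u 0) := by
      rw [es, one_smul, mul_add, add_mul, mul_smul_comm, smul_mul_assoc]
      module
    rw [e, h1, h2, hs, ht, es, zero_add]
    simp only [zero_mul, ite_self, zero_smul, add_zero]
    module

end StringSystem

/-! ### The relative complex and its exactness in positive degrees -/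

namespace StringSystem

variable {V W P : Type*} [AddCommGroup V] [Module ℂ V] [AddCommGroup W] [Module ℂ W]
  [Fintype P] [DecidableEq P] (X : StringSystem V W P)

/-- The relative subspaces: polarized vectors on the mass shell and annihilated by `b_0`. -/
def K (t : ℂ) (m₀ : ℤ) : Submodule ℂ V :=
  X.Pann m₀ ⊓ LinearMap.ker (X.Lt t 0) ⊓ LinearMap.ker (X.G.b 0)

variable {X}

theorem mem_K {t : ℂ} {m₀ : ℤ} {v : V} :
    v ∈ X.K t m₀ ↔ v ∈ X.Pann m₀ ∧ X.Lt t 0 v = 0 ∧ X.G.b 0 v = 0 := and_assoc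

theorem Dt_mem_K {m₀ : ℤ} (hm : 1 ≤ m₀) (hm' : m₀ ≤ 2) {t : ℂ} {v : V} (hv : v ∈ X.K t m₀) :
    X.Dt t v ∈ X.K t m₀ := by
  obtain ⟨h1, h2, h3⟩ := mem_K.mp hv
  refine mem_K.mpr ⟨Dt_mem_Pann hm hm' t h1, by rw [Lt_zero_Dt, h2, map_zero], ?_⟩
  have := Dt_b_apply (X := X) t 0 v
  rw [h2, h3, map_zero, zero_sub] at this
  exact neg_eq_zero.mp this.symm

namespace LightCone

variable (Y : X.LightCone)

/-- The homotopy contains only `b_m` with `m > 0`, and these have no contraction with `c_n` for `n ≥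
0`. Hence it preserves polarization. -/
theorem homotopy_c {n : ℤ} (hn : 0 ≤ n) (v : V) :
    Y.homotopy (X.G.c n v) = -X.G.c n (Y.homotopy v) := by
  have h := (locHasSum_locSum _ (homotopy_finite (Y := Y))).anticommutator (X.G.c n)
  have h2 := h.eq_zero fun k => by
    rw [mul_anticomm_eq', add_comm (X.G.b _ * X.G.c n), X.G.cb, if_neg (by omega), mul_zero,
      zero_sub, sub_eq_zero.mpr (Y.x_c _ _ n).eq, zero_mul, neg_zero]
  exact eq_neg_of_add_eq_zero_left (congrArg (fun Z : Module.End ℂ V => Z v) h2)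

theorem homotopy_b (n : ℤ) (v : V) :
    Y.homotopy (X.G.b n v) = -X.G.b n (Y.homotopy v) := by
  have h := (locHasSum_locSum _ (homotopy_finite (Y := Y))).anticommutator (X.G.b n)
  have h2 := h.eq_zero fun k => by
    rw [mul_anticomm_eq', X.G.bb, mul_zero, zero_sub, sub_eq_zero.mpr (Y.x_b _ _ n).eq, zero_mul,
      neg_zero]
  exact eq_neg_of_add_eq_zero_left (congrArg (fun Z : Module.End ℂ V => Z v) h2)

theorem Lt_zero_homotopy (t : ℂ) (v : V) : X.Lt t 0 (Y.homotopy v) = Y.homotopy (X.Lt t 0 v) := by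
  have h : Commute Y.homotopy (X.Lt t 0) :=
    (locHasSum_locSum _ (homotopy_finite (Y := Y))).commute fun n => by
      have h1 := Y.E_comm t (-((n : ℤ) + 1))
      have h2 := X.Lt_comm_b t 0 ((n : ℤ) + 1)
      rw [zero_add] at h2
      have h3 := mul_comm_eq_comm (Y.x Y.s (-((n : ℤ) + 1))) (X.G.b ((n : ℤ) + 1)) (X.Lt t 0)
      have h1' : Y.x Y.s (-((n : ℤ) + 1)) * X.Lt t 0 - X.Lt t 0 * Y.x Y.s (-((n : ℤ) + 1)) = _ :=
        (neg_sub _ _).symm.trans (congrArg Neg.neg h1)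
      have h2' : X.G.b ((n : ℤ) + 1) * X.Lt t 0 - X.Lt t 0 * X.G.b ((n : ℤ) + 1) = _ :=
        (neg_sub _ _).symm.trans (congrArg Neg.neg h2)
      rw [h1', h2'] at h3
      refine sub_eq_zero.mp (h3.trans ?_)
      rw [neg_mul, smul_mul_assoc, mul_neg, mul_smul_comm]
      push_cast
      module
  exact (congrArg (fun Z : Module.End ℂ V => Z v) h.eq).symm

theorem homotopy_mem_Ndeg {q : ℤ} {v : V} (hv : v ∈ X.Ndeg q) : Y.homotopy v ∈ X.Ndeg (q - 1) :=
  (locHasSum_locSum _ (homotopy_finite (Y := Y))).apply_mem v _ fun n =>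
    mem_Ndeg_of_commute (Y := Y.x Y.s (-((n : ℤ) + 1)))
      (X.G.commute_N (fun k => (Y.x_c _ _ k).symm) fun k => (Y.x_b _ _ k).symm) (b_mem_Ndeg _ hv)

theorem homotopy_mem_K {t : ℂ} {m₀ : ℤ} (hm : 1 ≤ m₀) {v : V} (hv : v ∈ X.K t m₀) :
    Y.homotopy v ∈ X.K t m₀ := by
  obtain ⟨h1, h2, h3⟩ := mem_K.mp hv
  refine mem_K.mpr ⟨fun n hn => ?_, by rw [Lt_zero_homotopy, h2, map_zero], ?_⟩
  · have := Y.homotopy_c (by omega : 0 ≤ n) v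
    rw [h1 n hn, map_zero] at this
    exact neg_eq_zero.mp this.symm
  · have := Y.homotopy_b 0 v
    rw [h3, map_zero] at this
    exact neg_eq_zero.mp this.symm

/-- The homotopy anticommutes with `c_0`, so the shift of intercept by `t` cancels. One analysis of
the Laplacian thus serves all intercepts, in particular `a` and `a - 1`. -/
theorem laplacian_apply (t : ℂ) {v : V} (hv : X.Dt t v = 0) :
    Y.laplacian v = X.Dt t (Y.homotopy v) := by
  have h1 : X.D v = -(t • X.G.c 0 v) := eq_neg_of_add_eq_zero_left hv
  change Y.homotopy (X.D v) + X.D (Y.homotopy v) = X.D (Y.homotopy v) + t • X.G.c 0 (Y.homotopy v)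
  rw [h1, map_neg, map_smul, Y.homotopy_c le_rfl, smul_neg, neg_neg, add_comm]

include Y in
/-- The relative complexes are exact in positive degrees. -/
theorem exists_primitive {m₀ : ℤ} (hm : 1 ≤ m₀) (hm' : m₀ ≤ 2) {t : ℂ}
    (hA : ∀ m, 1 ≤ m → m < m₀ → X.A t m = 0) {q : ℤ} (hq : 1 ≤ q) {v : V} (hv : v ∈ X.K t m₀)
    (hvq : v ∈ X.Ndeg q) (hD : X.Dt t v = 0) :
    ∃ u ∈ X.K t m₀, u ∈ X.Ndeg (q - 1) ∧ X.Dt t u = v := by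
  -- Closed relative vectors of degree `q` are stable under the Laplacian, so it can be inverted
  -- among them; then `v = {h, D} w = D (h w)`.
  obtain ⟨w, hw, rfl⟩ := exists_preimage_of_mem_regularPart
    (mem_regularPart (Y := Y) hq hvq (mem_K.mp hv).2.2)
    (X.K t m₀ ⊓ X.Ndeg q ⊓ LinearMap.ker (X.Dt t)) (fun u hu => by
      obtain ⟨⟨h1, h2⟩, h3⟩ := hu
      rw [Y.laplacian_apply t h3]
      have hK := Y.homotopy_mem_K hm h1
      refine ⟨⟨Dt_mem_K hm hm' hK, ?_⟩, Dt_Dt hm hm' hA (mem_K.mp hK).1⟩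
      have := Dt_mem_Ndeg t (Y.homotopy_mem_Ndeg h2)
      rwa [sub_add_cancel] at this) ⟨⟨hv, hvq⟩, hD⟩
  obtain ⟨⟨h1, h2⟩, h3⟩ := hw
  exact ⟨_, Y.homotopy_mem_K hm h1, Y.homotopy_mem_Ndeg h2, (Y.laplacian_apply t h3).symm⟩

end LightCone

/-! ### Reduction to the mass shell -/

/-- The vacuum is an eigenvector, and each creation mode shifts the eigenvalue by a constant. -/
theorem mem_iSup_eigenspace (v : V) : v ∈ ⨆ e, (X.Lt 0 0).eigenspace e := by
  have hstep : ∀ (Z : Module.End ℂ V) (z : ℂ), X.Lt 0 0 * Z - Z * X.Lt 0 0 = z • Z →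
      ∀ u ∈ ⨆ e, (X.Lt 0 0).eigenspace e, Z u ∈ ⨆ e, (X.Lt 0 0).eigenspace e := by
    intro Z z hZ u hu
    refine (iSup_le fun e => ?_ :
      (⨆ e, (X.Lt 0 0).eigenspace e) ≤ (⨆ e, (X.Lt 0 0).eigenspace e).comap Z) hu
    intro w hw
    refine Submodule.mem_iSup_of_mem (e + z) (Module.End.mem_eigenspace_iff.mpr ?_)
    have := congrArg (fun Z : Module.End ℂ V => Z w) hZ
    simp only [LinearMap.sub_apply, Module.End.mul_apply, LinearMap.smul_apply,
      Module.End.mem_eigenspace_iff.mp hw, map_smul] at this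
    rw [sub_eq_iff_eq_add.mp this, ← add_smul, add_comm]
  refine X.ghost_induction (⨆ e, (X.Lt 0 0).eigenspace e)
    (X.matter_induction (⨆ e, (X.Lt 0 0).eigenspace e) ?_ fun s m hm => hstep _ (-m) ?_)
    (fun i u hu => ?_) v
  · refine Submodule.mem_iSup_of_mem (X.B.vacEnergy - X.a) (Module.End.mem_eigenspace_iff.mpr ?_)
    simp only [Lt, Lmat, if_true, zero_smul, add_zero, LinearMap.add_apply, LinearMap.sub_apply,
      LinearMap.smul_apply, Module.End.one_apply, X.Ω_vacuum.L_zero,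
      (X.vac_vacuum X.Ω).L le_rfl, sub_smul]
  · rw [X.Lt_comm_y, if_neg (by omega), zero_smul, add_zero, zero_add]
  · unfold GhostSystem.wedge
    split_ifs
    · refine hstep _ (-i) ?_ u hu
      rw [X.Lt_comm_c, zero_add, Int.cast_zero, mul_zero, zero_add]
    · refine hstep _ i ?_ u hu
      rw [X.Lt_comm_b, zero_add]
      push_cast
      rw [zero_sub, neg_neg]

/-- For a diagonalisable operator an image vector has no component of eigenvalue zero. -/
theorem Lt_zero_mem_regularPart (v : V) : X.Lt 0 0 v ∈ regularPart (X.Lt 0 0) := by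
  refine (iSup_le fun e => ?_ : (⨆ e, (X.Lt 0 0).eigenspace e) ≤
    (regularPart (X.Lt 0 0)).comap (X.Lt 0 0)) (mem_iSup_eigenspace v)
  intro u hu
  have hu' := Module.End.mem_eigenspace_iff.mp hu
  change X.Lt 0 0 u ∈ regularPart (X.Lt 0 0)
  by_cases he : e = 0
  · rw [hu', he, zero_smul]
    exact Submodule.zero_mem _
  · rw [hu']
    refine Submodule.smul_mem _ _ (mem_regularPart_of_sub he ?_)
    rw [hu', sub_self]
    exact Submodule.zero_mem _

/-- `L_0^tot` is invertible on its own image, also within an invariant subspace, so the part off the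
mass shell can be subtracted without leaving `U`. -/
theorem exists_on_shell (U : Submodule ℂ V) (hU : ∀ u ∈ U, X.Lt 0 0 u ∈ U) {v : V} (hv : v ∈ U) :
    ∃ u ∈ U, X.Lt 0 0 (v - X.Lt 0 0 u) = 0 := by
  obtain ⟨w, ⟨u, hu, rfl⟩, hw⟩ := exists_preimage_of_mem_regularPart
    (Lt_zero_mem_regularPart (X := X) v) (U.map (X.Lt 0 0)) (fun u hu => by
      obtain ⟨w, hw, rfl⟩ := hu
      exact ⟨_, hU w hw, rfl⟩) ⟨v, hv, rfl⟩
  exact ⟨u, hu, by rw [map_sub, hw, sub_self]⟩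

theorem Lt_zero_eq_zero {v : V} (h : X.Lt 0 0 (X.Lt 0 0 v) = 0) : X.Lt 0 0 v = 0 := by
  obtain ⟨w, hw, hw'⟩ := exists_preimage_of_mem_regularPart
    (Lt_zero_mem_regularPart (X := X) v) (LinearMap.ker (X.Lt 0 0)) (fun u hu => by
      rw [LinearMap.mem_ker] at hu
      rw [hu]
      exact Submodule.zero_mem _) h
  rw [← hw']
  exact hw

theorem Lt_zero_mem_Pann {t : ℂ} {m₀ : ℤ} {v : V} (hv : v ∈ X.Pann m₀) :
    X.Lt t 0 v ∈ X.Pann m₀ := fun n hn => by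
  have := Lt_c_apply (X := X) t 0 n v
  rw [zero_add, hv n hn, map_zero, smul_zero, add_zero] at this
  exact this.symm

section Cohomology

variable {m₀ : ℤ} (hm : 1 ≤ m₀) (hm' : m₀ ≤ 2)
include hm hm'

/-- On a closed vector `L_0^tot = {D, b_0}` acts as `D b_0`, so the part subtracted to reach the
mass shell is exact. -/
theorem exists_cohomologous_on_shell {q : ℤ} {v : V} (hv : v ∈ X.Pann m₀) (hq : v ∈ X.Ndeg q)
    (hD : X.Dt 0 v = 0) : ∃ w ∈ X.Pann m₀, w ∈ X.Ndeg q ∧ X.Dt 0 w = 0 ∧ X.Lt 0 0 w = 0 ∧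
      ∃ u ∈ X.Pann m₀, u ∈ X.Ndeg (q - 1) ∧ X.Dt 0 u = v - w := by
  obtain ⟨u, ⟨⟨h1, h2⟩, h3⟩, hu⟩ := exists_on_shell (X := X)
    (X.Pann m₀ ⊓ X.Ndeg q ⊓ LinearMap.ker (X.Dt 0)) (fun u ⟨⟨h1, h2⟩, h3⟩ =>
      ⟨⟨Lt_zero_mem_Pann h1, mem_Ndeg_of_commute (X.commute_N_Lt 0 0) h2⟩, by
        have h3' : X.Dt 0 u = 0 := h3
        change X.Dt 0 (X.Lt 0 0 u) = 0
        rw [← Lt_zero_Dt, h3', map_zero]⟩) ⟨⟨hv, hq⟩, hD⟩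
  replace h3 : X.Dt 0 u = 0 := h3
  refine ⟨v - X.Lt 0 0 u, Submodule.sub_mem _ hv (Lt_zero_mem_Pann h1),
    Submodule.sub_mem _ hq (mem_Ndeg_of_commute (X.commute_N_Lt 0 0) h2), ?_, hu, X.G.b 0 u,
    b_mem_Pann (by omega) h1, b_mem_Ndeg 0 h2, ?_⟩
  · rw [map_sub, hD, ← Lt_zero_Dt, h3, map_zero, sub_zero]
  · rw [Dt_b_apply, h3, map_zero, sub_zero, sub_sub_cancel]

omit hm hm' in
theorem exists_primitive_on_shell {q : ℤ} {u : V} (hu : u ∈ X.Pann m₀) (hq : u ∈ X.Ndeg q)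
    (hE : X.Lt 0 0 (X.Dt 0 u) = 0) : ∃ w ∈ X.Pann m₀, w ∈ X.Ndeg q ∧ X.Lt 0 0 w = 0 ∧
      X.Dt 0 w = X.Dt 0 u := by
  obtain ⟨w, ⟨h1, h2⟩, hw⟩ := exists_on_shell (X := X) (X.Pann m₀ ⊓ X.Ndeg q) (fun u ⟨h1, h2⟩ =>
    ⟨Lt_zero_mem_Pann h1, mem_Ndeg_of_commute (X.commute_N_Lt 0 0) h2⟩) ⟨hu, hq⟩
  refine ⟨u - X.Lt 0 0 w, Submodule.sub_mem _ hu (Lt_zero_mem_Pann h1),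
    Submodule.sub_mem _ hq (mem_Ndeg_of_commute (X.commute_N_Lt 0 0) h2), hw, ?_⟩
  have h3 : X.Lt 0 0 (X.Lt 0 0 (X.Dt 0 w)) = 0 := by
    rw [map_sub, sub_eq_zero] at hw
    rw [Lt_zero_Dt, Lt_zero_Dt, ← hw, ← Lt_zero_Dt, hE]
  rw [map_sub, ← Lt_zero_Dt, Lt_zero_eq_zero h3, sub_zero]

omit hm hm' in
theorem b_c_zero_add (v : V) : X.G.b 0 (X.G.c 0 v) + X.G.c 0 (X.G.b 0 v) = v := by
  rw [add_comm]
  exact X.G.c_b_add_b_c (add_zero 0) v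

omit hm' in
theorem b_zero_mem_K {v : V} (hv : v ∈ X.Pann m₀) (hE : X.Lt 0 0 v = 0) : X.G.b 0 v ∈ X.K 0 m₀ := by
  refine mem_K.mpr ⟨b_mem_Pann (by omega) hv, ?_, X.G.b_b_self 0 v⟩
  rw [Lt_b_apply, hE, map_zero, Int.cast_zero, sub_self, zero_smul, add_zero]

omit hm hm' in
theorem Lt_zero_c_zero (t : ℂ) (v : V) : X.Lt t 0 (X.G.c 0 v) = X.G.c 0 (X.Lt t 0 v) := by
  rw [Lt_c_apply, Int.cast_zero, mul_zero, add_zero, neg_zero, zero_smul, add_zero]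

omit hm' in
theorem b_c_zero_mem_K {v : V} (hv : v ∈ X.Pann m₀) (hE : X.Lt 0 0 v = 0) :
    X.G.b 0 (X.G.c 0 v) ∈ X.K 0 m₀ :=
  b_zero_mem_K hm (c_mem_Pann 0 hv) (by rw [Lt_zero_c_zero, hE, map_zero])

omit hm hm' in
theorem Dt_c_zero (v : V) : X.Dt 0 (X.G.c 0 v) = X.G.Q 0 v - X.G.c 0 (X.Dt 0 v) :=
  Dt_c_apply 0 0 v

theorem Q_mem_K {v : V} (hv : v ∈ X.K 0 m₀) : X.G.Q 0 v ∈ X.K 0 m₀ := by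
  have hD := Dt_mem_K hm hm' hv
  obtain ⟨h1, h2, h3⟩ := mem_K.mp hv
  obtain ⟨h1', h2', h3'⟩ := mem_K.mp hD
  have e : X.G.Q 0 v = X.Dt 0 (X.G.c 0 v) + X.G.c 0 (X.Dt 0 v) := by
    rw [Dt_c_zero, sub_add_cancel]
  have hb := b_c_zero_add (X := X) v
  have hb' := b_c_zero_add (X := X) (X.Dt 0 v)
  rw [h3, map_zero, add_zero] at hb
  rw [h3', map_zero, add_zero] at hb'
  have hE : X.Lt 0 0 (X.G.c 0 v) = 0 := by rw [Lt_zero_c_zero, h2, map_zero]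
  rw [e]
  refine mem_K.mpr ⟨Submodule.add_mem _ (Dt_mem_Pann hm hm' 0 (c_mem_Pann 0 h1))
    (c_mem_Pann 0 h1'), ?_, ?_⟩
  · rw [map_add, Lt_zero_Dt, hE, map_zero, Lt_zero_c_zero, h2', map_zero, add_zero]
  · have h4 := Dt_b_apply (X := X) 0 0 (X.G.c 0 v)
    rw [hb, hE, zero_sub] at h4
    rw [map_add, hb', ← neg_eq_iff_eq_neg.mpr h4, neg_add_cancel]

omit hm hm' in
theorem Q_mem_Ndeg {q : ℤ} {v : V} (hv : v ∈ X.Ndeg q) : X.G.Q 0 v ∈ X.Ndeg (q + 2) := by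
  have e : X.G.Q 0 v = X.Dt 0 (X.G.c 0 v) + X.G.c 0 (X.Dt 0 v) := by
    rw [Dt_c_zero, sub_add_cancel]
  rw [e, show q + 2 = q + 1 + 1 by ring]
  exact Submodule.add_mem _ (Dt_mem_Ndeg 0 (c_mem_Ndeg 0 hv)) (c_mem_Ndeg 0 (Dt_mem_Ndeg 0 hv))

variable (hA : ∀ m, 1 ≤ m → m < m₀ → X.A 0 m = 0)
include hA

/-- `{D, c_0}` commutes with `D` as soon as `D² = 0`. -/
theorem Dt_Q {v : V} (hv : v ∈ X.Pann m₀) : X.Dt 0 (X.G.Q 0 v) = X.G.Q 0 (X.Dt 0 v) := by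
  have e : ∀ v, X.G.Q 0 v = X.Dt 0 (X.G.c 0 v) + X.G.c 0 (X.Dt 0 v) := fun v => by
    rw [Dt_c_zero, sub_add_cancel]
  rw [e, e, map_add, Dt_Dt hm hm' hA (c_mem_Pann 0 hv), Dt_Dt hm hm' hA hv, map_zero, zero_add,
    add_zero]

omit hm hm' hA in
/-- Components of an absolute cocycle on the mass shell. -/
theorem Dt_b_zero_of_closed {v : V} (hE : X.Lt 0 0 v = 0) (hD : X.Dt 0 v = 0) :
    X.Dt 0 (X.G.b 0 v) = 0 ∧ X.Dt 0 (X.G.b 0 (X.G.c 0 v)) = -X.G.Q 0 (X.G.b 0 v) := by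
  have h1 : X.Dt 0 (X.G.b 0 v) = 0 := by
    rw [Dt_b_apply, hE, hD, map_zero, sub_zero]
  refine ⟨h1, ?_⟩
  have h2 := congrArg (X.Dt 0) (b_c_zero_add (X := X) v)
  rw [map_add, Dt_c_zero, h1, map_zero, sub_zero, hD] at h2
  exact eq_neg_of_add_eq_zero_left h2

variable (Y : X.LightCone)
  (hneg : ∀ q, q < 0 → ∀ v ∈ X.K 0 m₀, v ∈ X.Ndeg q → X.Dt 0 v = 0 → v = 0)

include Y hneg in
-- On the mass shell write `w = ψ₀ + c_0 ψ₁` with `ψ₁ = b_0 w` and `ψ₀ = b_0 c_0 w`, of relative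
-- degrees `q - 1` and `q`. For `q < 0` both vanish; for `q ≥ 2` both degrees are positive and the
-- two equations are solved in turn.
theorem exists_primitive_of_ne {q : ℤ} (h0 : q ≠ 0) (h1 : q ≠ 1) {v : V} (hv : v ∈ X.Pann m₀)
    (hq : v ∈ X.Ndeg q) (hD : X.Dt 0 v = 0) :
    ∃ u ∈ X.Pann m₀, u ∈ X.Ndeg (q - 1) ∧ X.Dt 0 u = v := by
  obtain ⟨w, hw, hwq, hwD, hwE, u, hu, huq, huD⟩ := exists_cohomologous_on_shell hm hm' hv hq hD
  suffices h : ∃ u' ∈ X.Pann m₀, u' ∈ X.Ndeg (q - 1) ∧ X.Dt 0 u' = w by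
    obtain ⟨u', hu', hu'q, hu'D⟩ := h
    exact ⟨u + u', Submodule.add_mem _ hu hu', Submodule.add_mem _ huq hu'q, by
      rw [map_add, huD, hu'D, sub_add_cancel]⟩
  obtain ⟨hD1, hD0⟩ := Dt_b_zero_of_closed hwE hwD
  have hK1 := b_zero_mem_K hm hw hwE
  have hK0 := b_c_zero_mem_K hm hw hwE
  have hq1 := b_mem_Ndeg 0 hwq
  have hq0 := b_mem_Ndeg 0 (c_mem_Ndeg 0 hwq)
  rw [add_sub_cancel_right] at hq0
  have hw2 := b_c_zero_add (X := X) w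
  rcases lt_or_gt_of_ne h0 with h | h
  · have e1 := hneg _ (by omega) _ hK1 hq1 hD1
    rw [e1, map_zero, neg_zero] at hD0
    rw [e1, hneg _ h _ hK0 hq0 hD0, map_zero, add_zero] at hw2
    exact ⟨0, Submodule.zero_mem _, Submodule.zero_mem _, by rw [map_zero, hw2]⟩
  -- With `ψ₁ = D χ₁` the vector `ψ₀ + M χ₁` is closed, say `D χ₀`; then `D (χ₀ - c_0 χ₁) = ψ₀ + c_0
  -- ψ₁`.
  · obtain ⟨χ₁, hχ₁, hχ₁q, hχ₁D⟩ := Y.exists_primitive hm hm' hA (by omega) hK1 hq1 hD1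
    have hχ₁P := (mem_K.mp hχ₁).1
    obtain ⟨χ₀, hχ₀, hχ₀q, hχ₀D⟩ := Y.exists_primitive hm hm' hA (by omega)
      (Submodule.add_mem _ hK0 (Q_mem_K hm hm' hχ₁))
      (Submodule.add_mem _ hq0 (by
        have := Q_mem_Ndeg hχ₁q
        rwa [show q - 1 - 1 + 2 = q by ring] at this))
      (by rw [map_add, hD0, Dt_Q hm hm' hA hχ₁P, hχ₁D, neg_add_cancel])
    refine ⟨χ₀ - X.G.c 0 χ₁, Submodule.sub_mem _ (mem_K.mp hχ₀).1 (c_mem_Pann 0 hχ₁P),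
      Submodule.sub_mem _ hχ₀q (by
        have := c_mem_Ndeg 0 hχ₁q
        rwa [sub_add_cancel] at this), ?_⟩
    rw [map_sub, hχ₀D, Dt_c_zero, hχ₁D]
    refine Eq.trans ?_ hw2
    abel

omit hA in
include hneg in
-- The component `b_0 w` is a closed relative vector of degree `-1`, hence zero, so `w` is itself
-- relative.
theorem exists_relative_cocycle {v : V} (hv : v ∈ X.Pann m₀) (hq : v ∈ X.Ndeg 0)
    (hD : X.Dt 0 v = 0) : ∃ w ∈ X.K 0 m₀, w ∈ X.Ndeg 0 ∧ X.Dt 0 w = 0 ∧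
      ∃ u ∈ X.Pann m₀, u ∈ X.Ndeg (-1) ∧ X.Dt 0 u = v - w := by
  obtain ⟨w, hw, hwq, hwD, hwE, u, hu, huq, huD⟩ := exists_cohomologous_on_shell hm hm' hv hq hD
  obtain ⟨hD1, hD0⟩ := Dt_b_zero_of_closed hwE hwD
  have e1 := hneg _ (by norm_num) _ (b_zero_mem_K hm hw hwE) (b_mem_Ndeg 0 hwq) hD1
  exact ⟨w, mem_K.mpr ⟨hw, hwE, e1⟩, hwq, hwD, u, hu, huq, huD⟩

omit hm' hA in
include hneg in
theorem exists_relative_primitive {u : V} (hu : u ∈ X.Pann m₀) (hq : u ∈ X.Ndeg (-1))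
    (hv : X.Dt 0 u ∈ X.K 0 m₀) : ∃ w ∈ X.K 0 m₀, w ∈ X.Ndeg (-1) ∧ X.Dt 0 w = X.Dt 0 u := by
  obtain ⟨-, h2, h3⟩ := mem_K.mp hv
  obtain ⟨w, hw, hwq, hwE, hwD⟩ := exists_primitive_on_shell hu hq h2
  have hD1 : X.Dt 0 (X.G.b 0 w) = 0 := by
    rw [Dt_b_apply, hwE, hwD, h3, sub_zero]
  have e1 := hneg _ (by norm_num) _ (b_zero_mem_K hm hw hwE) (b_mem_Ndeg 0 hwq) hD1
  exact ⟨w, mem_K.mpr ⟨hw, hwE, e1⟩, hwq, hwD⟩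

include Y in
-- `M v` is closed of degree two, where the relative complex is exact.
theorem exists_primary {v : V} (hv : v ∈ X.K 0 m₀) (hq : v ∈ X.Ndeg 0) (hD : X.Dt 0 v = 0) :
    ∃ u ∈ X.K 0 m₀, u ∈ X.Ndeg 1 ∧ X.Dt 0 u = X.G.Q 0 v :=
  Y.exists_primitive hm hm' hA (q := 2) (by norm_num) (Q_mem_K hm hm' hv)
    (by simpa using Q_mem_Ndeg hq) (by rw [Dt_Q hm hm' hA (mem_K.mp hv).1, hD, map_zero])

omit hm hm' hA in
theorem Dt_c_sub_primary {v χ : V} (hD : X.Dt 0 v = 0) (hχ : X.Dt 0 χ = X.G.Q 0 v) :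
    X.Dt 0 (X.G.c 0 v - χ) = 0 := by
  rw [map_sub, Dt_c_zero, hD, map_zero, sub_zero, hχ, sub_self]

omit hA in
/-- Every absolute cocycle of ghost number `1 / 2` is cohomologous to one built from a relative
cocycle and a primary. -/
theorem exists_relative_cocycle' {v : V} (hv : v ∈ X.Pann m₀) (hq : v ∈ X.Ndeg 1)
    (hD : X.Dt 0 v = 0) : ∃ w ∈ X.K 0 m₀, w ∈ X.Ndeg 0 ∧ X.Dt 0 w = 0 ∧
      ∃ χ ∈ X.K 0 m₀, χ ∈ X.Ndeg 1 ∧ X.Dt 0 χ = X.G.Q 0 w ∧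
      ∃ u ∈ X.Pann m₀, u ∈ X.Ndeg 0 ∧ X.Dt 0 u = v - (X.G.c 0 w - χ) := by
  obtain ⟨w, hw, hwq, hwD, hwE, u, hu, huq, huD⟩ := exists_cohomologous_on_shell hm hm' hv hq hD
  obtain ⟨hD1, hD0⟩ := Dt_b_zero_of_closed hwE hwD
  have hq0 := b_mem_Ndeg 0 (c_mem_Ndeg 0 hwq)
  rw [add_sub_cancel_right] at hq0
  have hq1 := b_mem_Ndeg 0 hwq
  rw [sub_self] at hq1
  refine ⟨X.G.b 0 w, b_zero_mem_K hm hw hwE, hq1, hD1, -X.G.b 0 (X.G.c 0 w),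
    Submodule.neg_mem _ (b_c_zero_mem_K hm hw hwE), Submodule.neg_mem _ hq0, ?_, u, hu, huq, ?_⟩
  · rw [map_neg, hD0, neg_neg]
  · rw [huD, sub_neg_eq_add, add_comm (X.G.c 0 _), b_c_zero_add]

include Y in
theorem exists_primitive_primary_sub {v χ χ' : V} (hχ : χ ∈ X.K 0 m₀) (hχq : χ ∈ X.Ndeg 1)
    (hχD : X.Dt 0 χ = X.G.Q 0 v) (hχ' : χ' ∈ X.K 0 m₀) (hχ'q : χ' ∈ X.Ndeg 1)
    (hχ'D : X.Dt 0 χ' = X.G.Q 0 v) :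
    ∃ u ∈ X.K 0 m₀, u ∈ X.Ndeg 0 ∧ X.Dt 0 u = χ - χ' :=
  Y.exists_primitive hm hm' hA (q := 1) le_rfl (Submodule.sub_mem _ hχ hχ')
    (Submodule.sub_mem _ hχq hχ'q) (by rw [map_sub, hχD, hχ'D, sub_self])

omit hm' hA in
-- Applying `b_0` to `D w = c_0 v - χ`, with `w` on the mass shell, gives `-D b_0 w = v`.
theorem exists_relative_primitive' {u v χ : V} (hu : u ∈ X.Pann m₀) (hq : u ∈ X.Ndeg 0)
    (hv : v ∈ X.K 0 m₀) (hχ : χ ∈ X.K 0 m₀) (h : X.Dt 0 u = X.G.c 0 v - χ) :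
    ∃ w ∈ X.K 0 m₀, w ∈ X.Ndeg (-1) ∧ X.Dt 0 w = v := by
  obtain ⟨-, h2, h3⟩ := mem_K.mp hv
  obtain ⟨-, h2', h3'⟩ := mem_K.mp hχ
  obtain ⟨w, hw, hwq, hwE, hwD⟩ := exists_primitive_on_shell hu hq (by
    rw [h, map_sub, Lt_zero_c_zero, h2, h2', map_zero, sub_zero])
  have hq1 := b_mem_Ndeg 0 hwq
  rw [zero_sub] at hq1
  refine ⟨-X.G.b 0 w, Submodule.neg_mem _ (b_zero_mem_K hm hw hwE), Submodule.neg_mem _ hq1, ?_⟩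
  have hb := b_c_zero_add (X := X) v
  rw [h3, map_zero, add_zero] at hb
  rw [map_neg, Dt_b_apply, hwE, zero_sub, neg_neg, hwD, h, map_sub, h3', sub_zero, hb]

include Y in
-- `M w` is one primary of `M D w`, and `c_0 D w - M w = -D (c_0 w)`. The given primary differs from
-- it by a coboundary, by exactness in degree one.
theorem exists_primitive_of_exact {w χ : V} (hw : w ∈ X.K 0 m₀) (hq : w ∈ X.Ndeg (-1))
    (hχ : χ ∈ X.K 0 m₀) (hχq : χ ∈ X.Ndeg 1) (hχD : X.Dt 0 χ = X.G.Q 0 (X.Dt 0 w)) :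
    ∃ u ∈ X.Pann m₀, u ∈ X.Ndeg 0 ∧ X.Dt 0 u = X.G.c 0 (X.Dt 0 w) - χ := by
  obtain ⟨u, hu, huq, huD⟩ := exists_primitive_primary_sub hm hm' hA Y hχ hχq hχD
    (Q_mem_K hm hm' hw) (by simpa using Q_mem_Ndeg hq) (Dt_Q hm hm' hA (mem_K.mp hw).1)
  refine ⟨-u - X.G.c 0 w, Submodule.sub_mem _ (Submodule.neg_mem _ (mem_K.mp hu).1)
    (c_mem_Pann 0 (mem_K.mp hw).1), Submodule.sub_mem _ (Submodule.neg_mem _ huq)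
    (by simpa using c_mem_Ndeg 0 hq), ?_⟩
  rw [map_sub, map_neg, huD, Dt_c_zero]
  abel

end Cohomology

end StringSystem

namespace StringSystem

variable {V W P : Type*} [AddCommGroup V] [Module ℂ V] [AddCommGroup W] [Module ℂ W]
  [Fintype P] [DecidableEq P] (X : StringSystem V W P)

/-! ### Physical states -/

/-- The physical states with intercept `a - t`. -/
def phys (t : ℂ) : Submodule ℂ W := ⨅ m : ℕ, LinearMap.ker (X.Lt t m ∘ₗ X.vac)

/-- The states `L_{-1} F`, where `F` is physical with intercept `a - 1`. -/
def gauge : Submodule ℂ W := (X.phys 1).map (X.LW (-1))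

variable {X}

theorem mem_phys {t : ℂ} {v : W} : v ∈ X.phys t ↔ ∀ m : ℤ, 0 ≤ m → X.Lt t m (X.vac v) = 0 := by
  simp only [phys, Submodule.mem_iInf, LinearMap.mem_ker, LinearMap.comp_apply]
  refine ⟨fun h m hm => ?_, fun h m => h m (by omega)⟩
  obtain ⟨k, rfl⟩ := Int.eq_ofNat_of_zero_le hm
  exact h k

theorem Lt_eq_Lmat_vac (t : ℂ) {m : ℤ} (hm : 0 ≤ m) (v : W) :
    X.Lt t m (X.vac v) = X.Lmat m (X.vac v) + (if m = 0 then t else 0) • X.vac v := by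
  simp only [Lt, LinearMap.add_apply, (X.vac_vacuum v).L hm, add_zero, LinearMap.smul_apply,
    Module.End.one_apply]

theorem Lt_vac (t : ℂ) {m : ℤ} (hm : 0 ≤ m) (v : W) :
    X.Lt t m (X.vac v) = X.vac (X.LW m v - (if m = 0 then X.a - t else 0) • v) := by
  rw [Lt_eq_Lmat_vac t hm, Lmat, LinearMap.sub_apply, X.L_vac, LinearMap.smul_apply,
    Module.End.one_apply, map_sub, map_smul]
  split_ifs
  · module
  · module

theorem c_vac {n : ℤ} (hn : 0 < n) (v : W) : X.G.c n (X.vac v) = 0 := (X.vac_vacuum v).c n hn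

theorem b_vac {n : ℤ} (hn : 0 ≤ n) (v : W) : X.G.b n (X.vac v) = 0 := (X.vac_vacuum v).b n hn

theorem D_vac {t : ℂ} {v : W} (hv : v ∈ X.phys t) : X.D (X.vac v) = -(t • X.G.c 0 (X.vac v)) := by
  rw [mem_phys] at hv
  have h := X.sumD.apply_eq_single (X.vac v) 0 fun m hm => by
    rw [Module.End.mul_apply]
    rcases lt_or_gt_of_ne hm with h | h
    · rw [c_vac (by omega), map_zero]
    · have e := congrArg (fun Z : Module.End ℂ V => Z (X.vac v)) (X.commute_Lmat_c m (-m)).eq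
      have h2 := hv m h.le
      rw [Lt_eq_Lmat_vac t h.le, if_neg hm, zero_smul, add_zero] at h2
      change X.Lmat m (X.G.c (-m) (X.vac v)) = X.G.c (-m) (X.Lmat m (X.vac v)) at e
      rw [h2, map_zero] at e
      exact e
  have e := congrArg (fun Z : Module.End ℂ V => Z (X.vac v)) (X.commute_Lmat_c 0 0).eq
  change X.Lmat 0 (X.G.c 0 (X.vac v)) = X.G.c 0 (X.Lmat 0 (X.vac v)) at e
  have h2 := hv 0 le_rfl
  rw [Lt_eq_Lmat_vac t le_rfl, if_pos rfl] at h2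
  rw [LinearMap.sub_apply, (X.vac_vacuum v).D, sub_zero] at h
  refine h.trans (Eq.trans (b := X.Lmat 0 (X.G.c 0 (X.vac v))) ?_ ?_)
  · rw [neg_zero]
    rfl
  · rw [e, eq_neg_of_add_eq_zero_left h2, map_neg, map_smul]

/-- On the ghost vacuum the anticommutator `{D, b_m} = L_m^tot`, `m ≥ 0`, reduces to `b_m D`, so
closedness yields every constraint. -/
theorem Dt_vac_eq_zero_iff {t : ℂ} {v : W} : X.Dt t (X.vac v) = 0 ↔ v ∈ X.phys t := by
  constructor
  · intro h
    refine mem_phys.mpr fun m hm => ?_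
    have := Dt_b_apply (X := X) t m (X.vac v)
    rw [b_vac hm, h, map_zero, map_zero, sub_zero] at this
    exact this.symm
  · intro h
    change X.D (X.vac v) + t • X.G.c 0 (X.vac v) = 0
    rw [D_vac h, neg_add_cancel]

/-- Each non-zero term of `M` contains an annihilation mode. Hence zero is a primary of `M (v ⊗ ω)`,
and `c_0 (v ⊗ ω)` needs no correction. -/
theorem Q_zero_vac (v : W) : X.G.Q 0 (X.vac v) = 0 :=
  (X.G.sumQ 0).apply_eq_zero _ fun k => by
    rw [LinearMap.smul_apply, Module.End.mul_apply, add_zero]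
    rcases lt_trichotomy k 0 with h | rfl | h
    · rw [X.G.c_c_apply, c_vac (by omega), map_zero, neg_zero, smul_zero]
    · rw [neg_zero, X.G.c_c_self, smul_zero]
    · rw [c_vac h, map_zero, smul_zero]

theorem vac_mem_Pann {m₀ : ℤ} (hm : 1 ≤ m₀) (v : W) : X.vac v ∈ X.Pann m₀ :=
  fun _ hn => c_vac (by omega) v

theorem vac_mem_K {t : ℂ} {m₀ : ℤ} (hm : 1 ≤ m₀) {v : W} (hv : v ∈ X.phys t) :
    X.vac v ∈ X.K t m₀ :=
  mem_K.mpr ⟨vac_mem_Pann hm v, mem_phys.mp hv 0 le_rfl, b_vac le_rfl v⟩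

theorem exists_phys_of_mem_K_one {u : V} (hu : u ∈ X.K 0 1) (hq : u ∈ X.Ndeg 0)
    (hD : X.Dt 0 u = 0) : ∃ v ∈ X.phys 0, X.vac v = u := by
  obtain ⟨v, rfl⟩ := mem_range_vac (mem_K.mp hu).1 hq
  exact ⟨v, Dt_vac_eq_zero_iff.mp hD, rfl⟩

/-! ### The degenerate anomaly -/

theorem Lt_zero_eq (t : ℂ) (v : V) : X.Lt t 0 v = X.Lt 0 0 v + t • v := by
  simp [Lt]

theorem Q_one_apply {u : V} (hu : u ∈ X.Pann 2) : X.G.Q 1 u = -X.G.c 0 (X.G.c 1 u) := by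
  -- Only `k = 0` and `k = -1` survive on `Pann 2`, and by anticommutation both equal `-½ c_0 c_1`.
  have h := ((X.G.sumQ 1).remove 0).apply_eq_single u (-1) fun k hk => by
    split_ifs with h0
    · rfl
    · rw [LinearMap.smul_apply, Module.End.mul_apply]
      by_cases h1 : 0 < k
      · rw [hu (k + 1) (by omega), map_zero, smul_zero]
      · rw [X.G.c_c_apply, hu (-k) (by omega), map_zero, neg_zero, smul_zero]
  rw [if_neg (by norm_num), LinearMap.sub_apply, sub_eq_iff_eq_add] at h
  rw [h]
  simp only [LinearMap.smul_apply, Module.End.mul_apply, neg_zero, neg_neg, zero_add,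
    neg_add_cancel, X.G.c_c_apply 1 0]
  push_cast
  module

/-- The term `c_0 c_1` in `{D, c_1}` acts as a change of intercept: up to sign, `c_1` intertwines
the differentials of intercepts `a` and `a - 1`. -/
theorem c_one_Dt {u : V} (hu : u ∈ X.Pann 2) :
    X.G.c 1 (X.Dt 0 u) = -X.Dt 1 (X.G.c 1 u) := by
  have h := Dt_c_apply (X := X) 0 1 u
  rw [Q_one_apply hu] at h
  have h2 : X.Dt 1 (X.G.c 1 u) = X.Dt 0 (X.G.c 1 u) + X.G.c 0 (X.G.c 1 u) := by
    simp [Dt]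
  rw [h2, h]
  abel

theorem c_one_mem_K {u : V} (hu : u ∈ X.K 0 2) : X.G.c 1 u ∈ X.K 1 1 := by
  obtain ⟨h1, h2, h3⟩ := mem_K.mp hu
  refine mem_K.mpr ⟨c_one_mem_Pann h1, ?_, ?_⟩
  · have h := Lt_c_apply (X := X) 0 0 1 u
    rw [h2, map_zero, zero_add, zero_add] at h
    rw [Lt_zero_eq, h]
    push_cast
    module
  · have h := X.G.c_b_of_ne (show (1 : ℤ) + 0 ≠ 0 by norm_num) u
    rw [h3, map_zero] at h
    exact neg_eq_zero.mp h.symm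

theorem b_neg_one_mem_K {u : V} (hu : u ∈ X.K 1 1) : X.G.b (-1) u ∈ X.K 0 2 := by
  obtain ⟨h1, h2, h3⟩ := mem_K.mp hu
  refine mem_K.mpr ⟨b_mem_Pann (by norm_num) (X.Pann_mono (by norm_num) h1), ?_, ?_⟩
  · have h := Lt_b_apply (X := X) 0 0 (-1) u
    rw [zero_add] at h
    rw [Lt_zero_eq, ← eq_neg_iff_add_eq_zero] at h2
    rw [h, h2, map_neg, map_smul]
    push_cast
    module
  · rw [X.G.b_b_apply, h3, map_zero, neg_zero]

theorem c_one_b_neg_one {u : V} (hu : u ∈ X.Pann 1) : X.G.c 1 (X.G.b (-1) u) = u := by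
  have h := X.G.c_b_add_b_c (show (1 : ℤ) + -1 = 0 by norm_num) u
  rwa [hu 1 le_rfl, map_zero, add_zero] at h

/-- The ghost part `c_0 b_{-1}` of `L_{-1}^tot` cancels the `c_0` which `D` produces because `F` has
intercept `a - 1` instead of `a`. -/
theorem Dt_b_neg_one_vac {F : W} (hF : F ∈ X.phys 1) :
    X.Dt 0 (X.G.b (-1) (X.vac F)) = X.vac (X.LW (-1) F) := by
  have h1 : X.Dt 0 (X.vac F) = -X.G.c 0 (X.vac F) := by
    simp [Dt, D_vac hF]
  have h2 : X.Lt 0 (-1) (X.vac F) = X.vac (X.LW (-1) F) + X.G.c 0 (X.G.b (-1) (X.vac F)) := by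
    simp [Lt, Lmat, X.L_vac, (X.vac_vacuum F).L_neg_one]
  rw [Dt_b_apply, h1, h2, X.G.c_b_of_ne (by norm_num), map_neg]
  abel

theorem exists_vac_of_mem_K_two {u : V} (hu : u ∈ X.K 0 2) (hq : u ∈ X.Ndeg (-1)) :
    ∃ F, u = X.G.b (-1) (X.vac F) ∧ X.G.c 1 u = X.vac F := by
  have h1 := (mem_K.mp hu).1
  have hq' := c_mem_Ndeg 1 hq
  rw [neg_add_cancel] at hq'
  obtain ⟨F, hF⟩ := mem_range_vac (c_one_mem_Pann h1) hq'
  have h2 := eq_zero_of_mem_Pann_one (c_one_b_mem_Pann h1) (c_mem_Ndeg 1 (b_mem_Ndeg (-1) hq))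
    (by norm_num)
  have h := X.G.c_b_add_b_c (show (1 : ℤ) + -1 = 0 by norm_num) u
  rw [h2, zero_add, ← hF] at h
  exact ⟨F, h.symm, hF.symm⟩

theorem exists_phys_of_mem_K_two {u : V} (hu : u ∈ X.K 0 2) (hq : u ∈ X.Ndeg (-1)) {v : W}
    (hD : X.Dt 0 u = X.vac v) : ∃ F ∈ X.phys 1, u = X.G.b (-1) (X.vac F) ∧ X.LW (-1) F = v := by
  obtain ⟨F, h1, h2⟩ := exists_vac_of_mem_K_two hu hq
  have h3 := c_one_Dt (mem_K.mp hu).1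
  rw [hD, c_vac one_pos, h2] at h3
  have hF := Dt_vac_eq_zero_iff.mp (neg_eq_zero.mp h3.symm)
  refine ⟨F, hF, h1, X.vac_injective ?_⟩
  rw [← Dt_b_neg_one_vac hF, ← h1, hD]

theorem exists_primitive_vac_iff {v : W} :
    (∃ u ∈ X.K 0 2, u ∈ X.Ndeg (-1) ∧ X.Dt 0 u = X.vac v) ↔ v ∈ X.gauge := by
  constructor
  · rintro ⟨u, hu, hq, hD⟩
    obtain ⟨F, hF, -, rfl⟩ := exists_phys_of_mem_K_two hu hq hD
    exact ⟨F, hF, rfl⟩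
  · rintro ⟨F, hF, rfl⟩
    exact ⟨_, b_neg_one_mem_K (vac_mem_K le_rfl hF),
      by simpa using b_mem_Ndeg (-1) (vac_mem_Ndeg F), Dt_b_neg_one_vac hF⟩

theorem gauge_le_phys (hA : X.A 0 1 = 0) : X.gauge ≤ X.phys 0 := by
  intro v hv
  obtain ⟨u, hu, -, hD⟩ := exists_primitive_vac_iff.mpr hv
  rw [← Dt_vac_eq_zero_iff, ← hD]
  refine Dt_Dt one_le_two le_rfl (fun m h1 h2 => ?_) (mem_K.mp hu).1
  obtain rfl : m = 1 := by omega
  exact hA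

/-- `c_1 u` is closed of degree one in the complex of intercept `a - 1` and level `m₀ = 1`, hence
equals `D_1 w`. Adding `D b_{-1} w` cancels it, and a degree-zero vector that is also killed by
`c_1` is a matter state. -/
theorem exists_phys_cohomologous (Y : X.LightCone) (hA : X.A 0 1 = 0) {u : V} (hu : u ∈ X.K 0 2)
    (hq : u ∈ X.Ndeg 0) (hD : X.Dt 0 u = 0) :
    ∃ v ∈ X.phys 0, ∃ χ ∈ X.K 0 2, χ ∈ X.Ndeg (-1) ∧ X.Dt 0 χ = u - X.vac v := by
  have hA' : ∀ m, 1 ≤ m → m < 2 → X.A 0 m = 0 := fun m h1 h2 => by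
    obtain rfl : m = 1 := by omega
    exact hA
  have hu1 := (mem_K.mp hu).1
  have hq1 := c_mem_Ndeg 1 hq
  rw [zero_add] at hq1
  have hD1 := c_one_Dt hu1
  rw [hD, map_zero, eq_comm, neg_eq_zero] at hD1
  obtain ⟨w, hw, hwq, hwD⟩ := Y.exists_primitive le_rfl one_le_two
    -- At level one the condition on the anomaly coefficients is empty, so exactness is available
    -- for the shifted intercept.
    (fun m h1 h2 => absurd h1 (by omega)) le_rfl (c_one_mem_K hu) hq1 hD1
  rw [sub_self] at hwq
  have hχ := b_neg_one_mem_K hw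
  have hχq := b_mem_Ndeg (-1) hwq
  rw [zero_sub] at hχq
  set χ := X.G.b (-1) w
  have hDχ := Dt_mem_K one_le_two le_rfl hχ
  have hDχq := Dt_mem_Ndeg 0 hχq
  rw [neg_add_cancel] at hDχq
  have hc : X.G.c 1 (u + X.Dt 0 χ) = 0 := by
    rw [map_add, c_one_Dt (mem_K.mp hχ).1, c_one_b_neg_one (mem_K.mp hw).1, hwD, add_neg_cancel]
  have hP : u + X.Dt 0 χ ∈ X.Pann 1 := fun n hn => by
    rcases hn.eq_or_lt with rfl | h
    · exact hc
    · exact Submodule.add_mem _ hu1 (mem_K.mp hDχ).1 n (by omega)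
  obtain ⟨v, hv⟩ := mem_range_vac hP (Submodule.add_mem _ hq hDχq)
  refine ⟨v, ?_, -χ, Submodule.neg_mem _ hχ, Submodule.neg_mem _ hχq, ?_⟩
  · rw [← Dt_vac_eq_zero_iff, hv, map_add, hD, Dt_Dt one_le_two le_rfl hA' (mem_K.mp hχ).1,
      add_zero]
  · rw [hv, map_neg]
    abel

/-! ### Injectivity of `L_{-1}` -/

/-- The annihilation mode `y_1` is locally nilpotent: it kills the vacuum and commutes with the
creation modes up to scalars. -/
theorem mem_maxGenEigenspace_y (s : P) (v : W) :
    X.vac v ∈ (X.B.y s 1).maxGenEigenspace 0 := by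
  refine X.matter_induction ((X.B.y s 1).maxGenEigenspace 0) ?_ (fun r m hm u hu => ?_) v
  · rw [Module.End.mem_maxGenEigenspace]
    exact ⟨1, by rw [zero_smul, sub_zero, pow_one]; exact X.Ω_vacuum s 1 one_pos⟩
  · rw [Module.End.mem_maxGenEigenspace] at hu ⊢
    rw [zero_smul, sub_zero] at hu ⊢
    obtain ⟨k, hk⟩ := hu
    refine ⟨k + 1, ?_⟩
    have hc : ∀ u, X.B.y s 1 (X.B.y r m u) = X.B.y r m (X.B.y s 1 u)
        + (if s = r ∧ 1 + m = 0 then (((1 : ℤ) : ℂ) * X.B.g s) else 0) • u := fun u =>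
      sub_eq_iff_eq_add'.mp
        (congrArg (fun Z : Module.End ℂ V => Z u) (X.B.comm_eq_smul s r 1 m))
    induction k generalizing u with
    | zero =>
      have hu : u = 0 := hk
      rw [hu, map_zero, map_zero]
    | succ k ih =>
      rw [pow_succ, Module.End.mul_apply, hc, map_add, map_smul, hk, smul_zero, add_zero]
      exact ih (X.B.y s 1 u) hk

/-- Without background charge `[L_{-1}, y_1] = -y_0 = -z`. If `L_{-1} F = 0` then `L_{-1} y_1^{k+1}
F = -(k + 1) z y_1^k F`, so the vanishing of a power of `y_1` on `F` descends to `F = 0`. -/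
theorem LW_neg_one_injective {s : P} (hs : X.B.γ s = 0) (hz : X.B.z s ≠ 0) {F : W}
    (hF : X.LW (-1) F = 0) : F = 0 := by
  have hL : X.B.L (-1) (X.vac F) = 0 := by rw [X.L_vac, hF, map_zero]
  obtain ⟨k, hk⟩ := Module.End.mem_maxGenEigenspace _ _ _ |>.mp (mem_maxGenEigenspace_y (X := X) s F)
  rw [zero_smul, sub_zero] at hk
  have hc : ∀ u, X.B.L (-1) (X.B.y s 1 u) = X.B.y s 1 (X.B.L (-1) u) + (-X.B.z s) • u := fun u => by
    have h := congrArg (fun Z : Module.End ℂ V => Z u) (X.B.L_comm_y (-1) s 1)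
    simp only [hs, zero_mul, ite_self, zero_smul, add_zero, neg_add_cancel, X.B.y_zero] at h
    refine (sub_eq_iff_eq_add'.mp h).trans ?_
    simp
  have hpow : ∀ k : ℕ, X.B.L (-1) ((X.B.y s 1 ^ (k + 1)) (X.vac F))
      = (-((k + 1) * X.B.z s)) • (X.B.y s 1 ^ k) (X.vac F) := by
    intro k
    induction k with
    | zero =>
      rw [zero_add, pow_one, hc, hL, map_zero, zero_add, pow_zero, Module.End.one_apply]
      simp
    | succ k ih =>
      rw [pow_succ', Module.End.mul_apply, hc, ih, map_smul, ← Module.End.mul_apply, ← pow_succ']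
      push_cast
      module
  refine X.vac_injective ?_
  rw [map_zero]
  induction k with
  | zero => exact hk
  | succ k ih =>
    have h := hpow k
    rw [hk, map_zero, eq_comm, smul_eq_zero, neg_eq_zero, mul_eq_zero] at h
    exact ih (h.resolve_left fun h => h.elim (by exact_mod_cast k.succ_ne_zero) hz)

/-- Below degree `-1` there is nothing; in degree `-1` a closed vector is `b_{-1} F` with `L_{-1} F
= 0`. -/
theorem eq_zero_of_neg_of_closed {s : P} (hs : X.B.γ s = 0) (hz : X.B.z s ≠ 0) {q : ℤ} (hq : q < 0)
    {v : V} (hv : v ∈ X.K 0 2) (hvq : v ∈ X.Ndeg q) (hD : X.Dt 0 v = 0) : v = 0 := by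
  by_cases h : q < -1
  · exact eq_zero_of_lt_neg_one le_rfl (mem_K.mp hv).1 hvq h
  · obtain rfl : q = -1 := by omega
    obtain ⟨F, -, rfl, hF⟩ := exists_phys_of_mem_K_two (v := 0) hv hvq (by rw [hD, map_zero])
    rw [LW_neg_one_injective hs hz hF, map_zero, map_zero]

end StringSystem

theorem Subquot.exists_linearEquiv {V₁ V₂ : Type*} [AddCommGroup V₁] [Module ℂ V₁]
    [AddCommGroup V₂] [Module ℂ V₂] {Z₁ B₁ : Submodule ℂ V₁} {Z₂ B₂ : Submodule ℂ V₂}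
    (f : Z₁ →ₗ[ℂ] V₂) (hf : ∀ z, f z ∈ Z₂) (hB : ∀ z, f z ∈ B₂ ↔ (z : V₁) ∈ B₁)
    (hs : ∀ w ∈ Z₂, ∃ z, w - f z ∈ B₂) :
    ∃ e : Subquot Z₁ B₁ ≃ₗ[ℂ] Subquot Z₂ B₂,
      ∀ z, ∃ h : f z ∈ Z₂, e (Subquot.mk Z₁ B₁ z) = Subquot.mk Z₂ B₂ ⟨f z, h⟩ := by
  let g : Z₁ →ₗ[ℂ] Z₂ := f.codRestrict Z₂ hf
  have hg : B₁.submoduleOf Z₁ = (B₂.submoduleOf Z₂).comap g := Submodule.ext fun z => (hB z).symm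
  let F : (↥Z₁ ⧸ B₁.submoduleOf Z₁) →ₗ[ℂ] (↥Z₂ ⧸ B₂.submoduleOf Z₂) :=
    Submodule.mapQ _ _ g hg.le
  have hF : Function.Bijective F := by
    constructor
    · rw [← LinearMap.ker_eq_bot, Submodule.ker_mapQ, ← hg, Submodule.mkQ_map_self]
    · intro w
      obtain ⟨w, rfl⟩ := Submodule.mkQ_surjective _ w
      obtain ⟨z, hz⟩ := hs w w.2
      exact ⟨Submodule.mkQ _ z,
        ((Submodule.Quotient.eq (B₂.submoduleOf Z₂) (x := w) (y := g z)).mpr hz).symm⟩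
  exact ⟨LinearEquiv.ofBijective F hF, fun z => ⟨hf z, rfl⟩⟩

theorem Subquot.mk_eq_mk {V : Type*} [AddCommGroup V] [Module ℂ V] {Z B : Submodule ℂ V}
    {z w : Z} (h : (z : V) - w ∈ B) : Subquot.mk Z B z = Subquot.mk Z B w :=
  (Submodule.Quotient.eq _).mpr h

theorem Subquot.exists_linearEquiv_bot {V : Type*} [AddCommGroup V] [Module ℂ V]
    (Z : Submodule ℂ V) : ∃ e : Z ≃ₗ[ℂ] Subquot Z ⊥, ∀ z, e z = Subquot.mk Z ⊥ z :=
  ⟨((⊥ : Submodule ℂ V).submoduleOf Z).quotEquivOfEqBot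
    (Submodule.ext fun z => by simp [Submodule.submoduleOf]) |>.symm, fun _ => rfl⟩

namespace StringSystem

variable {V W P : Type*} [AddCommGroup V] [Module ℂ V] [AddCommGroup W] [Module ℂ W]
  [Fintype P] [DecidableEq P] (X : StringSystem V W P)

/-! ### Absolute and relative cohomology -/

/-- Absolute cocycles of ghost number `q - 1 / 2`. -/
def absZ (m₀ q : ℤ) : Submodule ℂ V := X.Pann m₀ ⊓ X.Ndeg q ⊓ LinearMap.ker (X.Dt 0)

/-- Absolute coboundaries of ghost number `q - 1 / 2`. -/
def absB (m₀ q : ℤ) : Submodule ℂ V := (X.Pann m₀ ⊓ X.Ndeg (q - 1)).map (X.Dt 0)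

/-- Relative cocycles of relative ghost number `q`. -/
def relZ (m₀ q : ℤ) : Submodule ℂ V := X.K 0 m₀ ⊓ X.Ndeg q ⊓ LinearMap.ker (X.Dt 0)

/-- Relative coboundaries of relative ghost number `q`. -/
def relB (m₀ q : ℤ) : Submodule ℂ V := (X.K 0 m₀ ⊓ X.Ndeg (q - 1)).map (X.Dt 0)

variable {X} {m₀ q : ℤ} {v : V}

theorem mem_absZ : v ∈ X.absZ m₀ q ↔ v ∈ X.Pann m₀ ∧ v ∈ X.Ndeg q ∧ X.Dt 0 v = 0 := and_assoc

theorem mem_relZ : v ∈ X.relZ m₀ q ↔ v ∈ X.K 0 m₀ ∧ v ∈ X.Ndeg q ∧ X.Dt 0 v = 0 := and_assoc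

theorem mem_absB :
    v ∈ X.absB m₀ q ↔ ∃ u ∈ X.Pann m₀, u ∈ X.Ndeg (q - 1) ∧ X.Dt 0 u = v := by
  simp only [absB, Submodule.mem_map, Submodule.mem_inf, and_assoc]

theorem mem_relB :
    v ∈ X.relB m₀ q ↔ ∃ u ∈ X.K 0 m₀, u ∈ X.Ndeg (q - 1) ∧ X.Dt 0 u = v := by
  simp only [relB, Submodule.mem_map, Submodule.mem_inf, and_assoc]

theorem K_le_Pann (t : ℂ) (m₀ : ℤ) : X.K t m₀ ≤ X.Pann m₀ := fun _ h => (mem_K.mp h).1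

theorem relZ_le_absZ : X.relZ m₀ q ≤ X.absZ m₀ q := fun _ h =>
  mem_absZ.mpr ((mem_relZ.mp h).imp_left fun h => K_le_Pann _ _ h)

theorem relB_le_absB : X.relB m₀ q ≤ X.absB m₀ q :=
  Submodule.map_mono (inf_le_inf_right _ (K_le_Pann _ _))

section

variable (hm : 1 ≤ m₀) (hm' : m₀ ≤ 2) (hA : ∀ m, 1 ≤ m → m < m₀ → X.A 0 m = 0)
include hm hm' hA

theorem absB_le_absZ : X.absB m₀ q ≤ X.absZ m₀ q := fun v hv => by
  obtain ⟨u, h1, h2, rfl⟩ := mem_absB.mp hv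
  have := Dt_mem_Ndeg 0 h2
  rw [sub_add_cancel] at this
  exact mem_absZ.mpr ⟨Dt_mem_Pann hm hm' 0 h1, this, Dt_Dt hm hm' hA h1⟩

theorem relB_le_relZ : X.relB m₀ q ≤ X.relZ m₀ q := fun v hv => by
  obtain ⟨u, h1, h2, rfl⟩ := mem_relB.mp hv
  have := Dt_mem_Ndeg 0 h2
  rw [sub_add_cancel] at this
  exact mem_relZ.mpr ⟨Dt_mem_K hm hm' h1, this, Dt_Dt hm hm' hA (K_le_Pann _ _ h1)⟩

variable (Y : X.LightCone)
  (hneg : ∀ q, q < 0 → ∀ v ∈ X.K 0 m₀, v ∈ X.Ndeg q → X.Dt 0 v = 0 → v = 0)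

include Y hneg in
theorem absZ_le_absB (h0 : q ≠ 0) (h1 : q ≠ 1) : X.absZ m₀ q ≤ X.absB m₀ q := fun v hv => by
  obtain ⟨h2, h3, h4⟩ := mem_absZ.mp hv
  exact mem_absB.mpr (exists_primitive_of_ne hm hm' hA Y hneg h0 h1 h2 h3 h4)

omit hm' hA in
include hneg in
theorem mem_relB_of_mem_absB (hv : v ∈ X.K 0 m₀) (h : v ∈ X.absB m₀ 0) : v ∈ X.relB m₀ 0 := by
  obtain ⟨u, h1, h2, rfl⟩ := mem_absB.mp h
  rw [zero_sub] at h2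
  obtain ⟨w, h3, h4, h5⟩ := exists_relative_primitive hm hneg h1 h2 hv
  exact mem_relB.mpr ⟨w, h3, by rwa [zero_sub], h5⟩

omit hA in
include hneg in
theorem exists_sub_mem_absB (hv : v ∈ X.absZ m₀ 0) : ∃ w ∈ X.relZ m₀ 0, v - w ∈ X.absB m₀ 0 := by
  obtain ⟨h1, h2, h3⟩ := mem_absZ.mp hv
  obtain ⟨w, hw, hwq, hwD, u, hu, huq, huD⟩ := exists_relative_cocycle hm hm' hneg h1 h2 h3
  exact ⟨w, mem_relZ.mpr ⟨hw, hwq, hwD⟩, mem_absB.mpr ⟨u, hu, by rwa [zero_sub], huD⟩⟩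

omit hA in
include hneg in
/-- The inclusion of the relative complex is an isomorphism on cohomology in degree `-1 / 2`. -/
theorem exists_linearEquiv_rel : ∃ e : Subquot (X.relZ m₀ 0) (X.relB m₀ 0) ≃ₗ[ℂ]
    Subquot (X.absZ m₀ 0) (X.absB m₀ 0), ∀ z : X.relZ m₀ 0, ∃ h : (z : V) ∈ X.absZ m₀ 0,
      e (Subquot.mk _ _ z) = Subquot.mk (X.absZ m₀ 0) (X.absB m₀ 0) ⟨z, h⟩ :=
  Subquot.exists_linearEquiv (X.relZ m₀ 0).subtype (fun z => relZ_le_absZ z.2)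
    (fun z => ⟨mem_relB_of_mem_absB hm hneg (mem_relZ.mp z.2).1, fun h => relB_le_absB h⟩)
    fun v hv => by
      obtain ⟨w, hw, h⟩ := exists_sub_mem_absB hm hm' hneg hv
      exact ⟨⟨w, hw⟩, h⟩

include Y in
-- Primaries exist one by one; a linear choice lifts through the surjection of `D` onto its range,
-- vector spaces being projective.
theorem exists_linear_primary_of_closed : ∃ Q : X.relZ m₀ 0 →ₗ[ℂ] V,
    ∀ z, Q z ∈ X.K 0 m₀ ∧ Q z ∈ X.Ndeg 1 ∧ X.Dt 0 (Q z) = X.G.Q 0 z := by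
  let T := X.K 0 m₀ ⊓ X.Ndeg 1
  let δ : T →ₗ[ℂ] V := X.Dt 0 ∘ₗ T.subtype
  have hr : ∀ z : X.relZ m₀ 0, (X.G.Q 0 ∘ₗ (X.relZ m₀ 0).subtype) z ∈ LinearMap.range δ := by
    intro z
    obtain ⟨h1, h2, h3⟩ := mem_relZ.mp z.2
    obtain ⟨u, hu, huq, huD⟩ := exists_primary hm hm' hA Y h1 h2 h3
    exact ⟨⟨u, hu, huq⟩, huD⟩
  obtain ⟨g, hg⟩ := Module.projective_lifting_property δ.rangeRestrict
    (LinearMap.codRestrict _ _ hr) (LinearMap.surjective_rangeRestrict δ)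
  refine ⟨T.subtype ∘ₗ g, fun z => ⟨(g z).2.1, (g z).2.2, ?_⟩⟩
  exact congrArg Subtype.val (LinearMap.congr_fun hg z)

include Y hneg in
/-- A linear choice of primaries, compatible with the coboundaries. -/
theorem exists_linear_primary : ∃ Q : X.relZ m₀ 0 →ₗ[ℂ] V,
    (∀ z, Q z ∈ X.K 0 m₀ ∧ Q z ∈ X.Ndeg 1 ∧ X.Dt 0 (Q z) = X.G.Q 0 z) ∧
    ∀ χ ∈ X.K 0 m₀, χ ∈ X.Ndeg (-1) → ∀ h : X.Dt 0 χ ∈ X.relZ m₀ 0,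
      Q ⟨X.Dt 0 χ, h⟩ = X.G.Q 0 χ := by
  obtain ⟨Q, hQ⟩ := exists_linear_primary_of_closed hm hm' hA Y
  let T := X.K 0 m₀ ⊓ X.Ndeg (-1)
  have hδ : ∀ u : T, (X.Dt 0 ∘ₗ T.subtype) u ∈ X.relZ m₀ 0 := fun u =>
    relB_le_relZ hm hm' hA (mem_relB.mpr ⟨u, u.2.1, by rw [zero_sub]; exact u.2.2, rfl⟩)
  let δ : T →ₗ[ℂ] X.relZ m₀ 0 := LinearMap.codRestrict _ _ hδ
  have hk : LinearMap.ker δ = ⊥ := (Submodule.eq_bot_iff _).mpr fun u hu =>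
    Subtype.ext (hneg (-1) (by norm_num) u u.2.1 u.2.2 (congrArg Subtype.val hu))
  obtain ⟨ρ, hρ⟩ := δ.exists_leftInverse_of_injective hk
  -- `D` is injective in degree `-1`, with left inverse `ρ`. On the complement `z - D ρ z` the old
  -- choice is kept, and on the coboundary `D ρ z` it is replaced by the canonical primary `M ρ z`.
  refine ⟨Q ∘ₗ (LinearMap.id - δ ∘ₗ ρ) + X.G.Q 0 ∘ₗ T.subtype ∘ₗ ρ, fun z => ?_,
    fun χ hχ hχq h => ?_⟩
  · obtain ⟨h1, h2, h3⟩ := hQ (z - δ (ρ z))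
    have hK := (ρ z).2.1
    have hq := Q_mem_Ndeg (ρ z).2.2
    refine ⟨Submodule.add_mem _ h1 (Q_mem_K hm hm' hK), Submodule.add_mem _ h2 hq, ?_⟩
    change X.Dt 0 (Q (z - δ (ρ z)) + X.G.Q 0 (ρ z : V)) = _
    rw [map_add, h3, Dt_Q hm hm' hA (K_le_Pann _ _ hK)]
    change X.G.Q 0 ((z : V) - X.Dt 0 (ρ z : V)) + _ = _
    rw [map_sub, sub_add_cancel]
  · have e : ρ ⟨X.Dt 0 χ, h⟩ = ⟨χ, hχ, hχq⟩ := LinearMap.congr_fun hρ ⟨χ, hχ, hχq⟩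
    have e2 : (⟨X.Dt 0 χ, h⟩ : X.relZ m₀ 0) - δ (ρ ⟨X.Dt 0 χ, h⟩) = 0 := by
      rw [e]
      exact sub_self _
    change Q ((⟨X.Dt 0 χ, h⟩ : X.relZ m₀ 0) - δ (ρ ⟨X.Dt 0 χ, h⟩))
      + X.G.Q 0 (ρ ⟨X.Dt 0 χ, h⟩ : V) = _
    rw [e2, map_zero, zero_add, e]

omit hm hm' hA in
theorem c_sub_primary_mem_absZ {χ : V} (hv : v ∈ X.relZ m₀ 0) (hχ : χ ∈ X.K 0 m₀)
    (hχq : χ ∈ X.Ndeg 1) (hχD : X.Dt 0 χ = X.G.Q 0 v) : X.G.c 0 v - χ ∈ X.absZ m₀ 1 := by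
  obtain ⟨h1, h2, h3⟩ := mem_relZ.mp hv
  exact mem_absZ.mpr ⟨Submodule.sub_mem _ (c_mem_Pann 0 (K_le_Pann _ _ h1)) (K_le_Pann _ _ hχ),
    Submodule.sub_mem _ (by simpa using c_mem_Ndeg 0 h2) hχq, Dt_c_sub_primary h3 hχD⟩

include Y in
theorem c_sub_primary_mem_absB {χ : V} (hv : v ∈ X.relB m₀ 0) (hχ : χ ∈ X.K 0 m₀)
    (hχq : χ ∈ X.Ndeg 1) (hχD : X.Dt 0 χ = X.G.Q 0 v) : X.G.c 0 v - χ ∈ X.absB m₀ 1 := by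
  obtain ⟨w, h1, h2, rfl⟩ := mem_relB.mp hv
  rw [zero_sub] at h2
  obtain ⟨u, hu, huq, huD⟩ := exists_primitive_of_exact hm hm' hA Y h1 h2 hχ hχq hχD
  exact mem_absB.mpr ⟨u, hu, by rwa [sub_self], huD⟩

omit hm' hA in
theorem mem_relB_of_c_sub_mem_absB {χ : V} (hv : v ∈ X.K 0 m₀) (hχ : χ ∈ X.K 0 m₀)
    (h : X.G.c 0 v - χ ∈ X.absB m₀ 1) : v ∈ X.relB m₀ 0 := by
  obtain ⟨u, hu, huq, huD⟩ := mem_absB.mp h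
  rw [sub_self] at huq
  obtain ⟨w, h3, h4, h5⟩ := exists_relative_primitive' hm hu huq hv hχ huD
  exact mem_relB.mpr ⟨w, h3, by rwa [zero_sub], h5⟩

omit hA in
theorem exists_sub_c_mem_absB (hv : v ∈ X.absZ m₀ 1) : ∃ w ∈ X.relZ m₀ 0, ∃ χ ∈ X.K 0 m₀,
    χ ∈ X.Ndeg 1 ∧ X.Dt 0 χ = X.G.Q 0 w ∧ v - (X.G.c 0 w - χ) ∈ X.absB m₀ 1 := by
  obtain ⟨h1, h2, h3⟩ := mem_absZ.mp hv
  obtain ⟨w, hw, hwq, hwD, χ, hχ, hχq, hχD, u, hu, huq, huD⟩ :=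
    exists_relative_cocycle' hm hm' h1 h2 h3
  exact ⟨w, mem_relZ.mpr ⟨hw, hwq, hwD⟩, χ, hχ, hχq, hχD, mem_absB.mpr ⟨u, hu, by rwa [sub_self], huD⟩⟩

include Y in
theorem primary_sub_mem_absB {χ χ' : V} (hχ : χ ∈ X.K 0 m₀) (hχq : χ ∈ X.Ndeg 1)
    (hχD : X.Dt 0 χ = X.G.Q 0 v) (hχ' : χ' ∈ X.K 0 m₀) (hχ'q : χ' ∈ X.Ndeg 1)
    (hχ'D : X.Dt 0 χ' = X.G.Q 0 v) : χ - χ' ∈ X.absB m₀ 1 := by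
  obtain ⟨u, hu, huq, huD⟩ := exists_primitive_primary_sub hm hm' hA Y hχ hχq hχD hχ' hχ'q hχ'D
  exact mem_absB.mpr ⟨u, K_le_Pann _ _ hu, by rwa [sub_self], huD⟩

include Y hneg in
/-- Corrected multiplication by `c_0` is an isomorphism on cohomology. -/
theorem exists_linearEquiv_c : ∃ e : Subquot (X.relZ m₀ 0) (X.relB m₀ 0) ≃ₗ[ℂ]
    Subquot (X.absZ m₀ 1) (X.absB m₀ 1), ∀ (z : X.relZ m₀ 0) (χ : V), χ ∈ X.K 0 m₀ →
      χ ∈ X.Ndeg 1 → X.Dt 0 χ = X.G.Q 0 z → ∃ h : X.G.c 0 z - χ ∈ X.absZ m₀ 1,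
      e (Subquot.mk _ _ z) = Subquot.mk (X.absZ m₀ 1) (X.absB m₀ 1) ⟨X.G.c 0 z - χ, h⟩ := by
  obtain ⟨Q, hQ, -⟩ := exists_linear_primary hm hm' hA Y hneg
  obtain ⟨e, he⟩ := Subquot.exists_linearEquiv (Z₁ := X.relZ m₀ 0) (B₁ := X.relB m₀ 0)
    (Z₂ := X.absZ m₀ 1) (B₂ := X.absB m₀ 1) (X.G.c 0 ∘ₗ (X.relZ m₀ 0).subtype - Q)
    (fun z => c_sub_primary_mem_absZ z.2 (hQ z).1 (hQ z).2.1 (hQ z).2.2)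
    (fun z => ⟨mem_relB_of_c_sub_mem_absB hm (mem_relZ.mp z.2).1 (hQ z).1,
      fun h => c_sub_primary_mem_absB hm hm' hA Y h (hQ z).1 (hQ z).2.1 (hQ z).2.2⟩)
    fun v hv => by
      obtain ⟨w, hw, χ, hχ, hχq, hχD, h⟩ := exists_sub_c_mem_absB hm hm' hv
      obtain ⟨h1, h2, h3⟩ := hQ ⟨w, hw⟩
      refine ⟨⟨w, hw⟩, ?_⟩
      have := Submodule.sub_mem _ h (primary_sub_mem_absB hm hm' hA Y hχ hχq hχD h1 h2 h3)
      refine (congrArg (· ∈ X.absB m₀ 1) ?_).mp this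
      change _ = v - (X.G.c 0 w - Q ⟨w, hw⟩)
      abel
  -- The isomorphism was built from one linear choice; any other primary differs from it by a
  -- coboundary, so the class is unchanged.
  refine ⟨e, fun z χ hχ hχq hχD => ⟨c_sub_primary_mem_absZ z.2 hχ hχq hχD, ?_⟩⟩
  obtain ⟨h, hz⟩ := he z
  rw [hz]
  obtain ⟨h1, h2, h3⟩ := hQ z
  refine Subquot.mk_eq_mk ?_
  have := primary_sub_mem_absB hm hm' hA Y hχ hχq hχD h1 h2 h3
  refine (congrArg (· ∈ X.absB m₀ 1) ?_).mp this
  change _ = (X.G.c 0 (z : V) - Q z) - (X.G.c 0 (z : V) - χ)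
  abel

variable {Γ : Submodule ℂ W}
  (hΓ : ∀ v ∈ X.phys 0, X.vac v ∈ X.relB m₀ 0 ↔ v ∈ Γ)
  (hphys : ∀ u ∈ X.relZ m₀ 0, ∃ v ∈ X.phys 0, u - X.vac v ∈ X.relB m₀ 0)

omit hm' hA in
theorem vac_mem_relZ {v : W} (hv : v ∈ X.phys 0) : X.vac v ∈ X.relZ m₀ 0 :=
  mem_relZ.mpr ⟨vac_mem_K hm hv, vac_mem_Ndeg v, Dt_vac_eq_zero_iff.mpr hv⟩

omit hA in
include hneg hΓ hphys in
theorem exists_linearEquiv_phys : ∃ e : Subquot (X.phys 0) Γ ≃ₗ[ℂ]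
    Subquot (X.absZ m₀ 0) (X.absB m₀ 0), ∀ v : X.phys 0, ∃ h : X.vac v ∈ X.absZ m₀ 0,
      e (Subquot.mk _ _ v) = Subquot.mk (X.absZ m₀ 0) (X.absB m₀ 0) ⟨X.vac v, h⟩ :=
  Subquot.exists_linearEquiv (X.vac ∘ₗ (X.phys 0).subtype)
    (fun v => relZ_le_absZ (vac_mem_relZ hm v.2))
    (fun v => ⟨fun h => (hΓ v v.2).mp (mem_relB_of_mem_absB hm hneg (vac_mem_K hm v.2) h),
      fun h => relB_le_absB ((hΓ v v.2).mpr h)⟩) fun u hu => by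
      obtain ⟨w, hw, h⟩ := exists_sub_mem_absB hm hm' hneg hu
      obtain ⟨v, hv, h2⟩ := hphys w hw
      have := Submodule.add_mem _ h (relB_le_absB h2)
      rw [sub_add_sub_cancel] at this
      exact ⟨⟨v, hv⟩, this⟩

omit hm' hA in
theorem c_vac_mem_absZ {v : W} (hv : v ∈ X.phys 0) : X.G.c 0 (X.vac v) ∈ X.absZ m₀ 1 := by
  have := c_sub_primary_mem_absZ (vac_mem_relZ hm hv) (Submodule.zero_mem (X.K 0 m₀))
    (Submodule.zero_mem _) (by rw [Q_zero_vac, map_zero])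
  rwa [sub_zero] at this

include Y hΓ hphys in
-- The correction vanishes on physical states, so the general criterion for `c_0 Ψ - χ` applies with
-- `χ = 0`.
theorem exists_linearEquiv_cphys (hΓΦ : Γ ≤ X.phys 0) :
    ∃ e : Subquot ((X.phys 0).map (X.G.c 0 ∘ₗ X.vac)) (Γ.map (X.G.c 0 ∘ₗ X.vac)) ≃ₗ[ℂ]
      Subquot (X.absZ m₀ 1) (X.absB m₀ 1), ∀ u : (X.phys 0).map (X.G.c 0 ∘ₗ X.vac),
      ∃ h : (u : V) ∈ X.absZ m₀ 1,
        e (Subquot.mk _ _ u) = Subquot.mk (X.absZ m₀ 1) (X.absB m₀ 1) ⟨u, h⟩ := by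
  refine Subquot.exists_linearEquiv ((X.phys 0).map (X.G.c 0 ∘ₗ X.vac)).subtype ?_ ?_ ?_
  · rintro ⟨-, v, hv, rfl⟩
    exact c_vac_mem_absZ hm hv
  · rintro ⟨-, v, hv, rfl⟩
    constructor
    · intro h
      change X.G.c 0 (X.vac v) ∈ X.absB m₀ 1 at h
      rw [← sub_zero (X.G.c 0 (X.vac v))] at h
      exact ⟨v, (hΓ v hv).mp (mem_relB_of_c_sub_mem_absB hm (vac_mem_K hm hv)
        (Submodule.zero_mem _) h), rfl⟩
    · rintro ⟨w, hw, h⟩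
      change X.G.c 0 (X.vac v) ∈ X.absB m₀ 1
      change X.G.c 0 (X.vac w) = X.G.c 0 (X.vac v) at h
      rw [← h, ← sub_zero (X.G.c 0 (X.vac w))]
      exact c_sub_primary_mem_absB hm hm' hA Y ((hΓ w (hΓΦ hw)).mpr hw) (Submodule.zero_mem _)
        (Submodule.zero_mem _) (by rw [Q_zero_vac, map_zero])
  · intro u hu
    obtain ⟨w, hw, χ, hχ, hχq, hχD, h⟩ := exists_sub_c_mem_absB hm hm' hu
    obtain ⟨v, hv, h2⟩ := hphys w hw
    refine ⟨⟨_, v, hv, rfl⟩, ?_⟩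
    have := Submodule.add_mem _ h (c_sub_primary_mem_absB hm hm' hA Y h2 hχ hχq
      (by rw [hχD, map_sub, Q_zero_vac, sub_zero]))
    refine (congrArg (· ∈ X.absB m₀ 1) ?_).mp this
    change _ = u - X.G.c 0 (X.vac v)
    rw [map_sub]
    abel

end

end StringSystem

/-- In `{D, c_0}` the terms of index `k` and `-k` agree by anticommutation, and the one of index
zero is `c_0² = 0` with coefficient zero. -/
theorem GhostSystem.smul_eq_Q_zero {V : Type*} [AddCommGroup V] [Module ℂ V] (G : GhostSystem V)
    {Y : Module.End ℂ V} (hY : LocHasSum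
      (fun n : ℕ => ((n : ℂ) + 1) • (G.c (-((n : ℤ) + 1)) * G.c ((n : ℤ) + 1))) Y) :
    (-2 : ℂ) • Y = G.Q 0 := by
  have h1 := LocHasSum.int_split
    (F := fun k : ℤ => (-(2 * k + (0 : ℤ)) / 2 : ℂ) • (G.c (-k) * G.c (k + 0)))
    ((hY.smul (-1)).congr fun n => by
      rw [smul_smul, add_zero]
      congr 1
      push_cast
      ring)
    ((hY.smul (-1)).congr fun n => by
      rw [add_zero, neg_neg, G.c_mul_c ((n : ℤ) + 1), smul_neg, smul_smul, ← neg_smul]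
      congr 1
      push_cast
      ring)
  rw [(G.sumQ 0).unique h1, add_zero, neg_zero, G.c_mul_self, smul_zero]
  module

theorem ghM_eq : ghM = ghostSystem.Q 0 := ghostSystem.smul_eq_Q_zero (locHasSum_locSum _ _)

namespace StringSystem

variable {V W P : Type*} [AddCommGroup V] [Module ℂ V] [AddCommGroup W] [Module ℂ W]
  [Fintype P] [DecidableEq P] (X : StringSystem V W P)

theorem Dt_zero : X.Dt 0 = X.D := by simp [Dt]

theorem Lt_zero (m : ℤ) : X.Lt 0 m = X.Lmat m + X.G.L m := by simp [Lt]

variable {X} in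
theorem mem_Ndeg_iff_of_b_eq_zero {q : ℤ} {v : V} (hb : X.G.b 0 v = 0) :
    v ∈ X.Ndeg q ↔ X.G.N₀ v = (q : ℂ) • v := by
  rw [mem_Ndeg, X.G.N_eq]
  simp only [LinearMap.add_apply, LinearMap.sub_apply, Module.End.mul_apply, hb, map_zero,
    LinearMap.smul_apply, Module.End.one_apply, zero_sub, sub_smul, ← sub_eq_add_neg]
  exact sub_left_inj

end StringSystem

/-! ### Identification of the complexes at fixed momentum -/

namespace Model

variable (S : Model) (p : Fin S.d → ℝ)

theorem Ltot_eq (m : ℤ) : S.Ltot p m = (S.stringSystem p).Lt 0 m := by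
  have h : Module.End.rTensorAlgHom ℂ (Fock S.d) GhostSpace (S.Lshift p S.a m)
      = (S.stringSystem p).Lmat m := by
    rw [Lshift, map_sub, map_smul, map_one]
    rfl
  rw [(S.stringSystem p).Lt_zero m, ← h]
  rfl

theorem D_eq : S.D p = (S.stringSystem p).Dt 0 := (S.stringSystem p).Dt_zero.symm

theorem gh_ghM : S.gh ghM = (S.stringSystem p).G.Q 0 := by
  have h := map_add (Module.End.lTensorAlgHom ℂ GhostSpace (Fock S.d))
    (ghD * ghC 0) (ghC 0 * ghD)
  rw [map_mul, map_mul] at h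
  rw [ghM_eq]
  exact h

/-- `κ (m² - ξ) = κ (m² - 1) - 24 (1 - a)`: the number `ξ` is defined so that the zeros of the
anomaly coefficient with `m ≥ 1` are the integers `m` with `m² = ξ`. -/
theorem A_eq (hκ : S.κ ≠ 0) (m : ℤ) :
    (S.stringSystem p).A 0 m = ((S.κ * m / 12 * ((m : ℝ) ^ 2 - S.ξ) : ℝ) : ℂ) := by
  have hκ' : (S.κ : ℂ) ≠ 0 := Complex.ofReal_ne_zero.mpr hκ
  change (S.κ : ℂ) / 12 * ((m : ℂ) ^ 3 - m) - 2 * m * (1 - S.a + 0) = _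
  rw [ξ]
  push_cast
  field_simp
  ring

theorem A_eq_zero_iff (hκ : S.κ ≠ 0) {m : ℤ} (hm : 1 ≤ m) :
    (S.stringSystem p).A 0 m = 0 ↔ S.ξ = (m : ℝ) ^ 2 := by
  have hm' : (m : ℝ) ≠ 0 := Int.cast_ne_zero.mpr (by omega)
  rw [S.A_eq p hκ, Complex.ofReal_eq_zero, mul_eq_zero, sub_eq_zero, eq_comm (a := S.ξ)]
  exact or_iff_right (div_ne_zero (mul_ne_zero hκ hm') (by norm_num))

variable {S p}

/-- Each polarization condition reads `A_m c_m Ψ = 0`, and by assumption `A_m` vanishes for positive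
`m` exactly below `m₀`; the condition at `m = 0` is void because `A_0 = 0`. -/
theorem P_eq {m₀ : ℤ} (hm : 1 ≤ m₀)
    (hA : ∀ m : ℤ, 1 ≤ m → ((S.stringSystem p).A 0 m = 0 ↔ m < m₀)) :
    S.P p = (S.stringSystem p).Pann m₀ := by
  have h : ∀ m : ℕ, S.Ltot p m * S.D p - S.D p * S.Ltot p m
      = (S.stringSystem p).A 0 m • (S.stringSystem p).G.c m := fun m => by
    rw [S.Ltot_eq]
    exact (S.stringSystem p).Lt_comm_D m (by omega)
  ext v
  simp only [P, h, Submodule.mem_iInf, LinearMap.mem_ker]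
  constructor
  · intro hv n hn
    obtain ⟨k, rfl⟩ := Int.eq_ofNat_of_zero_le (by omega : 0 ≤ n)
    exact (smul_eq_zero.mp (hv k)).resolve_left fun h => by
      have := (hA k (by omega)).mp h
      omega
  · intro hv k
    by_cases hk : m₀ ≤ k
    · exact smul_eq_zero_of_right ((S.stringSystem p).A 0 k) (hv k hk)
    · have h0 : (S.stringSystem p).A 0 k = 0 := by
        rcases Nat.eq_zero_or_pos k with rfl | h0
        · exact (S.stringSystem p).A_zero 0
        · exact (hA k (by omega)).mpr (by omega)
      rw [h0]
      exact zero_smul ℂ ((S.stringSystem p).G.c k v)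

theorem Prel_eq {m₀ : ℤ} (hP : S.P p = (S.stringSystem p).Pann m₀) :
    S.Prel p = (S.stringSystem p).K 0 m₀ := by
  rw [Prel, hP, S.Ltot_eq]
  rfl

theorem Pdeg_eq {m₀ : ℤ} (hP : S.P p = (S.stringSystem p).Pann m₀) {r : ℚ} {q : ℤ}
    (hr : (r : ℂ) = q - 1 / 2) :
    S.Pdeg p r = (S.stringSystem p).Pann m₀ ⊓ (S.stringSystem p).Ndeg q := by
  rw [Pdeg, hP, hr]
  rfl

/-- The eigenvalues of the ghost number lie in `ℤ - 1/2`. -/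
theorem Pdeg_eq_bot {r : ℚ} (hr : ∀ q : ℤ, (r : ℂ) ≠ q - 1 / 2) : S.Pdeg p r = ⊥ :=
  (Submodule.eq_bot_iff _).mpr fun _ hu =>
    (S.stringSystem p).eq_zero_of_N_ne (fun q => (hr q).symm) (Module.End.mem_eigenspace_iff.mp hu.2)

theorem Z_eq {m₀ : ℤ} (hP : S.P p = (S.stringSystem p).Pann m₀) {r : ℚ} {q : ℤ}
    (hr : (r : ℂ) = q - 1 / 2) : S.Z p r = (S.stringSystem p).absZ m₀ q := by
  rw [Z, Pdeg_eq hP hr, S.D_eq]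
  rfl

theorem B_eq {m₀ : ℤ} (hP : S.P p = (S.stringSystem p).Pann m₀) {r : ℚ} {q : ℤ}
    (hr : (r : ℂ) = q - 1 / 2) : S.B p r = (S.stringSystem p).absB m₀ q := by
  rw [B, Pdeg_eq (q := q - 1) hP (by push_cast; rw [hr]; ring), S.D_eq]
  rfl

theorem PrelDeg_eq {m₀ : ℤ} (hP : S.P p = (S.stringSystem p).Pann m₀) (q : ℤ) :
    S.PrelDeg p q = (S.stringSystem p).K 0 m₀ ⊓ (S.stringSystem p).Ndeg q := by
  ext u
  rw [PrelDeg, Prel_eq hP, Submodule.mem_inf, Submodule.mem_inf]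
  refine and_congr_right fun hu => ?_
  exact Module.End.mem_eigenspace_iff.trans
    (StringSystem.mem_Ndeg_iff_of_b_eq_zero (StringSystem.mem_K.mp hu).2.2).symm

/-- On the mass shell `L_0^tot c_0 = c_0 L_0^tot` vanishes, and so does `b_0`; the relative
differential is the restriction of `D`. -/
theorem Drel_apply {m₀ : ℤ} {u : S.C} (hu : u ∈ (S.stringSystem p).K 0 m₀) :
    S.Drel p u = (S.stringSystem p).Dt 0 u := by
  obtain ⟨-, h1, h2⟩ := StringSystem.mem_K.mp hu
  change S.D p u - S.Ltot p 0 ((S.stringSystem p).G.c 0 u)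
    - S.gh ghM ((S.stringSystem p).G.b 0 u) = _
  rw [h2, map_zero, S.Ltot_eq, StringSystem.Lt_zero_c_zero, h1, map_zero, S.D_eq]
  exact (sub_zero _).trans (sub_zero _)

theorem Zrel_eq {m₀ : ℤ} (hP : S.P p = (S.stringSystem p).Pann m₀) (q : ℤ) :
    S.Zrel p q = (S.stringSystem p).relZ m₀ q := by
  ext u
  rw [Zrel, PrelDeg_eq hP, StringSystem.relZ, Submodule.mem_inf, Submodule.mem_inf]
  refine and_congr_right fun hu => ?_
  change S.Drel p u = 0 ↔ (S.stringSystem p).Dt 0 u = 0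
  rw [Drel_apply hu.1]

theorem Brel_eq {m₀ : ℤ} (hP : S.P p = (S.stringSystem p).Pann m₀) (q : ℤ) :
    S.Brel p q = (S.stringSystem p).relB m₀ q := by
  ext u
  rw [Brel, PrelDeg_eq hP, StringSystem.relB, Submodule.mem_map, Submodule.mem_map]
  refine exists_congr fun w => and_congr_right fun hw => ?_
  rw [Drel_apply hw.1]

theorem isPrimary_iff {m₀ : ℤ} (hP : S.P p = (S.stringSystem p).Pann m₀) {u χ : S.C} :
    S.IsPrimary p u χ ↔ χ ∈ (S.stringSystem p).K 0 m₀ ∧ χ ∈ (S.stringSystem p).Ndeg 1 ∧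
      (S.stringSystem p).Dt 0 χ = (S.stringSystem p).G.Q 0 u := by
  rw [IsPrimary, PrelDeg_eq hP, Submodule.mem_inf, and_assoc, S.gh_ghM p]
  refine and_congr_right fun h => ?_
  rw [Drel_apply h]

theorem highestWeight_eq {h : ℝ} {t : ℂ} (ht : (h : ℂ) = S.a - t) :
    S.highestWeight p h = (S.stringSystem p).phys t := by
  ext v
  rw [StringSystem.phys, highestWeight, Submodule.mem_iInf, Submodule.mem_iInf]
  refine forall_congr' fun m => ?_
  rw [LinearMap.mem_ker, LinearMap.mem_ker, LinearMap.comp_apply,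
    StringSystem.Lt_vac t (by omega : (0 : ℤ) ≤ m), Lshift, ht]
  exact (map_eq_zero_iff _ (S.stringSystem p).vac_injective).symm

theorem phys_eq : S.phys p = (S.stringSystem p).phys 0 := highestWeight_eq (sub_zero _).symm

theorem gauge_eq : S.gauge p = (S.stringSystem p).gauge := by
  rw [gauge, highestWeight_eq (t := 1) (by push_cast; rfl)]
  rfl

/-- A non-zero momentum component supplies the non-vanishing zero mode, `d ≥ 2` a second
polarisation to pair it with. The background charge sits in the Liouville direction only. -/
theorem exists_polarisations (hd : 2 ≤ S.d) (hα : 0 < S.α) (hp : p ≠ 0) :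
    ∃ s t, s ≠ t ∧ (S.stringSystem p).B.γ s = 0 ∧ (S.stringSystem p).B.γ t = 0 ∧
      (S.stringSystem p).B.z s ≠ 0 := by
  obtain ⟨μ, hμ⟩ := Function.ne_iff.mp hp
  have : Nontrivial (Fin S.d) := Fin.nontrivial_iff_two_le.mpr hd
  obtain ⟨ν, hν⟩ := exists_ne μ
  refine ⟨Sum.inl μ, Sum.inl ν, fun h => hν (Sum.inl_injective h).symm, rfl, rfl, ?_⟩
  change S.aZero p μ ≠ 0
  exact Complex.ofReal_ne_zero.mpr (div_ne_zero hμ (Real.sqrt_pos.mpr hα).ne')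

end Model

namespace Model

variable {S : Model} {p : Fin S.d → ℝ} {m₀ : ℤ}

theorem le_of_level (hm : 1 ≤ m₀) (hm' : m₀ ≤ 2)
    (hA : ∀ m, 1 ≤ m → m < m₀ → (S.stringSystem p).A 0 m = 0)
    (hP : S.P p = (S.stringSystem p).Pann m₀) :
    (∀ r : ℚ, S.B p r ≤ S.Z p r) ∧ ∀ r : ℤ, S.Brel p r ≤ S.Zrel p r := by
  refine ⟨fun r => ?_, fun r => ?_⟩
  · by_cases hr : ∃ q : ℤ, (r : ℂ) = q - 1 / 2
    · obtain ⟨q, hq⟩ := hr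
      rw [B_eq hP hq, Z_eq hP hq]
      exact StringSystem.absB_le_absZ hm hm' hA
    · rw [B, Pdeg_eq_bot fun q hq => hr ⟨q + 1, by
        push_cast at hq ⊢
        linear_combination hq⟩, Submodule.map_bot]
      exact bot_le
  · rw [Brel_eq hP, Zrel_eq hP]
    exact StringSystem.relB_le_relZ hm hm' hA

section

variable (hm : 1 ≤ m₀) (hm' : m₀ ≤ 2)
  (hA : ∀ m, 1 ≤ m → m < m₀ → (S.stringSystem p).A 0 m = 0)
  (hP : S.P p = (S.stringSystem p).Pann m₀) (Y : (S.stringSystem p).LightCone)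
  (hneg : ∀ q, q < 0 → ∀ v ∈ (S.stringSystem p).K 0 m₀, v ∈ (S.stringSystem p).Ndeg q →
    (S.stringSystem p).Dt 0 v = 0 → v = 0)
include hm hm' hP hneg

include hA Y in
theorem subsingleton_H {r : ℚ} (h1 : r ≠ 1 / 2) (h2 : r ≠ -1 / 2) : Subsingleton (S.H p r) := by
  refine Submodule.Quotient.subsingleton_iff.mpr (Submodule.submoduleOf_eq_top.mpr ?_)
  by_cases hr : ∃ q : ℤ, (r : ℂ) = q - 1 / 2
  · obtain ⟨q, hq⟩ := hr
    have hq' : r = q - 1 / 2 := by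
      have : (r : ℂ) = ((q - 1 / 2 : ℚ) : ℂ) := by
        rw [hq]
        push_cast
        rfl
      exact_mod_cast this
    rw [B_eq hP hq, Z_eq hP hq]
    refine StringSystem.absZ_le_absB hm hm' hA Y hneg (fun h => h2 ?_) fun h => h1 ?_
    · rw [hq', h]
      norm_num
    · rw [hq', h]
      norm_num
  · rw [Z, Pdeg_eq_bot fun q hq => hr ⟨q, hq⟩, bot_inf_eq]
    exact bot_le

theorem exists_linearEquiv_neg : ∃ e : S.Hrel p 0 ≃ₗ[ℂ] S.H p (-1 / 2), ∀ Ψ : S.Zrel p 0,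
    ∃ h : (Ψ : S.C) ∈ S.Z p (-1 / 2), e (S.clsRel p 0 Ψ) = S.cls p (-1 / 2) ⟨Ψ, h⟩ := by
  have h := StringSystem.exists_linearEquiv_rel hm hm' hneg
  rw [← Zrel_eq hP, ← Brel_eq hP, ← Z_eq hP (r := -1 / 2) (by norm_num),
    ← B_eq hP (r := -1 / 2) (by norm_num)] at h
  exact h

include hA Y

theorem exists_linear_primary : ∃ Q : S.Zrel p 0 →ₗ[ℂ] S.C,
    (∀ Ψ : S.Zrel p 0, S.IsPrimary p Ψ (Q Ψ)) ∧
      ∀ χ ∈ S.PrelDeg p (-1), ∀ h : S.Drel p χ ∈ S.Zrel p 0,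
        Q ⟨S.Drel p χ, h⟩ = S.gh ghM χ := by
  have h := StringSystem.exists_linear_primary hm hm' hA Y hneg
  rw [← Zrel_eq hP] at h
  obtain ⟨Q, h1, h2⟩ := h
  refine ⟨Q, fun Ψ => (isPrimary_iff hP).mpr (h1 Ψ), fun χ hχ h => ?_⟩
  rw [PrelDeg_eq hP] at hχ
  have e := Drel_apply hχ.1
  have h' := h
  rw [e] at h'
  rw [S.gh_ghM p, ← h2 χ hχ.1 hχ.2 h']
  exact congrArg Q (Subtype.ext e)

theorem exists_linearEquiv_pos : ∃ e : S.Hrel p 0 ≃ₗ[ℂ] S.H p (1 / 2),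
    ∀ (Ψ : S.Zrel p 0) (χ : S.C), S.IsPrimary p Ψ χ →
      ∃ h : S.gh (ghC 0) Ψ - χ ∈ S.Z p (1 / 2),
        e (S.clsRel p 0 Ψ) = S.cls p (1 / 2) ⟨S.gh (ghC 0) Ψ - χ, h⟩ := by
  have h := StringSystem.exists_linearEquiv_c hm hm' hA Y hneg
  rw [← Zrel_eq hP, ← Brel_eq hP, ← Z_eq hP (r := 1 / 2) (by norm_num),
    ← B_eq hP (r := 1 / 2) (by norm_num)] at h
  obtain ⟨e, he⟩ := h
  exact ⟨e, fun Ψ χ hχ => he Ψ χ ((isPrimary_iff hP).mp hχ).1 ((isPrimary_iff hP).mp hχ).2.1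
    ((isPrimary_iff hP).mp hχ).2.2⟩

theorem exists_linearEquiv_phys {Γ : Submodule ℂ (Fock S.d)} (hΓΦ : Γ ≤ S.phys p)
    (hΓ : ∀ v ∈ S.phys p, S.vac v ∈ S.Brel p 0 ↔ v ∈ Γ)
    (hphys : ∀ u ∈ S.Zrel p 0, ∃ v ∈ S.phys p, u - S.vac v ∈ S.Brel p 0) :
    (∃ e : Subquot (S.phys p) Γ ≃ₗ[ℂ] S.H p (-1 / 2), ∀ v : S.phys p,
      ∃ h : S.vac v ∈ S.Z p (-1 / 2),
        e (Subquot.mk (S.phys p) Γ v) = S.cls p (-1 / 2) ⟨S.vac v, h⟩) ∧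
    ∃ e : Subquot (S.cphys p) (Γ.map S.cvac) ≃ₗ[ℂ] S.H p (1 / 2), ∀ Ψ : S.cphys p,
      ∃ h : (Ψ : S.C) ∈ S.Z p (1 / 2),
        e (Subquot.mk (S.cphys p) (Γ.map S.cvac) Ψ) = S.cls p (1 / 2) ⟨Ψ, h⟩ := by
  rw [phys_eq, Brel_eq hP] at hΓ hphys
  rw [phys_eq] at hΓΦ
  rw [Zrel_eq hP] at hphys
  have h1 := StringSystem.exists_linearEquiv_phys hm hm' hneg hΓ hphys
  have h2 := StringSystem.exists_linearEquiv_cphys hm hm' hA Y hΓ hphys hΓΦ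
  rw [← phys_eq, ← Z_eq hP (r := -1 / 2) (by norm_num),
    ← B_eq hP (r := -1 / 2) (by norm_num)] at h1
  rw [← phys_eq, ← Z_eq hP (r := 1 / 2) (by norm_num),
    ← B_eq hP (r := 1 / 2) (by norm_num)] at h2
  exact ⟨h1, h2⟩

end

end Model

end AnomalousString

end

theorem theorem3p2 (S : Model) (hd : 2 ≤ S.d) (hα : 0 < S.α) (hκ : S.κ ≠ 0)
    (hξ : ∀ s : ℕ, 2 ≤ s → S.ξ ≠ (s : ℝ) ^ 2) (p : Fin S.d → ℝ) (hp : p ≠ 0) :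
    -- the polarized complex and its relative version are complexes
    (∀ r : ℚ, S.B p r ≤ S.Z p r) ∧ (∀ r : ℤ, S.Brel p r ≤ S.Zrel p r) ∧
    -- vanishing outside the degrees `±1/2`
    (∀ r : ℚ, r ≠ 1 / 2 → r ≠ -1 / 2 → Subsingleton (S.H p r)) ∧
    -- the inclusion induces an isomorphism
    (∃ e : S.Hrel p 0 ≃ₗ[ℂ] S.H p (-1 / 2), ∀ Ψ : S.Zrel p 0,
      ∃ h : (Ψ : S.C) ∈ S.Z p (-1 / 2), e (S.clsRel p 0 Ψ) = S.cls p (-1 / 2) ⟨Ψ, h⟩) ∧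
    -- primaries can be chosen linearly, and so that the primary of `M D_rel χ` is `M χ`
    (∃ Q : S.Zrel p 0 →ₗ[ℂ] S.C, (∀ Ψ : S.Zrel p 0, S.IsPrimary p Ψ (Q Ψ)) ∧
      ∀ χ ∈ S.PrelDeg p (-1), ∀ h : S.Drel p χ ∈ S.Zrel p 0,
        Q ⟨S.Drel p χ, h⟩ = S.gh ghM χ) ∧
    -- corrected multiplication by `c_0` induces an isomorphism, for every choice of primaries
    (∃ e : S.Hrel p 0 ≃ₗ[ℂ] S.H p (1 / 2), ∀ (Ψ : S.Zrel p 0) (χ : S.C), S.IsPrimary p Ψ χ →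
      ∃ h : S.gh (ghC 0) Ψ - χ ∈ S.Z p (1 / 2),
        e (S.clsRel p 0 Ψ) = S.cls p (1 / 2) ⟨S.gh (ghC 0) Ψ - χ, h⟩) ∧
    -- identification with physical states, non-degenerate anomaly
    (S.ξ ≠ 1 →
      (∃ e : S.phys p ≃ₗ[ℂ] S.H p (-1 / 2), ∀ v : S.phys p,
        ∃ h : S.vac v ∈ S.Z p (-1 / 2), e v = S.cls p (-1 / 2) ⟨S.vac v, h⟩) ∧
      (∃ e : S.cphys p ≃ₗ[ℂ] S.H p (1 / 2), ∀ Ψ : S.cphys p,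
        ∃ h : (Ψ : S.C) ∈ S.Z p (1 / 2), e Ψ = S.cls p (1 / 2) ⟨Ψ, h⟩)) ∧
    -- identification with physical states, degenerate anomaly
    (S.ξ = 1 →
      S.gauge p ≤ S.phys p ∧
      (∃ e : Subquot (S.phys p) (S.gauge p) ≃ₗ[ℂ] S.H p (-1 / 2),
        ∀ v : S.phys p, ∃ h : S.vac v ∈ S.Z p (-1 / 2),
          e (Subquot.mk (S.phys p) (S.gauge p) v) = S.cls p (-1 / 2) ⟨S.vac v, h⟩) ∧
      (∃ e : Subquot (S.cphys p) (S.cgauge p) ≃ₗ[ℂ] S.H p (1 / 2),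
        ∀ Ψ : S.cphys p, ∃ h : (Ψ : S.C) ∈ S.Z p (1 / 2),
          e (Subquot.mk (S.cphys p) (S.cgauge p) Ψ) = S.cls p (1 / 2) ⟨Ψ, h⟩)) := by
  obtain ⟨s, t, hst, hs, ht, hz⟩ := Model.exists_polarisations hd hα hp
  obtain ⟨Y⟩ := StringSystem.nonempty_lightCone _ hst hs ht hz
  -- The alternative fixes the level: `A_1 = 0` exactly when `ξ = 1`, and then `m₀ = 2`; otherwise
  -- no `A_m` with `m ≥ 1` vanishes and `m₀ = 1`.
  by_cases h1 : S.ξ = 1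
  · have hA0 : (S.stringSystem p).A 0 1 = 0 := (S.A_eq_zero_iff p hκ le_rfl).mpr (by simp [h1])
    have hA : ∀ m : ℤ, 1 ≤ m → ((S.stringSystem p).A 0 m = 0 ↔ m < 2) := fun m hm => by
      refine ⟨fun h => ?_, fun h => ?_⟩
      · rw [S.A_eq_zero_iff p hκ hm, h1] at h
        have h2 : (1 : ℤ) = m ^ 2 := by exact_mod_cast h
        nlinarith
      · obtain rfl : m = 1 := by omega
        exact hA0
    have hP := Model.P_eq one_le_two hA
    have hA' : ∀ m, 1 ≤ m → m < 2 → (S.stringSystem p).A 0 m = 0 := fun m h => (hA m h).mpr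
    have hneg : ∀ q, q < 0 → ∀ v ∈ (S.stringSystem p).K 0 2, v ∈ (S.stringSystem p).Ndeg q →
        (S.stringSystem p).Dt 0 v = 0 → v = 0 := fun q hq v hv hvq hD =>
      StringSystem.eq_zero_of_neg_of_closed hs hz hq hv hvq hD
    have hle := Model.le_of_level one_le_two le_rfl hA' hP
    have hgauge : S.gauge p ≤ S.phys p := by
      rw [Model.gauge_eq, Model.phys_eq]
      exact StringSystem.gauge_le_phys hA0
    refine ⟨hle.1, hle.2,
      fun r => Model.subsingleton_H one_le_two le_rfl hA' hP Y hneg,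
      Model.exists_linearEquiv_neg one_le_two le_rfl hP hneg,
      Model.exists_linear_primary one_le_two le_rfl hA' hP Y hneg,
      Model.exists_linearEquiv_pos one_le_two le_rfl hA' hP Y hneg,
      fun h => absurd h1 h, fun _ => ⟨hgauge, ?_⟩⟩
    refine Model.exists_linearEquiv_phys one_le_two le_rfl hA' hP Y hneg hgauge
      (fun v _ => ?_) fun u hu => ?_
    · rw [Model.gauge_eq, Model.Brel_eq hP]
      exact StringSystem.mem_relB.trans StringSystem.exists_primitive_vac_iff
    · rw [Model.Zrel_eq hP] at hu
      obtain ⟨h2, h3, h4⟩ := StringSystem.mem_relZ.mp hu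
      obtain ⟨v, hv, h⟩ := StringSystem.exists_phys_cohomologous Y hA0 h2 h3 h4
      rw [Model.phys_eq, Model.Brel_eq hP]
      exact ⟨v, hv, StringSystem.mem_relB.mpr h⟩
  · have hA : ∀ m : ℤ, 1 ≤ m → ((S.stringSystem p).A 0 m = 0 ↔ m < 1) := fun m hm => by
      refine ⟨fun h => ?_, fun h => by omega⟩
      rw [S.A_eq_zero_iff p hκ hm] at h
      obtain ⟨k, rfl⟩ := Int.eq_ofNat_of_zero_le (by omega : 0 ≤ m)
      rcases hm.eq_or_lt with h2 | h2
      · rw [← h2] at h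
        exact absurd (by simpa using h) h1
      · exact absurd (by simpa using h) (hξ k (by omega))
    have hP := Model.P_eq le_rfl hA
    have hA' : ∀ m, 1 ≤ m → m < 1 → (S.stringSystem p).A 0 m = 0 := fun m h => (hA m h).mpr
    -- At level one there are no cochains of negative degree at all, closed or not.
    have hneg : ∀ q, q < 0 → ∀ v ∈ (S.stringSystem p).K 0 1, v ∈ (S.stringSystem p).Ndeg q →
        (S.stringSystem p).Dt 0 v = 0 → v = 0 := fun q hq v hv hvq _ =>
      StringSystem.eq_zero_of_mem_Pann_one (StringSystem.mem_K.mp hv).1 hvq hq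
    have hle := Model.le_of_level le_rfl one_le_two hA' hP
    refine ⟨hle.1, hle.2,
      fun r => Model.subsingleton_H le_rfl one_le_two hA' hP Y hneg,
      Model.exists_linearEquiv_neg le_rfl one_le_two hP hneg,
      Model.exists_linear_primary le_rfl one_le_two hA' hP Y hneg,
      Model.exists_linearEquiv_pos le_rfl one_le_two hA' hP Y hneg,
      fun _ => ?_, fun h => absurd h h1⟩
    -- For the same reason there are no coboundaries in degree zero, and the gauge space is taken to
    -- be `⊥`.
    have hbot : ∀ u ∈ S.Brel p 0, u = 0 := fun u hu => by
      rw [Model.Brel_eq hP] at hu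
      obtain ⟨w, h2, h3, rfl⟩ := StringSystem.mem_relB.mp hu
      rw [StringSystem.eq_zero_of_mem_Pann_one (StringSystem.mem_K.mp h2).1 h3 (by norm_num),
        map_zero]
    have key := Model.exists_linearEquiv_phys le_rfl one_le_two hA' hP Y hneg
      (Γ := ⊥) bot_le
      (fun v _ => ⟨fun h => (map_eq_zero_iff _ (S.stringSystem p).vac_injective).mp (hbot _ h),
        fun h => by
          rw [(Submodule.mem_bot ℂ).mp h, map_zero]
          exact Submodule.zero_mem _⟩) fun u hu => by
        rw [Model.Zrel_eq hP] at hu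
        obtain ⟨h2, h3, h4⟩ := StringSystem.mem_relZ.mp hu
        obtain ⟨v, hv, h⟩ := StringSystem.exists_phys_of_mem_K_one h2 h3 h4
        rw [Model.phys_eq]
        refine ⟨v, hv, ?_⟩
        rw [← h, show S.vac v = (S.stringSystem p).vac v from rfl, sub_self]
        exact Submodule.zero_mem _
    obtain ⟨e₁, he₁⟩ := Subquot.exists_linearEquiv_bot (S.phys p)
    obtain ⟨e₂, he₂⟩ := Subquot.exists_linearEquiv_bot (S.cphys p)
    rw [Submodule.map_bot] at key
    obtain ⟨⟨e, he⟩, e', he'⟩ := key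
    refine ⟨⟨e₁.trans e, fun v => ?_⟩, e₂.trans e', fun Ψ => ?_⟩
    · obtain ⟨h, h2⟩ := he v
      exact ⟨h, by rw [LinearEquiv.trans_apply, he₁, h2]⟩
    · obtain ⟨h, h2⟩ := he' Ψ
      exact ⟨h, by rw [LinearEquiv.trans_apply, he₂, h2]⟩
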